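/- **Theorem (Free Construction, autonomous case).** *Multicategories.* A multicategory has objects, sets $M(a_1,\dots,a_n;b)$ of multiarrows for all finite (possibly empty) lists of objects, identities $id_a\in M(a;a)$ and an associative unital composition $f\circ\langle g_1,\dots,g_n\rangle\in M(\gamma_1,\dots,\gamma_n;b)$ for $f\in M(a_1,\dots,a_n;b)$, $g_i\in M(\gamma_i;a_i)$. It is *symmetric* if it carries a right action $f\mapsto f\cdot\sigma$, $M(a_1,\dots,a_n;b)\to M(a_{\sigma(1)},\dots,a_{\sigma(n)};b)$, of permutations, compatible with composition: $(f\cdot\sigma)\circ\langle g_{\sigma(1)}\cdot\pi_{\sigma(1)},\dots,g_{\sigma(n)}\cdot\pi_{\sigma(n)}\rangle=(f\circ\langle g_1,\dots,g_n\rangle)\cdot\rho$, where $\rho$ is the block permutation induced by $\sigma$ and the $\pi_i$. It is *representable* if it carries objects $(a_1\otimes\dots\otimes a_k)$ and multiarrows $\mathsf{re}:a_1,\dots,a_k\to(a_1\otimes\dots\otimes a_k)$, for all $k\ge 0$ and all $a_1,\dots,a_k$, such that all maps $f\mapsto f\circ\langle id_\gamma,\mathsf{re},id_\delta\rangle$,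 $M(\gamma,(a_1\otimes\dots\otimes a_k),\delta;b)\to M(\gamma,a_1,\dots,a_k,\delta;b)$, are bijective. It is *closed* if it carries objects $(a_1\otimes\dots\otimes a_k)\multimap b$ and multiarrows $\mathsf{ev}:((a_1\otimes\dots\otimes a_k)\multimap b),a_1,\dots,a_k\to b$, for all $k\ge 0$ and all $a_1,\dots,a_k,b$, such that all maps $f\mapsto\mathsf{ev}\circ\langle f,id_{a_1},\dots,id_{a_k}\rangle$, $M(\gamma;(a_1\otimes\dots\otimes a_k)\multimap b)\to M(\gamma,a_1,\dots,a_k;b)$, are bijective. (These bijections are then automatically natural.) An *autonomous multicategory* is a symmetric representable closed one, and an *autonomous functor* is a functor of multicategories that strictly preserves the symmetric action, the objects $(a_1\otimes\dots\otimes a_k)$ and $(a_1\otimes\dots\otimes a_k)\multimap b$, and the multiarrows $\mathsf{re}$ and $\mathsf{ev}$. *Signatures.* An autonomous signature $\mathcal A$ consists of a set of atoms and of a multigraph $\mathcal A$ (a set of multiarrows $\mathcal A(a_1,\dots,a_n;b)$ for all nodes $a_1,\dots,a_n,b$) whose nodes are the types $a::=o\mid(a_1\otimes\dots\otimes a_k)\mid(a_1\otimes\dots\otimes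 a_k)\multimap a$, where $o$ is an atom and $k\in\mathbb N$. A map of autonomous signatures $i$ from $\mathcal A$ to (the signature $\overline{\mathsf S}$ underlying) an autonomous multicategory $\mathsf S$ is a morphism of multigraphs from $\mathcal A$ to $\mathsf S$ with $i(a_1\otimes\dots\otimes a_k)=(i(a_1)\otimes\dots\otimes i(a_k))$ and $i((a_1\otimes\dots\otimes a_k)\multimap a)=(i(a_1)\otimes\dots\otimes i(a_k))\multimap i(a)$. *Terms.* The autonomous resource terms over $\mathcal A$, taken up to renaming of bound variables, are $$s,t::=x\mid\lambda\langle x_1^{a_1},\dots,x_k^{a_k}\rangle.s\mid s\,t\mid\langle s_1,\dots,s_k\rangle\mid s[x_1^{a_1},\dots,x_k^{a_k}:=t]\mid f(s_1,\dots,s_k),$$ with $k\in\mathbb N$ and $f$ a multiarrow of $\mathcal A$; $\lambda\langle\vec x\rangle.s$ and $s[\vec x:=t]$ bind $\vec x$ in $s$. The typing rules are as follows, where contexts are lists of distinct variables with types, contexts that are combined are disjoint, and $\Theta$ is any shuffle (interleaving that keeps the order in each list) of the contexts that are combined: $x:a\vdash x:a$; if $\gamma_i\vdash s_i:a_i$ for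 all $i$, then $\Theta\vdash\langle s_1,\dots,s_k\rangle:(a_1\otimes\dots\otimes a_k)$ and, for $f\in\mathcal A(a_1,\dots,a_k;b)$, $\Theta\vdash f(s_1,\dots,s_k):b$, with $\Theta$ a shuffle of $\gamma_1,\dots,\gamma_k$; if $\gamma,x_1:a_1,\dots,x_k:a_k\vdash s:b$ then $\gamma\vdash\lambda\langle x_1^{a_1},\dots,x_k^{a_k}\rangle.s:(a_1\otimes\dots\otimes a_k)\multimap b$; if $\gamma\vdash s:(a_1\otimes\dots\otimes a_k)\multimap b$ and $\delta\vdash t:(a_1\otimes\dots\otimes a_k)$ then $\Theta\vdash s\,t:b$, with $\Theta$ a shuffle of $\gamma,\delta$; if $\gamma\vdash s:(a_1\otimes\dots\otimes a_k)$ and $\delta_1,x_1:a_1,\dots,x_k:a_k,\delta_2\vdash t:b$ then $\Theta\vdash t[x_1^{a_1},\dots,x_k^{a_k}:=s]:b$, with $\Theta$ a shuffle of $\gamma,\delta_1,\delta_2$. Let $\Lambda(\mathcal A)(a_1,\dots,a_n;b)$ be the set of terms $s$ with $x_1:a_1,\dots,x_n:a_n\vdash s:b$, up to renaming of the $x_i$.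 *Reduction and structural equivalence.* Let $\mathtt C$ range over all contexts with one hole, $\mathtt E$ over those whose hole is not the argument $t$ of a substitution $s[\vec x:=t]$, $\mathtt D$ over those whose hole is not the function $s$ of an application $s\,t$, and $\mathtt L$ over the contexts $\mathtt L::=[\cdot]\mid\mathtt L[\vec x:=t]$. The reduction $\to_{\mathsf{aut}}$ on typed terms is given by the following rules, where $s\{\vec t/\vec x\}$ is capture-avoiding substitution and the variables bound by $\mathtt L$ in the $\beta$ rules are fresh: in all contexts $\mathtt C$, $\ s[\vec x:=\mathtt L[\langle t_1,\dots,t_k\rangle]]\to\mathtt L[s\{\vec t/\vec x\}]$ and $(\mathtt L[\lambda\langle\vec x\rangle.s])\langle t_1,\dots,t_k\rangle\to\mathtt L[s\{\vec t/\vec x\}]$; in contexts $\mathtt E$, $\ s\to\langle\vec x\rangle[\vec x:=s]$ if $s$ has a type $(a_1\otimes\dots\otimes a_k)$ and is not of the form $\mathtt L[\langle\vec t\rangle]$; in contexts $\mathtt D$, $\ s\to\lambda\langle\vec x\rangle.(s\langle\vec x\rangle)$ if $s$ has a type $(a_1\otimes\dots\otimes a_k)\multimap b$ and is not of the form $\mathtt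 L[\lambda\langle\vec y\rangle.t]$; in the last two rules $\vec x$ is a fresh list $x_1^{a_1},\dots,x_k^{a_k}$. Structural equivalence $\equiv$ is the smallest congruence with $\mathtt C[s[\vec x:=t]]\equiv\mathtt C[s][\vec x:=t]$ whenever $\mathtt C$ does not bind variables of $t$ and $\vec x$ are not free in $\mathtt C$. Let $=_{\mathsf{aut}}$ be the equivalence relation generated by $\to_{\mathsf{aut}}$ on each set $\Lambda(\mathcal A)(\gamma;b)$, and let $\sim$ be the equivalence relation on it generated by $\equiv\cup=_{\mathsf{aut}}$. *Statement.* Let $\mathcal A$ be an autonomous signature. The sets $\Lambda(\mathcal A)(\gamma;b)/{\sim}$ are the multiarrows of an autonomous multicategory $\mathsf{Aut}(\mathcal A)$ whose objects are the nodes of $\mathcal A$. Its identities are the classes of the variables; its composition is given by (well-defined) substitution, $[s]\circ\langle[t_1],\dots,[t_n]\rangle=[s\{t_1,\dots,t_n/x_1,\dots,x_n\}]$; permutations act by permuting (renaming) the variables of the context; $(a_1\otimes\dots\otimes a_k)$ and $(a_1\otimes\dots\otimes a_k)\multimap b$ are the types so written; $\mathsf{re}=[\langle x_1,\dots,x_k\rangle]$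 and $\mathsf{ev}=[x_0\langle x_1,\dots,x_k\rangle]$. Let $\eta_{\mathcal A}$ be the inclusion of $\mathcal A$ in $\mathsf{Aut}(\mathcal A)$, which is the identity on nodes and sends $f$ to $[f(x_1,\dots,x_n)]$. Then for every autonomous multicategory $\mathsf S$ and every map of autonomous signatures $i:\mathcal A\to\overline{\mathsf S}$ there is a unique autonomous functor $i^*:\mathsf{Aut}(\mathcal A)\to\mathsf S$ such that $\overline{i^*}\circ\eta_{\mathcal A}=i$. -/

import Mathlib

universe u v u₁ v₁ u₂ v₂

/-! ## Multicategories -/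

/-- `Tuple H Γ as` is the type of tuples `⟨g₁, …, gₙ⟩` with `as = a₁, …, aₙ`, with multiarrows
`gᵢ : γᵢ → aᵢ` of the multigraph `H`, and with `Γ = γ₁, …, γₙ` (concatenation). -/
inductive Tuple {O : Type u} (H : List O → O → Type v) : List O → List O → Type (max u v)
  | nil : Tuple H [] []
  | cons {γ δ Γ : List O} {a : O} {as : List O} (g : H γ a) (gs : Tuple H δ as)
      (h : Γ = γ ++ δ) : Tuple H Γ (a :: as)

namespace Tuple

variable {O : Type u} {H : List O → O → Type v}

/-- Juxtaposition of tuples. -/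
def append {Γ Δ as bs : List O} : Tuple H Γ as → Tuple H Δ bs → Tuple H (Γ ++ Δ) (as ++ bs)
  | .nil, ts => ts
  | .cons g gs h, ts => .cons g (gs.append ts) (by rw [h, List.append_assoc])

/-- The tuple of identities, given a family `i` of multiarrows `a → a`. -/
def ids (i : ∀ a, H [a] a) : ∀ as : List O, Tuple H as as
  | [] => .nil
  | a :: as => .cons (i a) (ids i as) rfl

/-- A tuple over a concatenation is the juxtaposition of two tuples. -/
def split {Γ bs : List O} : ∀ as : List O, Tuple H Γ (as ++ bs) →
    Σ' (Γ₁ Γ₂ : List O) (_ : Tuple H Γ₁ as) (_ : Tuple H Γ₂ bs), Γ = Γ₁ ++ Γ₂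
  | [], t => ⟨[], Γ, .nil, t, rfl⟩
  | _ :: as, .cons (γ := γ) g gs h =>
    match split as gs with
    | ⟨Γ₁, Γ₂, t₁, t₂, e⟩ => ⟨γ ++ Γ₁, Γ₂, .cons g t₁ rfl, t₂, by rw [h, e, List.append_assoc]⟩

/-- Componentwise composition of tuples:
`⟨g₁, …, gₙ⟩ ∘ (h⃗₁, …, h⃗ₙ) = ⟨g₁ ∘ h⃗₁, …, gₙ ∘ h⃗ₙ⟩`. -/
def comp (c : ∀ {Γ as : List O} {b : O}, H as b → Tuple H Γ as → H Γ b) {Γ Δ as : List O} :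
    Tuple H Γ as → Tuple H Δ Γ → Tuple H Δ as
  | .nil, ts => ts
  | .cons (γ := γ) g gs rfl, ts =>
    match split γ ts with
    | ⟨_, _, t₁, t₂, e⟩ => .cons (c g t₁) (gs.comp c t₂) e

/-- The tuple `⟨g₀, …, gₙ₋₁⟩` of a family of multiarrows. -/
def ofFn : ∀ {n : ℕ} {γ : Fin n → List O} {a : Fin n → O} {Γ : List O},
    (∀ i, H (γ i) (a i)) → Γ = (List.ofFn γ).flatten → Tuple H Γ (List.ofFn a)
  | 0, _, _, _, _, h => by
    rw [h, List.ofFn_zero, List.ofFn_zero]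
    exact .nil
  | n + 1, γ, a, Γ, g, h => by
    rw [List.ofFn_succ]
    exact .cons (g 0) (ofFn (fun i : Fin n => g i.succ) rfl)
      (by rw [h, List.ofFn_succ, List.flatten_cons])

/-- The action of a map of multigraphs on tuples. -/
def map {O' : Type u₁} {H' : List O' → O' → Type v₁} (F : O → O')
    (m : ∀ {as : List O} {b : O}, H as b → H' (as.map F) (F b)) {Γ as : List O} :
    Tuple H Γ as → Tuple H' (Γ.map F) (as.map F)
  | .nil => .nil
  | .cons g gs h => .cons (m g) (gs.map F m) (by rw [h, List.map_append])

/-- The action on tuples of a map of multigraphs that is the identity on nodes. -/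
def mapHom {H' : List O → O → Type v₁} (m : ∀ {as : List O} {b : O}, H as b → H' as b)
    {Γ as : List O} : Tuple H Γ as → Tuple H' Γ as
  | .nil => .nil
  | .cons g gs h => .cons (m g) (gs.mapHom m) h

end Tuple

/-- A multicategory structure on the multigraph with nodes `O` and multiarrows `H`. -/
structure Multicategory (O : Type u) (H : List O → O → Type v) where
  id (a : O) : H [a] a
  /-- `comp f ⟨g₁, …, gₙ⟩ = f ∘ ⟨g₁, …, gₙ⟩` -/
  comp {Γ as : List O} {b : O} : H as b → Tuple H Γ as → H Γ b
  id_comp {Γ : List O} {b : O} (f : H Γ b) :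
    comp (id b) (.cons f .nil (List.append_nil Γ).symm) = f
  comp_id {as : List O} {b : O} (f : H as b) : comp f (Tuple.ids id as) = f
  assoc {Δ Γ as : List O} {b : O} (f : H as b) (gs : Tuple H Γ as) (hs : Tuple H Δ Γ) :
    comp (comp f gs) hs = comp f (gs.comp comp hs)

/-- The concatenation of the lists `c i`, as a single indexed family. -/
def blockConcat {α : Type u} {n : ℕ} {k : Fin n → ℕ} (c : ∀ i, Fin (k i) → α) :
    Fin (∑ i, k i) → α :=
  fun p => c (finSigmaFinEquiv.symm p).1 (finSigmaFinEquiv.symm p).2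

/-- The block permutation that sends the `j`-th place of the `i`-th block to the place
`π (σ i) j` of the block `σ i`. -/
def blockPerm {n : ℕ} {k : Fin n → ℕ} (σ : Equiv.Perm (Fin n)) (π : ∀ i, Equiv.Perm (Fin (k i))) :
    Fin (∑ i, k (σ i)) ≃ Fin (∑ i, k i) :=
  finSigmaFinEquiv.symm.trans
    (((Equiv.sigmaCongrRight fun i => π (σ i)).trans
      (Equiv.sigmaCongrLeft (β := fun i => Fin (k i)) σ)).trans finSigmaFinEquiv)

theorem blockConcat_apply {α : Type u} {n : ℕ} {k : Fin n → ℕ} (c : ∀ i, Fin (k i) → α)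
    (q : Σ i, Fin (k i)) : blockConcat c (finSigmaFinEquiv q) = c q.1 q.2 := by
  unfold blockConcat
  rw [Equiv.symm_apply_apply]

theorem ofFn_blockConcat {α : Type u} {n : ℕ} {k : Fin n → ℕ} (c : ∀ i, Fin (k i) → α) :
    List.ofFn (blockConcat c) = (List.ofFn fun i => List.ofFn (c i)).flatten := by
  induction n with
  | zero => simp
  | succ n ih =>
    have hs : ∑ i, k i = (∑ i : Fin n, k i.castSucc) + k (Fin.last n) := Fin.sum_univ_castSucc k
    have key : blockConcat c = fun p =>
        Fin.append (blockConcat fun i : Fin n => c i.castSucc) (c (Fin.last n)) (Fin.cast hs p) := by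
      funext p
      obtain ⟨⟨i, j⟩, rfl⟩ := finSigmaFinEquiv.surjective p
      rw [blockConcat_apply]
      induction i using Fin.lastCases with
      | last =>
        have : Fin.cast hs (finSigmaFinEquiv ⟨Fin.last n, j⟩) = Fin.natAdd _ j := by
          ext
          simp [finSigmaFinEquiv_apply]
          rfl
        rw [this, Fin.append_right]
      | cast i =>
        have : Fin.cast hs (finSigmaFinEquiv ⟨i.castSucc, j⟩) =
            Fin.castAdd _ (finSigmaFinEquiv (n := fun i : Fin n => k i.castSucc) ⟨i, j⟩) := by
          ext
          simp [finSigmaFinEquiv_apply]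
        rw [this, Fin.append_left, blockConcat_apply]
    rw [key, List.ofFn_congr hs, List.ofFn_succ', List.concat_eq_append, List.flatten_append,
      ← ih fun i => c i.castSucc]
    simp [List.ofFn_fin_append]

theorem ofFn_blockConcat_perm {α : Type u} {n : ℕ} {k : Fin n → ℕ} (c : ∀ i, Fin (k i) → α)
    (σ : Equiv.Perm (Fin n)) (π : ∀ i, Equiv.Perm (Fin (k i))) :
    List.ofFn (blockConcat c ∘ blockPerm σ π) =
      (List.ofFn fun i => List.ofFn (c (σ i) ∘ π (σ i))).flatten := by
  rw [← ofFn_blockConcat (fun i => c (σ i) ∘ π (σ i))]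
  congr 1
  funext p
  obtain ⟨⟨i, j⟩, rfl⟩ := finSigmaFinEquiv.surjective p
  rw [blockConcat_apply]
  simp only [Function.comp, blockPerm, Equiv.trans_apply, Equiv.symm_apply_apply,
    blockConcat_apply]
  rfl

/-- A symmetric structure: the actions `f ↦ f · e`, from `M(a₁, …, aₙ; b)` to
`M(a_{e(1)}, …, a_{e(n)}; b)`, of permutations `e`, which are written as bijections `Fin m ≃ Fin n`
(so that `m = n`). The axioms are those of a right action, and
`(f · σ) ∘ ⟨g_{σ(1)} · π_{σ(1)}, …⟩ = (f ∘ ⟨g₁, …, gₙ⟩) · (σ ∘ (π_{σ(1)}, …))`. -/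
structure SymmetricStructure {O : Type u} {H : List O → O → Type v} (M : Multicategory O H) where
  act {m n : ℕ} (e : Fin m ≃ Fin n) {a : Fin n → O} {b : O} {Γ Δ : List O}
    (hΓ : Γ = List.ofFn a) (hΔ : Δ = List.ofFn (a ∘ e)) : H Γ b → H Δ b
  act_refl {n : ℕ} {a : Fin n → O} {b : O} {Γ : List O} (hΓ : Γ = List.ofFn a) (f : H Γ b) :
    act (Equiv.refl _) hΓ hΓ f = f
  act_trans {l m n : ℕ} (e' : Fin l ≃ Fin m) (e : Fin m ≃ Fin n) {a : Fin n → O} {b : O}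
    {Γ Δ Θ : List O} (hΓ : Γ = List.ofFn a) (hΔ : Δ = List.ofFn (a ∘ e))
    (hΘ : Θ = List.ofFn ((a ∘ e) ∘ e')) (f : H Γ b) :
    act e' hΔ hΘ (act e hΓ hΔ f) = act (e'.trans e) hΓ hΘ f
  comp_act {n : ℕ} {a : Fin n → O} {b : O} {k : Fin n → ℕ} {c : ∀ i, Fin (k i) → O}
    (σ : Equiv.Perm (Fin n)) (π : ∀ i, Equiv.Perm (Fin (k i)))
    (f : H (List.ofFn a) b) (g : ∀ i, H (List.ofFn (c i)) (a i)) :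
    M.comp (act σ rfl rfl f)
        (Tuple.ofFn (a := a ∘ σ) (fun i => act (π (σ i)) rfl rfl (g (σ i)))
          (ofFn_blockConcat_perm c σ π)) =
      act (blockPerm σ π) rfl rfl (M.comp f (Tuple.ofFn g (ofFn_blockConcat c)))

/-- A representable structure: tensor products `(a₁ ⊗ … ⊗ aₖ)` and multiarrows
`re : a₁, …, aₖ → (a₁ ⊗ … ⊗ aₖ)` such that the maps `f ↦ f ∘ ⟨id_γ, re, id_δ⟩` are bijective
(they are automatically natural). -/
structure RepresentableStructure {O : Type u} {H : List O → O → Type v}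
    (M : Multicategory O H) where
  tensor : List O → O
  re (as : List O) : H as (tensor as)
  bijective (γ as δ : List O) (b : O) : Function.Bijective
    fun f : H (γ ++ tensor as :: δ) b =>
      M.comp f ((Tuple.ids M.id γ).append (.cons (re as) (Tuple.ids M.id δ) rfl))

/-- A (right) closed structure: objects `(a₁ ⊗ … ⊗ aₖ) ⊸ b` and multiarrows
`ev : ((a₁ ⊗ … ⊗ aₖ) ⊸ b), a₁, …, aₖ → b` such that the maps `f ↦ ev ∘ ⟨f, id, …, id⟩` are
bijective (they are automatically natural). -/
structure ClosedStructure {O : Type u} {H : List O → O → Type v} (M : Multicategory O H) where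
  lolli : List O → O → O
  ev (as : List O) (b : O) : H (lolli as b :: as) b
  bijective (γ as : List O) (b : O) : Function.Bijective
    fun f : H γ (lolli as b) => M.comp (ev as b) (.cons f (Tuple.ids M.id as) rfl)

/-- An autonomous multicategory: a symmetric representable closed multicategory. -/
structure AutonomousMulticategory (O : Type u) (H : List O → O → Type v) extends
    Multicategory O H where
  symm : SymmetricStructure toMulticategory
  rep : RepresentableStructure toMulticategory
  closed : ClosedStructure toMulticategory

/-- An autonomous functor: a functor of multicategories that preserves the symmetric, the
representable and the closed structure on the nose. -/
structure AutonomousFunctor {O₁ : Type u₁} {H₁ : List O₁ → O₁ → Type v₁} {O₂ : Type u₂}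
    {H₂ : List O₂ → O₂ → Type v₂} (M : AutonomousMulticategory O₁ H₁)
    (N : AutonomousMulticategory O₂ H₂) where
  obj : O₁ → O₂
  map {as : List O₁} {b : O₁} : H₁ as b → H₂ (as.map obj) (obj b)
  map_id (a : O₁) : map (M.id a) = N.id (obj a)
  map_comp {Γ as : List O₁} {b : O₁} (f : H₁ as b) (gs : Tuple H₁ Γ as) :
    map (M.comp f gs) = N.comp (map f) (gs.map obj map)
  map_act {m n : ℕ} (e : Fin m ≃ Fin n) {a : Fin n → O₁} {b : O₁} {Γ Δ : List O₁}
    (hΓ : Γ = List.ofFn a) (hΔ : Δ = List.ofFn (a ∘ e)) (f : H₁ Γ b) :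
    map (M.symm.act e hΓ hΔ f) =
      N.symm.act e (a := obj ∘ a) (by rw [hΓ, List.map_ofFn]) (by rw [hΔ, List.map_ofFn]; rfl)
        (map f)
  obj_tensor (as : List O₁) : obj (M.rep.tensor as) = N.rep.tensor (as.map obj)
  map_re (as : List O₁) : HEq (map (M.rep.re as)) (N.rep.re (as.map obj))
  obj_lolli (as : List O₁) (b : O₁) :
    obj (M.closed.lolli as b) = N.closed.lolli (as.map obj) (obj b)
  map_ev (as : List O₁) (b : O₁) :
    HEq (map (M.closed.ev as b)) (N.closed.ev (as.map obj) (obj b))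

/-! ## Autonomous signatures -/

/-- The types over a set of atoms: `a ::= o | (a₁ ⊗ … ⊗ aₖ) | (a₁ ⊗ … ⊗ aₖ) ⊸ a`, `k ∈ ℕ`. -/
inductive Ty (At : Type u) : Type u
  | atom : At → Ty At
  | tensor : List (Ty At) → Ty At
  | lolli : List (Ty At) → Ty At → Ty At

set_option linter.checkUnivs false in
/-- An autonomous signature: a set of atoms, and a multigraph whose nodes are the types. -/
structure AutSignature where
  Atom : Type u
  Arr : List (Ty Atom) → Ty Atom → Type v

/-- The nodes of the signature. -/
abbrev AutSignature.Node (A : AutSignature.{u, v}) : Type u := Ty A.Atom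

/-- A map of autonomous signatures from `A` to the one underlying an autonomous multicategory `S`:
a morphism of multigraphs that preserves the formation of `(a₁ ⊗ … ⊗ aₖ)` and of
`(a₁ ⊗ … ⊗ aₖ) ⊸ a`. (Equivalently, an assignment of objects of `S` to the atoms, together with
one of multiarrows of `S` to the multiarrows of `A`.) -/
structure SignatureMap (A : AutSignature.{u, v}) {O : Type u₁} {H : List O → O → Type v₁}
    (S : AutonomousMulticategory O H) where
  obj : A.Node → O
  obj_tensor (as : List A.Node) : obj (.tensor as) = S.rep.tensor (as.map obj)
  obj_lolli (as : List A.Node) (b : A.Node) :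
    obj (.lolli as b) = S.closed.lolli (as.map obj) (obj b)
  map {as : List A.Node} {b : A.Node} : A.Arr as b → H (as.map obj) (obj b)

/-! ## Autonomous resource terms

Terms are taken up to renaming of bound variables, by means of de Bruijn indices: in the scope of a
binder of `x₁, …, xₖ` the variable `xᵢ₊₁` is written `i`, for `i < k`, and the variable that is
written `n` outside the scope is written `n + k`. -/

/-- Raw autonomous resource terms:
`x | λ⟨x₁^{a₁}, …, xₖ^{aₖ}⟩. s | s t | ⟨s₁, …, sₖ⟩ | s[x₁^{a₁}, …, xₖ^{aₖ} := t] | f(s₁, …, sₖ)`. -/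
inductive Raw (A : AutSignature.{u, v}) : Type (max u v)
  | var (x : ℕ) : Raw A
  | lam (as : List A.Node) (s : Raw A) : Raw A
  | app (s t : Raw A) : Raw A
  | tup {k : ℕ} (ss : Fin k → Raw A) : Raw A
  | sub (as : List A.Node) (s t : Raw A) : Raw A
  | con {as : List A.Node} {b : A.Node} (f : A.Arr as b) (ss : Fin as.length → Raw A) : Raw A

/-- A renaming, in the scope of a binder of `k` variables. -/
def upRen (k : ℕ) (ρ : ℕ → ℕ) (i : ℕ) : ℕ := if i < k then i else ρ (i - k) + k

namespace Raw

variable {A : AutSignature.{u, v}}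

/-- Renaming of free variables. -/
def rename (ρ : ℕ → ℕ) : Raw A → Raw A
  | var x => var (ρ x)
  | lam as s => lam as (s.rename (upRen as.length ρ))
  | app s t => app (s.rename ρ) (t.rename ρ)
  | tup ss => tup fun i => (ss i).rename ρ
  | sub as s t => sub as (s.rename (upRen as.length ρ)) (t.rename ρ)
  | con f ss => con f fun i => (ss i).rename ρ
termination_by structural s => s

/-- A term in the scope of `k` more variables, none of which is free in it. -/
def shift (k : ℕ) (s : Raw A) : Raw A := s.rename (· + k)

/-- A substitution, in the scope of a binder of `k` variables. -/
def upSub (k : ℕ) (σ : ℕ → Raw A) (i : ℕ) : Raw A := if i < k then var i else (σ (i - k)).shift k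

/-- Capture-avoiding simultaneous substitution. -/
def subst (σ : ℕ → Raw A) : Raw A → Raw A
  | var x => σ x
  | lam as s => lam as (s.subst (upSub as.length σ))
  | app s t => app (s.subst σ) (t.subst σ)
  | tup ss => tup fun i => (ss i).subst σ
  | sub as s t => sub as (s.subst (upSub as.length σ)) (t.subst σ)
  | con f ss => con f fun i => (ss i).subst σ
termination_by structural s => s

/-- The list term `⟨x₁, …, xₖ⟩` of the variables `0, …, k - 1`. -/
def varTup (k : ℕ) : Raw A := tup fun i : Fin k => var i

end Raw

/-! ### Typing -/

/-- Typing contexts `x₁ : a₁, …, xₙ : aₙ`. -/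
abbrev TyCtx (A : AutSignature.{u, v}) : Type u := List (ℕ × A.Node)

/-- The context `0 : a₁, …, n - 1 : aₙ`. -/
def enumCtx {A : AutSignature.{u, v}} (as : List A.Node) : TyCtx A := as.mapIdx fun i a => (i, a)

/-- A context in the scope of `k` more variables. -/
def TyCtx.shift {A : AutSignature.{u, v}} (k : ℕ) (γ : TyCtx A) : TyCtx A :=
  γ.map fun p => (p.1 + k, p.2)

/-- `Θ = (γ₁, …, γₖ) · σ` for a shuffle `σ`, that is, for a bijection from the disjoint union of the
sets of places of the `γᵢ` to the set of places of `Θ` that is monotone on each summand. -/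
def IsShuffle {α : Type u} {k : ℕ} (γ : Fin k → List α) (Θ : List α) : Prop :=
  ∃ σ : (Σ i, Fin (γ i).length) ≃ Fin Θ.length,
    (∀ i, Monotone fun j => σ ⟨i, j⟩) ∧ ∀ i j, Θ.get (σ ⟨i, j⟩) = (γ i).get j

/-- `Θ` is obtained by a shuffle from contexts `γ₁, …, γₖ` that have no variable in common. -/
def Merge {A : AutSignature.{u, v}} {k : ℕ} (γ : Fin k → TyCtx A) (Θ : TyCtx A) : Prop :=
  (∀ i j, i ≠ j → List.Disjoint ((γ i).map Prod.fst) ((γ j).map Prod.fst)) ∧ IsShuffle γ Θ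

/-- The typing judgement `γ ⊢ s : a`. -/
inductive Typed {A : AutSignature.{u, v}} : TyCtx A → Raw A → A.Node → Prop
  | var (x : ℕ) (a : A.Node) : Typed [(x, a)] (.var x) a
  | tup {k : ℕ} {γ : Fin k → TyCtx A} {ss : Fin k → Raw A} {as : Fin k → A.Node} {Θ : TyCtx A} :
      (∀ i, Typed (γ i) (ss i) (as i)) → Merge γ Θ → Typed Θ (.tup ss) (.tensor (List.ofFn as))
  | lam {γ : TyCtx A} {as : List A.Node} {s : Raw A} {b : A.Node} :
      Typed (γ.shift as.length ++ enumCtx as) s b → Typed γ (.lam as s) (.lolli as b)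
  | app {γ δ Θ : TyCtx A} {s t : Raw A} {as : List A.Node} {b : A.Node} :
      Typed γ s (.lolli as b) → Typed δ t (.tensor as) → Merge ![γ, δ] Θ → Typed Θ (.app s t) b
  | sub {γ δ₁ δ₂ Θ : TyCtx A} {s t : Raw A} {as : List A.Node} {b : A.Node} :
      Typed γ s (.tensor as) →
      Typed (δ₁.shift as.length ++ enumCtx as ++ δ₂.shift as.length) t b →
      Merge ![γ, δ₁, δ₂] Θ → Typed Θ (.sub as t s) b
  | con {as : List A.Node} {b : A.Node} (f : A.Arr as b) {γ : Fin as.length → TyCtx A}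
      {ss : Fin as.length → Raw A} {Θ : TyCtx A} :
      (∀ i, Typed (γ i) (ss i) (as.get i)) → Merge γ Θ → Typed Θ (.con f ss) b

/-- The set `Λ(A)(a₁, …, aₙ; b)` of the terms `s` with `x₁ : a₁, …, xₙ : aₙ ⊢ s : b`. As these are
taken up to renaming of the variables of the context, `xᵢ₊₁` is chosen to be `i`. -/
def Term (A : AutSignature.{u, v}) (as : List A.Node) (b : A.Node) : Type (max u v) :=
  {s : Raw A // Typed (enumCtx as) s b}

/-! ### Contexts with one hole -/

/-- Contexts with one hole. In `tup ss i C` and `con f ss i C` the `i`-th entry of `ss` is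
replaced with `C`; `subL as C t` and `subR as s C` are `C[x⃗ := t]` and `s[x⃗ := C]`. -/
inductive Cx (A : AutSignature.{u, v}) : Type (max u v)
  | hole : Cx A
  | lam (as : List A.Node) (C : Cx A) : Cx A
  | appL (C : Cx A) (t : Raw A) : Cx A
  | appR (s : Raw A) (C : Cx A) : Cx A
  | tup {k : ℕ} (ss : Fin k → Raw A) (i : Fin k) (C : Cx A) : Cx A
  | subL (as : List A.Node) (C : Cx A) (t : Raw A) : Cx A
  | subR (as : List A.Node) (s : Raw A) (C : Cx A) : Cx A
  | con {as : List A.Node} {b : A.Node} (f : A.Arr as b) (ss : Fin as.length → Raw A)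
      (i : Fin as.length) (C : Cx A) : Cx A

namespace Cx

variable {A : AutSignature.{u, v}}

/-- The term `C[s]`, with capture of variables. -/
def plug : Cx A → Raw A → Raw A
  | hole, s => s
  | lam as C, s => .lam as (C.plug s)
  | appL C t, s => .app (C.plug s) t
  | appR t C, s => .app t (C.plug s)
  | tup ss i C, s => .tup (Function.update ss i (C.plug s))
  | subL as C t, s => .sub as (C.plug s) t
  | subR as t C, s => .sub as t (C.plug s)
  | con f ss i C, s => .con f (Function.update ss i (C.plug s))

/-- The number of variables that `C` binds at its hole. -/
def depth : Cx A → ℕ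
  | hole => 0
  | lam as C => as.length + C.depth
  | appL C _ => C.depth
  | appR _ C => C.depth
  | tup _ _ C => C.depth
  | subL as C _ => as.length + C.depth
  | subR _ _ C => C.depth
  | con _ _ _ C => C.depth

/-- Renaming of the free variables of a context. -/
def rename (ρ : ℕ → ℕ) : Cx A → Cx A
  | hole => hole
  | lam as C => lam as (C.rename (upRen as.length ρ))
  | appL C t => appL (C.rename ρ) (t.rename ρ)
  | appR s C => appR (s.rename ρ) (C.rename ρ)
  | tup ss i C => tup (fun j => (ss j).rename ρ) i (C.rename ρ)
  | subL as C t => subL as (C.rename (upRen as.length ρ)) (t.rename ρ)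
  | subR as s C => subR as (s.rename (upRen as.length ρ)) (C.rename ρ)
  | con f ss i C => con f (fun j => (ss j).rename ρ) i (C.rename ρ)
termination_by structural C => C

/-- A context in the scope of `k` more variables, none of which is free in it. -/
def shift (k : ℕ) (C : Cx A) : Cx A := C.rename (· + k)

/-- Substitution contexts: `L ::= [·] | L[x⃗ := t]`. -/
def IsL : Cx A → Prop
  | hole => True
  | subL _ C _ => C.IsL
  | _ => False

/-- The contexts `E`: the hole is not the argument `t` of a substitution `s[x⃗ := t]`. -/
def IsE : Cx A → Prop
  | hole => True
  | lam _ C => C.IsE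
  | appL C _ => C.IsE
  | appR _ C => C.IsE
  | tup _ _ C => C.IsE
  | subL _ C _ => C.IsE
  | subR _ _ C => C.IsE ∧ C ≠ hole
  | con _ _ _ C => C.IsE

/-- The contexts `D`: the hole is not the function `s` of an application `s t`. -/
def IsD : Cx A → Prop
  | hole => True
  | lam _ C => C.IsD
  | appL C _ => C.IsD ∧ C ≠ hole
  | appR _ C => C.IsD
  | tup _ _ C => C.IsD
  | subL _ C _ => C.IsD
  | subR _ _ C => C.IsD
  | con _ _ _ C => C.IsD

end Cx

/-! ### Reduction and structural equivalence -/

section Reduction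

variable {A : AutSignature.{u, v}}

/-- The terms `L[⟨s₁, …, sₖ⟩]`. -/
def IsLT (s : Raw A) : Prop :=
  ∃ (L : Cx A) (k : ℕ) (ss : Fin k → Raw A), L.IsL ∧ s = L.plug (.tup ss)

/-- The terms `L[λx⃗. t]`. -/
def IsAT (s : Raw A) : Prop :=
  ∃ (L : Cx A) (as : List A.Node) (t : Raw A), L.IsL ∧ s = L.plug (.lam as t)

/-- The substitution of `t₁, …, tₖ` for the innermost variables `x₁, …, xₖ`. The result is outside
of the scope of their binder. -/
def instSub {k : ℕ} (ts : Fin k → Raw A) (i : ℕ) : Raw A :=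
  if h : i < k then ts ⟨i, h⟩ else .var (i - k)

/-- The `β₁` root step `s[x⃗ := L[⟨t₁, …, tₖ⟩]] → L[s{t₁, …, tₖ / x⃗}]`, and the `β₂` root step
`L[λx⃗. s]⟨t₁, …, tₖ⟩ → L[s{t₁, …, tₖ / x⃗}]`. The variables bound by `L` are not free in `s` in the
first one, and in the `tᵢ` in the second one. -/
inductive BetaRoot : Raw A → Raw A → Prop
  | beta₁ (as : List A.Node) (s : Raw A) (L : Cx A) (ts : Fin as.length → Raw A) : L.IsL →
      BetaRoot (.sub as s (L.plug (.tup ts)))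
        (L.plug ((s.rename (upRen as.length (· + L.depth))).subst (instSub ts)))
  | beta₂ (as : List A.Node) (s : Raw A) (L : Cx A) (ts : Fin as.length → Raw A) : L.IsL →
      BetaRoot (.app (L.plug (.lam as s)) (.tup ts))
        (L.plug (s.subst (instSub fun i => (ts i).shift L.depth)))

/-- The `η₁` root step `s → ⟨x⃗⟩[x⃗ := s]`, for `γ ⊢ s : (a₁ ⊗ … ⊗ aₖ)` with `s` not in `LT`. -/
inductive EtaRoot₁ : Raw A → Raw A → Prop
  | eta (γ : TyCtx A) (as : List A.Node) (s : Raw A) : Typed γ s (.tensor as) → ¬ IsLT s →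
      EtaRoot₁ s (.sub as (.varTup as.length) s)

/-- The `η₂` root step `s → λx⃗. s⟨x⃗⟩`, for `γ ⊢ s : (a₁ ⊗ … ⊗ aₖ) ⊸ b` with `s` not in `AT`. -/
inductive EtaRoot₂ : Raw A → Raw A → Prop
  | eta (γ : TyCtx A) (as : List A.Node) (b : A.Node) (s : Raw A) :
      Typed γ s (.lolli as b) → ¬ IsAT s →
      EtaRoot₂ s (.lam as (.app (s.shift as.length) (.varTup as.length)))

/-- The contextual extensions of the root steps: `β` in all contexts, `η₁` in the contexts `E`,
`η₂` in the contexts `D`. -/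
inductive RawStep : Raw A → Raw A → Prop
  | beta (C : Cx A) {s t : Raw A} : BetaRoot s t → RawStep (C.plug s) (C.plug t)
  | eta₁ (E : Cx A) {s t : Raw A} : E.IsE → EtaRoot₁ s t → RawStep (E.plug s) (E.plug t)
  | eta₂ (D : Cx A) {s t : Raw A} : D.IsD → EtaRoot₂ s t → RawStep (D.plug s) (D.plug t)

/-- The renaming that takes `k` variables out of the scope of `d` variables. -/
def exchange (k d i : ℕ) : ℕ := if i < k then i + d else if i < k + d then i - k else i

/-- Structural equivalence: the smallest congruence with `C[s[x⃗ := t]] ≡ C[s][x⃗ := t]`, where `C`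
does not bind variables of `t` and where the `x⃗` are not free in `C`. -/
inductive StrEq : Raw A → Raw A → Prop
  | root (C : Cx A) (as : List A.Node) (s t : Raw A) :
      StrEq (C.plug (.sub as s (t.shift C.depth)))
        (.sub as ((C.shift as.length).plug (s.rename (exchange as.length C.depth))) t)
  | congr (C : Cx A) {s t : Raw A} : StrEq s t → StrEq (C.plug s) (C.plug t)
  | refl (s : Raw A) : StrEq s s
  | symm {s t : Raw A} : StrEq s t → StrEq t s
  | trans {s t r : Raw A} : StrEq s t → StrEq t r → StrEq s r

/-- The reduction `→_aut` on `Λ(A)(a₁, …, aₙ; b)`. Both terms are typed in the same context, and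
bound variables carry their types; so the typing in an `η` step is the one that occurs in the
derivation for the whole term. -/
def Step {as : List A.Node} {b : A.Node} (s t : Term A as b) : Prop := RawStep s.1 t.1

/-- The equivalence `=_aut` that is generated by the reduction. -/
def AutEq {as : List A.Node} {b : A.Node} : Term A as b → Term A as b → Prop :=
  Relation.EqvGen Step

/-- The equivalence `∼` that is generated by the union of `≡` and `=_aut`. -/
def simSetoid (A : AutSignature.{u, v}) (as : List A.Node) (b : A.Node) : Setoid (Term A as b) :=
  Relation.EqvGen.setoid fun s t => StrEq s.1 t.1 ∨ AutEq s t

end Reduction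

/-! ### The multigraph of classes of terms -/

/-- The multiarrows `Λ(A)(a₁, …, aₙ; b) / ∼`. -/
def FreeHom (A : AutSignature.{u, v}) (as : List A.Node) (b : A.Node) : Type (max u v) :=
  Quotient (simSetoid A as b)

section FreeHom

variable {A : AutSignature.{u, v}}

/-- The class of a term. -/
def FreeHom.mk {as : List A.Node} {b : A.Node} (s : Term A as b) : FreeHom A as b :=
  Quotient.mk (simSetoid A as b) s

/-- The multiarrow `q` is the class of the raw term `s`, which is in particular well typed. -/
def FreeHom.IsClassOf {as : List A.Node} {b : A.Node} (q : FreeHom A as b) (s : Raw A) : Prop :=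
  ∃ h : Typed (enumCtx as) s b, q = FreeHom.mk ⟨s, h⟩

/-- For a tuple of terms `tᵢ` in contexts `γᵢ`: the substitution of the `tᵢ` for the variables of
the context `a₁, …, aₙ`, with the variables of the `tᵢ` numbered as in `γ₁, …, γₙ`. -/
def Tuple.toSubst {Γ as : List A.Node} : Tuple (Term A) Γ as → ℕ → Raw A
  | .nil, i => .var i
  | .cons t _ _, 0 => t.1
  | .cons (γ := γ) _ ts _, i + 1 => (ts.toSubst i).shift γ.length

/-- The renaming of the variables of the context `a₁, …, aₙ` for the context
`a_{e(1)}, …, a_{e(n)}`: the variable at the place `e(i)` of the former becomes the variable at the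
place `i` of the latter. -/
def permRen {m n : ℕ} (e : Fin m ≃ Fin n) (x : ℕ) : ℕ := if h : x < n then e.symm ⟨x, h⟩ else x

theorem enumCtx_eq_ofFn (as : List A.Node) :
    enumCtx as = List.ofFn fun i : Fin as.length => ((i : ℕ), as.get i) := by
  apply List.ext_get
  · simp [enumCtx]
  · intro n h₁ h₂
    simp [enumCtx]

theorem merge_vars (as : List A.Node) :
    Merge (fun i : Fin as.length => [((i : ℕ), as.get i)]) (enumCtx as) := by
  refine ⟨?_, ?_⟩
  · intro i j hij
    simpa [Fin.val_inj, eq_comm] using hij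
  · rw [enumCtx_eq_ofFn]
    refine ⟨(Equiv.sigmaUnique (Fin as.length) fun _ => Fin 1).trans
      (finCongr List.length_ofFn.symm), ?_, ?_⟩
    · intro i j j' _
      rw [Subsingleton.elim (α := Fin 1) j j']
    · intro i j
      rw [Subsingleton.elim (α := Fin 1) j 0]
      simp

/-- The inclusion of the signature: `f ↦ [f(x₁, …, xₙ)]`. -/
def FreeHom.eta {as : List A.Node} {b : A.Node} (f : A.Arr as b) : FreeHom A as b :=
  FreeHom.mk ⟨.con f fun i => .var i, .con f (fun i => .var i _) (merge_vars as)⟩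

/-- The multicategory `M`, whose objects are the nodes of `A` and whose multiarrows are the classes
of terms, has variables as identities, substitution as composition, renaming as symmetric action,
and the structure given by `(a₁ ⊗ … ⊗ aₖ)`, `[⟨x₁, …, xₖ⟩]`, `(a₁ ⊗ … ⊗ aₖ) ⊸ b` and
`[x₀⟨x₁, …, xₖ⟩]`. -/
structure IsTermMulticategory (M : AutonomousMulticategory A.Node (FreeHom A)) : Prop where
  id (a : A.Node) : (M.id a).IsClassOf (.var 0)
  comp {Γ as : List A.Node} {b : A.Node} (s : Term A as b) (ts : Tuple (Term A) Γ as) :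
    (M.comp (FreeHom.mk s) (ts.mapHom FreeHom.mk)).IsClassOf (s.1.subst ts.toSubst)
  act {m n : ℕ} (e : Fin m ≃ Fin n) {a : Fin n → A.Node} {b : A.Node} {Γ Δ : List A.Node}
    (hΓ : Γ = List.ofFn a) (hΔ : Δ = List.ofFn (a ∘ e)) (s : Term A Γ b) :
    (M.symm.act e hΓ hΔ (FreeHom.mk s)).IsClassOf (s.1.rename (permRen e))
  tensor : M.rep.tensor = Ty.tensor
  re (as : List A.Node) : (M.rep.re as).IsClassOf (.varTup as.length)
  lolli : M.closed.lolli = Ty.lolli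
  ev (as : List A.Node) (b : A.Node) :
    (M.closed.ev as b).IsClassOf (.app (.var 0) ((Raw.varTup as.length).shift 1))

/-- The functor `F` on the multicategory of classes of terms extends the map of signatures `i`. -/
structure AutonomousFunctor.Extends {O : Type u₁} {H : List O → O → Type v₁}
    {M : AutonomousMulticategory A.Node (FreeHom A)} {S : AutonomousMulticategory O H}
    (F : AutonomousFunctor M S) (i : SignatureMap A S) : Prop where
  obj_eq : F.obj = i.obj
  map_eta {as : List A.Node} {b : A.Node} (f : A.Arr as b) :
    HEq (F.map (FreeHom.eta f)) (i.map f)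

end FreeHom

/-!
The free property rests on one construction, the interpretation of raw terms in a `Model`: an
autonomous multicategory on the nodes of the signature, with an interpretation of its multiarrows.

*Interpretation.* Variables, term formers, `λ` and `s[x⃗ := t]` are interpreted by identities,
composition, transposition along `ev`, and transposition along `re`. Terms are resource terms, so a
typed term uses each variable of its context exactly once, but the order of the context is
arbitrary: hence a multiarrow is paired with a list of names of its places, and two such pairs are
compared up to a permutation of named places (`Reord`). Names that are distinct determine the
permutation (`Reord.unique`), and this keeps block permutations out of the induction proofs; they
occur only in `Reord.comp_left` and `TReord.comp`, where the equivariance of composition is used.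
The interpretation is an inductive relation `Den` between raw terms and multiarrows, whose rules
absorb permutations. It is defined on all typed terms (`Typed.exists_den`), only on these
(`Den.typed`), and is single-valued (`Den.unique`, `Den.eq`). The shuffles of the typing rules are
dealt with beforehand: a term is typed if and only if it is simply typed and linear
(`typed_iff_wt`), which does not depend on the order of the context.

*Soundness.* Substitution is interpreted by composition (`Den.subst`), from which the `β` rules
follow; the `η` rules are the uniqueness of transposes. For structural equivalence
`C[s[x⃗ := t]] ≡ C[s][x⃗ := t]`, both sides are read as functions of a variable in the place of `t`;
they agree after the substitution of `⟨x⃗⟩` for that variable, which makes the left hand side a `β`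
redex, and precomposition with `re` is injective (`SemLe.root`). Soundness in the model in which all
sets of multiarrows are singletons is subject reduction (`Typed.of_semLe`).

*The multicategory of terms.* The reduction relation restricts `η` to some contexts and to terms
that are not already of the expanded form. The generated equivalence `Conv` is insensitive to this:
it contains all instances of `η` (`Conv.eta₁`, `Conv.eta₂`), and is a congruence even in function
position (`Conv.appL`). As `s{t⃗ / x⃗}` is the `β` reduct of `(λx⃗. s) ⟨t⃗⟩`, it follows that
substitution is well-defined on classes (`Conv.subst`), so that the classes form a symmetric
multicategory. Representability is `s ∼ s{⟨x⃗⟩ / x}[x⃗ := x]` (`Conv.expand`) together with `β`, and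
closedness is `η` and `β` for `λ` (`freeAut`).

*The universal property.* A map of signatures into an autonomous multicategory `S` makes `S` into a
model, by pulling it back along the map of objects (`SignatureMap.model`). By soundness the
interpretation is defined on classes of terms (`interp`), and it preserves the structure
(`isModelHom_interp`). Conversely, in the model of classes of terms each term is interpreted by its
own class (`Term.den`), and homomorphisms of models preserve interpretations (`IsModelHom.den`).
Therefore every homomorphism from the model of classes of terms is `interp`
(`IsModelHom.eq_interp`), which is uniqueness.
-/

universe w

/-! ### Tuples of multiarrows -/

section Tuples

variable {O : Type u} {H : List O → O → Type v}

/-- `TRel P xs ts gs`: the tuple `gs` is componentwise related to the list `ts` by `P`, where the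
list of names `xs` is the concatenation of the lists of names that belong to the components. -/
inductive TRel {α : Type u₁} {ι : Type w}
    (P : List α → ι → ∀ (Γ : List O) (b : O), H Γ b → Prop) :
    List α → List ι → ∀ (Γ as : List O), Tuple H Γ as → Prop
  | nil : TRel P [] [] [] [] .nil
  | cons {xs ys : List α} {s : ι} {ts : List ι} {γ δ Γ : List O} {a : O} {as : List O}
      {g : H γ a} {gs : Tuple H δ as} (h : Γ = γ ++ δ) :
      P xs s γ a g → TRel P ys ts δ as gs → TRel P (xs ++ ys) (s :: ts) Γ (a :: as) (.cons g gs h)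

namespace Tuple

theorem split_append {Γ Δ as bs : List O} (t : Tuple H Γ as) (t' : Tuple H Δ bs) :
    split as (t.append t') = ⟨Γ, Δ, t, t', rfl⟩ := by
  induction t with
  | nil => rfl
  | cons g gs h ih => subst h; simp only [append, split]; rw [ih]

theorem rec_cons {Γ Γ' γ δ as : List O} {a : O} (g : H γ a) (gs : Tuple H δ as) (h : Γ = Γ')
    (e : Γ = γ ++ δ) : (h ▸ cons g gs e : Tuple H Γ' (a :: as)) = cons g gs (h.symm.trans e) := by
  subst h; rfl

theorem cons_heq {γ δ δ' Γ Γ' as as' : List O} {a : O} {g : H γ a} {gs : Tuple H δ as}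
    {gs' : Tuple H δ' as'} {h : Γ = γ ++ δ} {h' : Γ' = γ ++ δ'} (hδ : δ = δ') (has : as = as')
    (hg : HEq gs gs') : HEq (Tuple.cons g gs h) (Tuple.cons g gs' h') := by
  subst hδ has h h'
  cases hg; rfl

theorem append_nil_heq {Γ as : List O} (t : Tuple H Γ as) : HEq (t.append .nil) t := by
  induction t with
  | nil => rfl
  | cons g gs h ih => exact cons_heq (List.append_nil _) (List.append_nil _) ih

theorem exists_eq_append {Γ : List O} (as bs : List O) (t : Tuple H Γ (as ++ bs)) :
    ∃ (Γ₁ Γ₂ : List O) (h : Γ₁ ++ Γ₂ = Γ) (t₁ : Tuple H Γ₁ as) (t₂ : Tuple H Γ₂ bs),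
      t = h ▸ t₁.append t₂ := by
  induction as generalizing Γ with
  | nil => exact ⟨[], Γ, rfl, .nil, t, rfl⟩
  | cons a as ih =>
    cases t with
    | cons g gs h =>
      obtain ⟨Γ₁, Γ₂, rfl, t₁, t₂, rfl⟩ := ih gs
      subst h
      exact ⟨_, Γ₂, List.append_assoc _ _ _, .cons g t₁ rfl, t₂, by
        simp only [append]
        rw [rec_cons]⟩

theorem comp_cons (c : ∀ {Γ as : List O} {b : O}, H as b → Tuple H Γ as → H Γ b)
    {γ δ as Δ₁ Δ₂ : List O} {a : O} (g : H γ a) (gs : Tuple H δ as) (t₁ : Tuple H Δ₁ γ)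
    (t₂ : Tuple H Δ₂ δ) :
    (cons g gs rfl).comp c (t₁.append t₂) = cons (c g t₁) (gs.comp c t₂) rfl := by
  simp only [comp]
  rw [split_append]

theorem comp_cons_of_heq (c : ∀ {Γ as : List O} {b : O}, H as b → Tuple H Γ as → H Γ b)
    {γ δ as Δ₁ Δ₂ Γ Δ : List O} {a : O} (g : H γ a) (gs : Tuple H δ as) (t₁ : Tuple H Δ₁ γ)
    (t₂ : Tuple H Δ₂ δ) (h : Γ = γ ++ δ) (h' : Δ = Δ₁ ++ Δ₂) (t : Tuple H Δ Γ)
    (ht : HEq t (t₁.append t₂)) :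
    (cons g gs h).comp c t = cons (c g t₁) (gs.comp c t₂) h' := by
  subst h h'
  cases ht
  exact comp_cons c g gs t₁ t₂

theorem comp_single (c : ∀ {Γ as : List O} {b : O}, H as b → Tuple H Γ as → H Γ b)
    {γ Δ : List O} {a : O} (g : H γ a) (t : Tuple H Δ γ) :
    (cons g .nil (List.append_nil γ).symm).comp c t =
      cons (c g t) .nil (List.append_nil Δ).symm :=
  comp_cons_of_heq c g .nil t .nil _ _ t (append_nil_heq t).symm

theorem ids_append (i : ∀ a, H [a] a) (as bs : List O) :
    (ids i as).append (ids i bs) = ids i (as ++ bs) := by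
  induction as with
  | nil => rfl
  | cons a as ih => simp only [ids, append, ih, List.cons_append]

theorem comp_ids {M : Multicategory O H} {Γ as : List O} (t : Tuple H Γ as) :
    t.comp M.comp (ids M.id Γ) = t := by
  induction t with
  | nil => rfl
  | cons g gs h ih => subst h; rw [← ids_append, comp_cons, M.comp_id, ih]

theorem ids_comp {M : Multicategory O H} {Γ as : List O} (t : Tuple H Γ as) :
    (ids M.id as).comp M.comp t = t := by
  induction t with
  | nil => rfl
  | cons g gs h ih =>
    subst h
    have := comp_cons M.comp (M.id _) (ids M.id _) (.cons g .nil (List.append_nil _).symm) gs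
    rw [M.id_comp, ih] at this
    exact this

end Tuple

namespace TRel

variable {α : Type u₁} {ι : Type w} {P : List α → ι → ∀ (Γ : List O) (b : O), H Γ b → Prop}

theorem names_length (hP : ∀ xs s Γ b (g : H Γ b), P xs s Γ b g → xs.length = Γ.length)
    {xs : List α} {ts : List ι} {Γ as : List O} {gs : Tuple H Γ as}
    (h : TRel P xs ts Γ as gs) : xs.length = Γ.length := by
  induction h with
  | nil => rfl
  | cons h h' _ ih => subst h; simp [ih, hP _ _ _ _ _ h']

theorem mono {ι' : Type*} {P' : List α → ι' → ∀ (Γ : List O) (b : O), H Γ b → Prop} (φ : ι → ι')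
    {xs : List α} {ts : List ι} {Γ as : List O} {gs : Tuple H Γ as} (h : TRel P xs ts Γ as gs)
    (hP : ∀ xs, ∀ s ∈ ts, ∀ Γ b (g : H Γ b), P xs s Γ b g → P' xs (φ s) Γ b g) :
    TRel P' xs (ts.map φ) Γ as gs := by
  induction h with
  | nil => exact .nil
  | cons e h h' ih =>
    exact .cons e (hP _ _ (by simp) _ _ _ h) (ih fun xs s hs => hP xs s (by simp [hs]))

theorem of_map {ι' : Type*} {P' : List α → ι' → ∀ (Γ : List O) (b : O), H Γ b → Prop} (φ : ι → ι')
    {xs : List α} {ts : List ι} {Γ as : List O} {gs : Tuple H Γ as}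
    (h : TRel P' xs (ts.map φ) Γ as gs) : TRel (fun ys s => P' ys (φ s)) xs ts Γ as gs := by
  induction ts generalizing xs Γ as with
  | nil => cases h; exact .nil
  | cons t ts ih =>
    cases h with
    | cons e h h' => exact .cons e h (ih h')

theorem map_names {β : Type*} {P' : List β → ι → ∀ (Γ : List O) (b : O), H Γ b → Prop} (φ : α → β)
    {xs : List α} {ts : List ι} {Γ as : List O} {gs : Tuple H Γ as} (h : TRel P xs ts Γ as gs)
    (hP : ∀ xs, ∀ s ∈ ts, ∀ Γ b (g : H Γ b), P xs s Γ b g → P' (xs.map φ) s Γ b g) :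
    TRel P' (xs.map φ) ts Γ as gs := by
  induction h with
  | nil => exact .nil
  | cons e h h' ih =>
    rw [List.map_append]
    exact .cons e (hP _ _ (by simp) _ _ _ h) (ih fun xs s hs => hP xs s (by simp [hs]))

theorem append {xs ys : List α} {ts ts' : List ι} {Γ as Δ bs : List O} {gs : Tuple H Γ as}
    {gs' : Tuple H Δ bs} (h : TRel P xs ts Γ as gs) (h' : TRel P ys ts' Δ bs gs') :
    TRel P (xs ++ ys) (ts ++ ts') (Γ ++ Δ) (as ++ bs) (gs.append gs') := by
  induction h with
  | nil => exact h'
  | cons e h _ ih =>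
    rw [List.append_assoc]
    exact .cons _ h ih

theorem of_append {ys : List α} {ts ts' : List ι} {Γ as bs : List O} {gs : Tuple H Γ (as ++ bs)}
    (h : TRel P ys (ts ++ ts') Γ (as ++ bs) gs) (hl : ts.length = as.length) :
    ∃ (Γ₁ Γ₂ : List O) (e : Γ₁ ++ Γ₂ = Γ) (t₁ : Tuple H Γ₁ as) (t₂ : Tuple H Γ₂ bs)
      (y₁ y₂ : List α), ys = y₁ ++ y₂ ∧ gs = e ▸ t₁.append t₂ ∧ TRel P y₁ ts Γ₁ as t₁ ∧
        TRel P y₂ ts' Γ₂ bs t₂ := by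
  induction as generalizing ys ts Γ with
  | nil =>
    obtain rfl : ts = [] := by simpa using hl
    exact ⟨[], Γ, rfl, .nil, gs, [], ys, rfl, rfl, .nil, h⟩
  | cons a as ih =>
    cases ts with
    | nil => simp at hl
    | cons t ts =>
      cases h with
      | cons e h₀ h₁ =>
        obtain ⟨Γ₁, Γ₂, rfl, t₁, t₂, y₁, y₂, rfl, rfl, r₁, r₂⟩ := ih h₁ (by simpa using hl)
        subst e
        refine ⟨_, Γ₂, List.append_assoc _ _ _, .cons _ t₁ rfl, t₂, _, y₂,
          (List.append_assoc _ _ _).symm, ?_, .cons rfl h₀ r₁, r₂⟩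
        simp only [Tuple.append]
        rw [Tuple.rec_cons]

end TRel

end Tuples

/-! ### Permutations of named contexts -/

section Reord

variable {O : Type u} {H : List O → O → Type v} {M : Multicategory O H}

theorem zip_ofFn {α β : Type*} {n : ℕ} (x : Fin n → α) (a : Fin n → β) :
    (List.ofFn x).zip (List.ofFn a) = List.ofFn fun i => (x i, a i) := by
  apply List.ext_get <;> simp

theorem ofFn_comp_equiv_perm {α : Type*} {m n : ℕ} (e : Fin m ≃ Fin n) (x : Fin n → α) :
    (List.ofFn (x ∘ e)).Perm (List.ofFn x) := by
  obtain rfl : m = n := by simpa using Fintype.card_congr e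
  exact Equiv.Perm.ofFn_comp_perm e x

theorem exists_ofFn_pair {α β : Type*} {xs : List α} {Γ : List β} (h : xs.length = Γ.length) :
    ∃ (n : ℕ) (x : Fin n → α) (a : Fin n → β), xs = List.ofFn x ∧ Γ = List.ofFn a :=
  ⟨Γ.length, fun i => xs.get (i.cast h.symm), Γ.get,
    by apply List.ext_get <;> simp [h], by simp⟩

theorem exists_equiv_of_perm {α : Type*} {m n : ℕ} {x : Fin n → α} {y : Fin m → α}
    (h : (List.ofFn x).Perm (List.ofFn y)) (hx : (List.ofFn x).Nodup) :
    ∃ e : Fin m ≃ Fin n, y = x ∘ e := by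
  have hx' : Function.Injective x := List.nodup_ofFn.1 hx
  have hy' : Function.Injective y := List.nodup_ofFn.1 (h.nodup_iff.1 hx)
  have hr : ∀ z, z ∈ Set.range x ↔ z ∈ Set.range y := fun z => by
    rw [← List.mem_ofFn' , ← List.mem_ofFn']; exact h.mem_iff
  refine ⟨(Equiv.ofInjective y hy').trans ((Equiv.setCongr (Set.ext hr).symm).trans
    (Equiv.ofInjective x hx').symm), ?_⟩
  funext i
  simp [Equiv.apply_ofInjective_symm]

/-- `Reord S xs Γ b f ys Δ b g`: with the places of `Γ` named by `xs` and those of `Δ` by `ys`, the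
multiarrow `g` is obtained from `f` by the action of a permutation that matches the names. -/
inductive Reord (S : SymmetricStructure M) {α : Type u₁} :
    List α → ∀ (Γ : List O) (b : O), H Γ b → List α → ∀ (Γ : List O) (b : O), H Γ b → Prop
  | mk {m n : ℕ} (e : Fin m ≃ Fin n) (x : Fin n → α) (a : Fin n → O) {b : O} {Γ Δ : List O}
      (hΓ : Γ = List.ofFn a) (hΔ : Δ = List.ofFn (a ∘ e)) (f : H Γ b) {xs ys : List α}
      (hx : xs = List.ofFn x) (hy : ys = List.ofFn (x ∘ e)) :
      Reord S xs Γ b f ys Δ b (S.act e hΓ hΔ f)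

namespace Reord

variable {S : SymmetricStructure M} {α : Type u₁} {xs ys zs : List α} {Γ Δ Θ : List O} {b c d : O}
  {f : H Γ b} {g : H Δ c} {h : H Θ d}

theorem refl (S : SymmetricStructure M) (hx : xs.length = Γ.length) (f : H Γ b) :
    Reord S xs Γ b f xs Γ b f := by
  obtain ⟨n, x, a, rfl, rfl⟩ := exists_ofFn_pair hx
  have key : ∀ g, S.act (Equiv.refl (Fin n)) rfl rfl f = g →
      Reord S (List.ofFn x) (List.ofFn a) b f (List.ofFn x) (List.ofFn a) b g := by
    rintro g rfl
    exact .mk (Equiv.refl (Fin n)) x a rfl rfl f rfl rfl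
  exact key f (S.act_refl rfl f)

theorem symm (r : Reord S xs Γ b f ys Δ c g) : Reord S ys Δ c g xs Γ b f := by
  cases r with
  | mk e x a hΓ hΔ f hx hy =>
    have hx' : x = (x ∘ e) ∘ e.symm := by funext i; simp
    have ha' : a = (a ∘ e) ∘ e.symm := by funext i; simp
    have := Reord.mk (S := S) e.symm (x ∘ e) (a ∘ e) hΔ (hΓ.trans (congrArg _ ha'))
      (S.act e hΓ hΔ f) hy (hx.trans (congrArg _ hx'))
    rw [S.act_trans] at this
    convert this using 1
    have key : ∀ (e' : Fin _ ≃ Fin _) (h' : Γ = List.ofFn (a ∘ e')), e' = Equiv.refl _ →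
        f = S.act e' hΓ h' f := by
      rintro _ h' rfl; exact (S.act_refl hΓ f).symm
    exact key _ _ (by ext; simp)

theorem trans (r : Reord S xs Γ b f ys Δ c g) (r' : Reord S ys Δ c g zs Θ d h) :
    Reord S xs Γ b f zs Θ d h := by
  cases r with
  | mk e x a hΓ hΔ f hx hy =>
    cases r' with
    | @mk l m' e' x' a' _ _ _ hΓ' hΔ' _ _ _ hx' hy' =>
      have hl := congrArg List.length (hy.symm.trans hx')
      simp only [List.length_ofFn] at hl
      subst hl
      have h₁ := List.ofFn_injective (hy.symm.trans hx')
      have h₂ := List.ofFn_injective (hΔ.symm.trans hΓ')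
      subst h₁ h₂
      rw [S.act_trans]
      exact .mk _ x a _ hΔ' f hx hy'

theorem length_left (r : Reord S xs Γ b f ys Δ c g) : xs.length = Γ.length := by
  cases r with
  | mk e x a hΓ hΔ f hx hy => simp [hx, hΓ]

theorem length_right (r : Reord S xs Γ b f ys Δ c g) : ys.length = Δ.length := r.symm.length_left

theorem zip_perm (r : Reord S xs Γ b f ys Δ c g) : (xs.zip Γ).Perm (ys.zip Δ) := by
  cases r with
  | mk e x a hΓ hΔ f hx hy =>
    rw [hx, hy, hΓ, hΔ, zip_ofFn, zip_ofFn]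
    exact (ofFn_comp_equiv_perm e fun i => (x i, a i)).symm

theorem perm (r : Reord S xs Γ b f ys Δ c g) : xs.Perm ys := by
  cases r with
  | mk e x a hΓ hΔ f hx hy => rw [hx, hy]; exact (ofFn_comp_equiv_perm e x).symm

theorem map {β : Type*} (φ : α → β) (r : Reord S xs Γ b f ys Δ c g) :
    Reord S (xs.map φ) Γ b f (ys.map φ) Δ c g := by
  cases r with
  | mk e x a hΓ hΔ f hx hy =>
    exact .mk e (φ ∘ x) a hΓ hΔ f (by rw [hx, List.map_ofFn]) (by rw [hy, List.map_ofFn]; rfl)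

/-- Distinct names determine the permutation. -/
theorem unique {g' : H Δ c} (r : Reord S xs Γ b f ys Δ c g) (r' : Reord S xs Γ b f ys Δ c g')
    (hx : xs.Nodup) : g = g' := by
  cases r with
  | @mk m n e x a _ _ _ hΓ hΔ _ _ _ hx₁ hy₁ =>
    cases r' with
    | @mk m' n' e' x' a' _ _ _ hΓ' hΔ' _ _ _ hx' hy' =>
      have hn := congrArg List.length (hx₁.symm.trans hx')
      have hm := congrArg List.length (hy₁.symm.trans hy')
      simp only [List.length_ofFn] at hn hm
      subst hn hm
      have h₁ := List.ofFn_injective (hx₁.symm.trans hx')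
      have h₂ := List.ofFn_injective (hΓ.symm.trans hΓ')
      subst h₁ h₂
      have h₃ := List.ofFn_injective (hy₁.symm.trans hy')
      have hinj : Function.Injective x := List.nodup_ofFn.1 (hx₁ ▸ hx)
      obtain rfl : e = e' := Equiv.ext fun i => hinj (congrFun h₃ i)
      rfl

theorem eq_of_same {f' : H Γ b} (r : Reord S xs Γ b f xs Γ b f') (hx : xs.Nodup) : f = f' :=
  (refl S r.length_left f).unique r hx

theorem exists_of_perm (S : SymmetricStructure M) (f : H Γ b) (hx : xs.length = Γ.length)
    (hy : ys.length = Δ.length) (h : (xs.zip Γ).Perm (ys.zip Δ)) (hn : xs.Nodup) :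
    ∃ g : H Δ b, Reord S xs Γ b f ys Δ b g := by
  obtain ⟨n, x, a, rfl, rfl⟩ := exists_ofFn_pair hx
  obtain ⟨m, y, c, rfl, rfl⟩ := exists_ofFn_pair hy
  rw [zip_ofFn, zip_ofFn] at h
  obtain ⟨e, he⟩ := exists_equiv_of_perm h (List.nodup_ofFn.2 fun i j hij =>
    List.nodup_ofFn.1 hn (congrArg Prod.fst hij))
  obtain rfl : y = x ∘ e := funext fun i => congrArg Prod.fst (congrFun he i)
  obtain rfl : c = a ∘ e := funext fun i => congrArg Prod.snd (congrFun he i)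
  exact ⟨_, .mk e x a rfl rfl f rfl rfl⟩

end Reord

/-- A multiarrow whose source is named by `z`, with a permutation of its source and a label. -/
structure Block (H : List O → O → Type v) (α : Type u₁) (ι : Type w) where
  k : ℕ
  z : Fin k → α
  c : Fin k → O
  a : O
  g : H (List.ofFn c) a
  p : Equiv.Perm (Fin k)
  l : ι

theorem Tuple.ofFn_succ {n : ℕ} {γ : Fin (n + 1) → List O} {a : Fin (n + 1) → O} {Γ : List O}
    (g : ∀ i, H (γ i) (a i)) (h : Γ = (List.ofFn γ).flatten) :
    HEq (Tuple.ofFn g h) (Tuple.cons (Γ := Γ) (g 0) (Tuple.ofFn (fun i : Fin n => g i.succ) rfl)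
      (by rw [h, List.ofFn_succ, List.flatten_cons])) := by
  simp only [Tuple.ofFn]
  generalize_proofs h₁ h₂
  exact cast_heq _ _

theorem Tuple.ofFn_zero {γ : Fin 0 → List O} {a : Fin 0 → O} {Γ : List O}
    (g : ∀ i, H (γ i) (a i)) (h : Γ = (List.ofFn γ).flatten) :
    HEq (Tuple.ofFn g h) (Tuple.nil (H := H)) := by
  simp only [Tuple.ofFn]
  subst h
  simp

theorem TRel.exists_blocks {α : Type u₁} {ι : Type w}
    {P : List α → ι → ∀ (Γ : List O) (b : O), H Γ b → Prop}
    (hP : ∀ xs s Γ b (g : H Γ b), P xs s Γ b g → xs.length = Γ.length)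
    {xs : List α} {ts : List ι} {Γ as : List O} {gs : Tuple H Γ as} (h : TRel P xs ts Γ as gs) :
    ∃ (n : ℕ) (B : Fin n → Block H α ι) (hΓ : Γ = (List.ofFn fun i => List.ofFn (B i).c).flatten),
      xs = (List.ofFn fun i => List.ofFn (B i).z).flatten ∧ ts = List.ofFn (fun i => (B i).l) ∧
      as = List.ofFn (fun i => (B i).a) ∧ HEq gs (Tuple.ofFn (fun i => (B i).g) hΓ) ∧
      (∀ i, P (List.ofFn (B i).z) (B i).l _ _ (B i).g) := by
  induction h with
  | nil =>
    exact ⟨0, Fin.elim0, by simp, by simp, by simp, by simp, (Tuple.ofFn_zero _ _).symm, by simp⟩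
  | @cons xs ys s ts γ δ Γ a as g gs h h' _ ih =>
    obtain ⟨n, B, rfl, rfl, rfl, rfl, hgs, hB⟩ := ih
    obtain ⟨k, z, c, rfl, rfl⟩ := exists_ofFn_pair (hP _ _ _ _ _ h')
    refine ⟨n + 1, Fin.cons ⟨k, z, c, a, g, Equiv.refl _, s⟩ B, ?_, ?_, ?_, ?_, ?_, ?_⟩
    · rw [h, List.ofFn_succ]; rfl
    · rw [List.ofFn_succ]; rfl
    · rw [List.ofFn_succ]; rfl
    · rw [List.ofFn_succ]; rfl
    · refine HEq.trans ?_ (Tuple.ofFn_succ _ _).symm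
      exact Tuple.cons_heq rfl rfl hgs
    · intro i
      induction i using Fin.cases with
      | zero => exact h'
      | succ i => exact hB i

theorem TRel.of_blocks {α : Type u₁} {ι : Type w}
    {P : List α → ι → ∀ (Γ : List O) (b : O), H Γ b → Prop} {n : ℕ} {γ : Fin n → List O}
    {a : Fin n → O} {x : Fin n → List α} {t : Fin n → ι} {Γ : List O} (g : ∀ i, H (γ i) (a i))
    (hΓ : Γ = (List.ofFn γ).flatten) (h : ∀ i, P (x i) (t i) _ _ (g i)) :
    TRel P (List.ofFn x).flatten (List.ofFn t) Γ (List.ofFn a) (Tuple.ofFn g hΓ) := by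
  have key : ∀ (as : List O) (t' : Tuple H Γ as), as = List.ofFn a → HEq t' (Tuple.ofFn g hΓ) →
      TRel P (List.ofFn x).flatten (List.ofFn t) Γ as t' := by
    intro as t' has ht
    induction n generalizing as Γ with
    | zero =>
      obtain rfl : as = [] := by simpa using has
      obtain rfl : Γ = [] := by simpa using hΓ
      cases t'
      simpa using TRel.nil
    | succ n ih =>
      have hs := ht.trans (Tuple.ofFn_succ _ _)
      obtain rfl : as = a 0 :: List.ofFn fun i : Fin n => a i.succ := by
        simpa [List.ofFn_succ] using has
      cases eq_of_heq hs
      simp only [List.ofFn_succ, List.flatten_cons]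
      exact .cons _ (h 0) (ih _ rfl (fun i => h i.succ) _ _ rfl HEq.rfl)
  exact key _ _ rfl HEq.rfl

/-- Composition with a permuted multiarrow: the arguments are permuted in the same way. This is the
equivariance of composition, with identities for the permutations of the arguments. -/
theorem Reord.comp_left {S : SymmetricStructure M} {α : Type u₁} {ι : Type w}
    {P : List α → ι → ∀ (Γ : List O) (b : O), H Γ b → Prop}
    (hP : ∀ xs s Γ b (g : H Γ b), P xs s Γ b g → xs.length = Γ.length)
    {ts ts' : List ι} {as as' : List O} {b c : O} {f : H as b} {f' : H as' c}
    (r : Reord S ts as b f ts' as' c f') {xs : List α} {Γ : List O} {gs : Tuple H Γ as}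
    (h : TRel P xs ts Γ as gs) :
    ∃ (xs' : List α) (Γ' : List O) (gs' : Tuple H Γ' as'), TRel P xs' ts' Γ' as' gs' ∧
      Reord S xs Γ b (M.comp f gs) xs' Γ' c (M.comp f' gs') := by
  cases r with
  | @mk m n e x a _ _ _ hΓ hΔ _ _ _ hx₁ hy₁ =>
  obtain ⟨n', B, hΓ', rfl, hts, has, hgs, hB⟩ := h.exists_blocks hP
  obtain rfl : m = n := by simpa using Fintype.card_congr e
  have hn := congrArg List.length (hx₁.symm.trans hts)
  simp only [List.length_ofFn] at hn
  subst hn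
  obtain rfl := List.ofFn_injective (hx₁.symm.trans hts)
  obtain rfl := List.ofFn_injective (hΓ.symm.trans has)
  subst has hΔ hy₁ hts
  obtain rfl := hΓ'.trans (ofFn_blockConcat fun i => (B i).c).symm
  cases eq_of_heq hgs
  have hc := S.comp_act (c := fun i => (B i).c) e (fun i => Equiv.refl _) f (fun i => (B i).g)
  have hact : ∀ i, S.act (Equiv.refl (Fin (B i).k)) rfl rfl (B i).g = (B i).g :=
    fun i => S.act_refl rfl _
  refine ⟨_, _, _, TRel.of_blocks (x := fun i => List.ofFn (B (e i)).z)
    (fun i => S.act (Equiv.refl (Fin (B (e i)).k)) rfl rfl (B (e i)).g)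
    (ofFn_blockConcat_perm (fun i => (B i).c) e fun i => Equiv.refl _) fun i => ?_, ?_⟩
  · rw [hact]; exact hB (e i)
  · erw [hc]
    exact .mk _ (blockConcat fun i => (B i).z) (blockConcat fun i => (B i).c)
      rfl rfl _ (ofFn_blockConcat _).symm
      (ofFn_blockConcat_perm (fun i => (B i).z) e fun i => Equiv.refl _).symm

/-- Two tuples whose components are permutations of each other. -/
inductive TReord (S : SymmetricStructure M) {α : Type u₁} :
    List α → ∀ (Γ as : List O), Tuple H Γ as → List α → ∀ (Γ as : List O), Tuple H Γ as → Prop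
  | nil : TReord S [] [] [] .nil [] [] [] .nil
  | cons {xs ys xs' ys' : List α} {γ δ Γ γ' δ' Γ' as as' : List O} {a a' : O}
      {g : H γ a} {gs : Tuple H δ as} {g' : H γ' a'} {gs' : Tuple H δ' as'} (h : Γ = γ ++ δ)
      (h' : Γ' = γ' ++ δ') : Reord S xs γ a g xs' γ' a' g' → TReord S ys δ as gs ys' δ' as' gs' →
      TReord S (xs ++ ys) Γ (a :: as) (.cons g gs h) (xs' ++ ys') Γ' (a' :: as') (.cons g' gs' h')

theorem TReord.exists_blocks {S : SymmetricStructure M} {α : Type u₁} {xs xs' : List α}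
    {Γ as Γ' as' : List O} {gs : Tuple H Γ as} {gs' : Tuple H Γ' as'}
    (h : TReord S xs Γ as gs xs' Γ' as' gs') :
    ∃ (n : ℕ) (B : Fin n → Block H α Unit)
      (hΓ : Γ = (List.ofFn fun i => List.ofFn (B i).c).flatten)
      (hΓ' : Γ' = (List.ofFn fun i => List.ofFn ((B i).c ∘ (B i).p)).flatten),
      xs = (List.ofFn fun i => List.ofFn (B i).z).flatten ∧
      xs' = (List.ofFn fun i => List.ofFn ((B i).z ∘ (B i).p)).flatten ∧
      as = List.ofFn (fun i => (B i).a) ∧ as' = List.ofFn (fun i => (B i).a) ∧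
      HEq gs (Tuple.ofFn (fun i => (B i).g) hΓ) ∧
      HEq gs' (Tuple.ofFn (fun i => S.act (B i).p rfl rfl (B i).g) hΓ') := by
  induction h with
  | nil =>
    exact ⟨0, Fin.elim0, by simp, by simp, by simp, by simp, by simp, by simp,
      (Tuple.ofFn_zero _ _).symm, (Tuple.ofFn_zero _ _).symm⟩
  | @cons xs ys xs' ys' γ δ Γ γ' δ' Γ' as as' a a' g gs g' gs' h h' r _ ih =>
    obtain ⟨n, B, rfl, rfl, rfl, rfl, rfl, rfl, hgs, hgs'⟩ := ih
    cases r with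
    | @mk m n e x c _ _ _ hΓ hΔ _ _ _ hx hy =>
    obtain rfl : m = n := by simpa using Fintype.card_congr e
    subst hΓ hΔ hx hy
    refine ⟨_, Fin.cons ⟨m, x, c, _, g, e, ()⟩ B, ?_, ?_, ?_, ?_, ?_, ?_, ?_, ?_⟩
    · rw [h, List.ofFn_succ]; rfl
    · rw [h', List.ofFn_succ]; rfl
    · rw [List.ofFn_succ]; rfl
    · rw [List.ofFn_succ]; rfl
    · rw [List.ofFn_succ]; rfl
    · rw [List.ofFn_succ]; rfl
    · refine HEq.trans ?_ (Tuple.ofFn_succ _ _).symm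
      exact Tuple.cons_heq rfl rfl hgs
    · refine HEq.trans ?_ (Tuple.ofFn_succ _ _).symm
      exact Tuple.cons_heq rfl rfl hgs'

/-- Composition with permuted arguments. This is the equivariance of composition, with the identity
for the permutation of the multiarrow. -/
theorem TReord.comp {S : SymmetricStructure M} {α : Type u₁} {xs xs' : List α}
    {Γ as Γ' : List O} {gs : Tuple H Γ as} {gs' : Tuple H Γ' as}
    (h : TReord S xs Γ as gs xs' Γ' as gs') {b : O} (f : H as b) :
    Reord S xs Γ b (M.comp f gs) xs' Γ' b (M.comp f gs') := by
  obtain ⟨n, B, hΓ, hΓ', rfl, rfl, rfl, -, hgs, hgs'⟩ := h.exists_blocks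
  obtain rfl := hΓ.trans (ofFn_blockConcat fun i => (B i).c).symm
  obtain rfl := hΓ'.trans
    (ofFn_blockConcat_perm (fun i => (B i).c) (Equiv.refl _) fun i => (B i).p).symm
  cases eq_of_heq hgs
  cases eq_of_heq hgs'
  have hc := S.comp_act (c := fun i => (B i).c) (Equiv.refl _) (fun i => (B i).p) f
    (fun i => (B i).g)
  have hf : S.act (Equiv.refl (Fin n)) rfl rfl f = f := S.act_refl rfl _
  rw [hf] at hc
  have hc' := Reord.mk (S := S) (blockPerm (Equiv.refl _) fun i => (B i).p)
    (blockConcat fun i => (B i).z) (blockConcat fun i => (B i).c)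
      rfl rfl (M.comp f (Tuple.ofFn (fun i => (B i).g) hΓ)) (ofFn_blockConcat _).symm
      (ofFn_blockConcat_perm (fun i => (B i).z) (Equiv.refl _) fun i => (B i).p).symm
  rw [← hc] at hc'
  exact hc'

theorem TReord.refl (S : SymmetricStructure M) {α : Type u₁} {ι : Type w}
    {P : List α → ι → ∀ (Γ : List O) (b : O), H Γ b → Prop}
    (hP : ∀ xs s Γ b (g : H Γ b), P xs s Γ b g → xs.length = Γ.length)
    {ts : List ι} {as : List O} {xs : List α} {Γ : List O} {gs : Tuple H Γ as}
    (h : TRel P xs ts Γ as gs) : TReord S xs Γ as gs xs Γ as gs := by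
  induction h with
  | nil => exact .nil
  | cons e h _ ih => exact .cons e e (.refl S (hP _ _ _ _ _ h) _) ih

end Reord

/-! ### Models of a signature -/

/-- A model of the signature `A`: an autonomous multicategory whose objects are the nodes of `A`,
with an interpretation of the multiarrows of `A`. Evaluation is given in the form
`ap : (a₁ ⊗ … ⊗ aₖ) ⊸ b, (a₁ ⊗ … ⊗ aₖ) → b`, and representability is restricted to the first place;
by symmetry, this is no restriction. -/
structure Model (A : AutSignature.{u, v}) where
  H : List A.Node → A.Node → Type w
  M : Multicategory A.Node H
  S : SymmetricStructure M
  re (as : List A.Node) : H as (.tensor as)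
  re_bij (as δ : List A.Node) (b : A.Node) : Function.Bijective
    fun f : H (.tensor as :: δ) b => M.comp f (.cons (re as) (Tuple.ids M.id δ) rfl)
  ap (as : List A.Node) (b : A.Node) : H [.lolli as b, .tensor as] b
  ap_bij (γ as : List A.Node) (b : A.Node) : Function.Bijective
    fun f : H γ (.lolli as b) =>
      M.comp (ap as b) (.cons f (.cons (re as) .nil (List.append_nil as).symm) rfl)
  gen {as : List A.Node} {b : A.Node} : A.Arr as b → H as b

namespace Model

variable {A : AutSignature.{u, v}} (𝓜 : Model.{u, v, w} A)

/-- The inverse of precomposition with `re`. -/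
noncomputable def unre {as δ : List A.Node} {b : A.Node} (f : 𝓜.H (as ++ δ) b) :
    𝓜.H (.tensor as :: δ) b := ((𝓜.re_bij as δ b).2 f).choose

theorem unre_spec {as δ : List A.Node} {b : A.Node} (f : 𝓜.H (as ++ δ) b) :
    𝓜.M.comp (𝓜.unre f) (.cons (𝓜.re as) (Tuple.ids 𝓜.M.id δ) rfl) = f :=
  ((𝓜.re_bij as δ b).2 f).choose_spec

theorem eq_unre {as δ : List A.Node} {b : A.Node} {f : 𝓜.H (as ++ δ) b}
    {g : 𝓜.H (.tensor as :: δ) b}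
    (h : 𝓜.M.comp g (.cons (𝓜.re as) (Tuple.ids 𝓜.M.id δ) rfl) = f) : g = 𝓜.unre f :=
  (𝓜.re_bij as δ b).1 (h.trans (𝓜.unre_spec f).symm)

/-- Currying. -/
noncomputable def lamb {γ as : List A.Node} {b : A.Node} (f : 𝓜.H (γ ++ as) b) :
    𝓜.H γ (.lolli as b) := ((𝓜.ap_bij γ as b).2 f).choose

theorem lamb_spec {γ as : List A.Node} {b : A.Node} (f : 𝓜.H (γ ++ as) b) :
    𝓜.M.comp (𝓜.ap as b)
      (.cons (𝓜.lamb f) (.cons (𝓜.re as) .nil (List.append_nil as).symm) rfl) = f :=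
  ((𝓜.ap_bij γ as b).2 f).choose_spec

theorem eq_lamb {γ as : List A.Node} {b : A.Node} {f : 𝓜.H (γ ++ as) b} {g : 𝓜.H γ (.lolli as b)}
    (h : 𝓜.M.comp (𝓜.ap as b)
      (.cons g (.cons (𝓜.re as) .nil (List.append_nil as).symm) rfl) = f) : g = 𝓜.lamb f :=
  (𝓜.ap_bij γ as b).1 (h.trans (𝓜.lamb_spec f).symm)

theorem ap_comp {γ Δ as : List A.Node} {b : A.Node} (f : 𝓜.H γ (.lolli as b))
    (hs : Tuple 𝓜.H Δ γ) {Θ : List A.Node} (ts : Tuple 𝓜.H Θ as) :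
    𝓜.M.comp (𝓜.M.comp (𝓜.ap as b)
      (.cons f (.cons (𝓜.re as) .nil (List.append_nil as).symm) rfl)) (hs.append ts) =
    𝓜.M.comp (𝓜.ap as b) (.cons (𝓜.M.comp f hs)
      (.cons (𝓜.M.comp (𝓜.re as) ts) .nil (List.append_nil Θ).symm) rfl) := by
  rw [𝓜.M.assoc, Tuple.comp_cons]
  rw [Tuple.comp_single]

/-- Transposition along evaluation is natural. -/
theorem comp_lamb {γ Δ as : List A.Node} {b : A.Node} (f : 𝓜.H (γ ++ as) b) (hs : Tuple 𝓜.H Δ γ) :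
    𝓜.M.comp (𝓜.lamb f) hs = 𝓜.lamb (𝓜.M.comp f (hs.append (Tuple.ids 𝓜.M.id as))) := by
  apply eq_lamb
  conv_rhs => rw [← 𝓜.lamb_spec f]
  rw [ap_comp, 𝓜.M.comp_id]

/-- Transposition along `re` is natural. The left hand side is the form in which substitution acts
on the interpretation of `s[x⃗ := t]`. -/
theorem comp_unre {as Γ Δ Δ₁ Δ₂ : List A.Node} {b : A.Node} (n : 𝓜.H (as ++ Γ) b)
    (m : 𝓜.H Δ (.tensor as)) (t₁ : Tuple 𝓜.H Δ₁ Δ) (t₂ : Tuple 𝓜.H Δ₂ Γ) :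
    𝓜.M.comp (𝓜.M.comp (𝓜.unre n) (.cons m (Tuple.ids 𝓜.M.id Γ) rfl)) (t₁.append t₂) =
      𝓜.M.comp (𝓜.unre (𝓜.M.comp n ((Tuple.ids 𝓜.M.id as).append t₂)))
        (.cons (𝓜.M.comp m t₁) (Tuple.ids 𝓜.M.id Δ₂) rfl) := by
  have h : 𝓜.M.comp (𝓜.unre n) (.cons (𝓜.M.id _) t₂ rfl) =
      𝓜.unre (𝓜.M.comp n ((Tuple.ids 𝓜.M.id as).append t₂)) := by
    apply eq_unre
    conv_rhs => rw [← 𝓜.unre_spec n]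
    rw [𝓜.M.assoc, 𝓜.M.assoc, Tuple.comp_cons, 𝓜.M.comp_id, Tuple.ids_comp]
    have := Tuple.comp_cons 𝓜.M.comp (𝓜.M.id (.tensor as)) t₂
      (.cons (𝓜.re as) .nil (List.append_nil _).symm) (Tuple.ids 𝓜.M.id _)
    rw [𝓜.M.id_comp, Tuple.comp_ids] at this
    exact congrArg _ this
  rw [← h, 𝓜.M.assoc, 𝓜.M.assoc, Tuple.comp_cons, Tuple.ids_comp]
  have := Tuple.comp_cons 𝓜.M.comp (𝓜.M.id (.tensor as)) t₂
      (.cons (𝓜.M.comp m t₁) .nil (List.append_nil _).symm) (Tuple.ids 𝓜.M.id _)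
  rw [𝓜.M.id_comp, Tuple.comp_ids] at this
  exact congrArg _ this.symm

section Reord

variable {𝓜} {α : Type u₁}

/-- The components of the tuple `⟨p, id, …, id⟩`, of which the first one is labelled by `none`. -/
inductive HeadRel (us : List α) {Δ : List A.Node} {c : A.Node} (p : 𝓜.H Δ c) :
    List α → Option α → ∀ (Γ : List A.Node) (b : A.Node), 𝓜.H Γ b → Prop
  | head : HeadRel us p us none Δ c p
  | var (x : α) (a : A.Node) : HeadRel us p [x] (some x) [a] a (𝓜.M.id a)

theorem HeadRel.ids {us : List α} {Δ : List A.Node} {c : A.Node} {p : 𝓜.H Δ c} {xs : List α}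
    {Γ : List A.Node} (h : xs.length = Γ.length) :
    TRel (HeadRel us p) xs (xs.map some) Γ Γ (Tuple.ids 𝓜.M.id Γ) := by
  induction Γ generalizing xs with
  | nil => obtain rfl : xs = [] := by simpa using h
           exact .nil
  | cons a Γ ih =>
    cases xs with
    | nil => simp at h
    | cons x xs =>
      exact .cons (xs := [x]) (γ := [a]) rfl (.var x a) (ih (by simpa using h))

theorem HeadRel.eq_ids {us : List α} {Δ : List A.Node} {c : A.Node} {p : 𝓜.H Δ c}
    {xs ys : List α} {Γ as : List A.Node} {gs : Tuple 𝓜.H Γ as}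
    (h : TRel (HeadRel us p) ys (xs.map some) Γ as gs) :
    ys = xs ∧ Γ = as ∧ HEq gs (Tuple.ids 𝓜.M.id as) := by
  induction xs generalizing ys Γ as with
  | nil => cases h; simp [Tuple.ids]
  | cons x xs ih =>
    cases h with
    | cons e h h' =>
      obtain ⟨rfl, rfl, hg⟩ := ih h'
      cases h with
      | var x a => subst e; cases hg; exact ⟨rfl, rfl, HEq.rfl⟩

theorem HeadRel.length {us : List α} {Δ : List A.Node} {c : A.Node} {p : 𝓜.H Δ c}
    (hp : us.length = Δ.length) (xs : List α) (s : Option α) (Γ : List A.Node) (b : A.Node)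
    (g : 𝓜.H Γ b) (h : HeadRel us p xs s Γ b g) : xs.length = Γ.length := by
  cases h with
  | head => exact hp
  | var => rfl

theorem reord_head {us xs ys : List α} {Δ Γ Γ' : List A.Node} {c b : A.Node} (p : 𝓜.H Δ c)
    (hp : us.length = Δ.length) (hx : xs.length = Γ.length)
    {f : 𝓜.H (c :: Γ) b} {g : 𝓜.H (c :: Γ') b}
    (r : Reord 𝓜.S (none :: xs.map some) (c :: Γ) b f (none :: ys.map some) (c :: Γ') b g) :
    Reord 𝓜.S (us ++ xs) (Δ ++ Γ) b (𝓜.M.comp f (.cons p (Tuple.ids 𝓜.M.id Γ) rfl))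
      (us ++ ys) (Δ ++ Γ') b (𝓜.M.comp g (.cons p (Tuple.ids 𝓜.M.id Γ') rfl)) := by
  obtain ⟨ys', Θ, gs', h, r'⟩ := r.comp_left (HeadRel.length (us := us) (p := p) hp)
    (.cons rfl .head (HeadRel.ids hx))
  cases h with
  | cons e h h' =>
    obtain ⟨rfl, rfl, hg⟩ := HeadRel.eq_ids h'
    cases h
    subst e
    cases hg
    exact r'

/-- A permutation that fixes the block `as` of places descends to the transpose, in which this block
is a single place, named `none`. -/
theorem reord_unre {zs xs ys : List α} {as Γ Γ' : List A.Node} {b : A.Node}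
    {n : 𝓜.H (as ++ Γ) b} {n' : 𝓜.H (as ++ Γ') b} (hz : zs.length = as.length)
    (r : Reord 𝓜.S (zs ++ xs) (as ++ Γ) b n (zs ++ ys) (as ++ Γ') b n') (hn : (zs ++ xs).Nodup) :
    Reord 𝓜.S (none :: xs.map some) (.tensor as :: Γ) b (𝓜.unre n)
      (none :: ys.map some) (.tensor as :: Γ') b (𝓜.unre n') := by
  have hx : xs.length = Γ.length := by
    have := r.length_left
    simpa [hz] using this
  have hy : ys.length = Γ'.length := by
    have := r.length_right
    simpa [hz] using this
  have hp := r.zip_perm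
  rw [List.zip_append hz, List.zip_append hz, List.perm_append_left_iff] at hp
  obtain ⟨g, hg⟩ := Reord.exists_of_perm (xs := none :: xs.map some) (ys := none :: ys.map some)
    (Δ := .tensor as :: Γ') 𝓜.S (𝓜.unre n) (by simpa using hx) (by simpa using hy)
    (by simpa [List.zip_map_left] using hp.map _)
    (by simpa using (List.nodup_append.1 hn).2.1.map (Option.some_injective _))
  have h := reord_head (us := zs) (𝓜.re as) hz hx hg
  rw [unre_spec] at h
  rwa [← eq_unre 𝓜 (h.unique r hn)]

/-- Permutations of the arguments of the interpretation of a substitution. -/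
theorem reord_sub {zs xs ys us us' : List α} {as Γ Γ' Δ Δ' : List A.Node} {b : A.Node}
    {n : 𝓜.H (as ++ Γ) b} {n' : 𝓜.H (as ++ Γ') b} (hz : zs.length = as.length)
    (r : Reord 𝓜.S (zs ++ xs) (as ++ Γ) b n (zs ++ ys) (as ++ Γ') b n') (hn : (zs ++ xs).Nodup)
    {m : 𝓜.H Δ (.tensor as)} {m' : 𝓜.H Δ' (.tensor as)}
    (r' : Reord 𝓜.S us Δ _ m us' Δ' _ m') :
    Reord 𝓜.S (us ++ xs) (Δ ++ Γ) b (𝓜.M.comp (𝓜.unre n) (.cons m (Tuple.ids 𝓜.M.id Γ) rfl))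
      (us' ++ ys) (Δ' ++ Γ') b
      (𝓜.M.comp (𝓜.unre n') (.cons m' (Tuple.ids 𝓜.M.id Γ') rfl)) := by
  have hx : xs.length = Γ.length := by
    have := r.length_left
    simpa [hz] using this
  have hy : ys.length = Γ'.length := by
    have := r.length_right
    simpa [hz] using this
  refine (reord_head m r'.length_left hx (reord_unre hz r hn)).trans ?_
  exact TReord.comp (.cons rfl rfl r' (TReord.refl 𝓜.S
    (HeadRel.length (us := us) (p := m) r'.length_left) (HeadRel.ids hy))) _

theorem reord_lamb {zs xs ys : List α} {as Γ Γ' : List A.Node} {b : A.Node}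
    {n : 𝓜.H (Γ ++ as) b} {n' : 𝓜.H (Γ' ++ as) b} (hx : xs.length = Γ.length)
    (hy : ys.length = Γ'.length)
    (r : Reord 𝓜.S (xs ++ zs) (Γ ++ as) b n (ys ++ zs) (Γ' ++ as) b n') (hn : (xs ++ zs).Nodup) :
    Reord 𝓜.S xs Γ _ (𝓜.lamb n) ys Γ' _ (𝓜.lamb n') := by
  have hz : zs.length = as.length := by
    have := r.length_left
    simpa [hx] using this
  have hp := r.zip_perm
  rw [List.zip_append hx, List.zip_append hy, List.perm_append_right_iff] at hp
  obtain ⟨g, hg⟩ := Reord.exists_of_perm 𝓜.S (𝓜.lamb n) hx hy hp (List.nodup_append.1 hn).1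
  have h := TReord.comp (.cons rfl rfl hg (.cons (List.append_nil as).symm
    (List.append_nil as).symm (.refl 𝓜.S hz (𝓜.re as)) .nil)) (𝓜.ap as b)
  rw [lamb_spec, List.append_nil] at h
  rwa [← eq_lamb 𝓜 (h.unique r hn)]

end Reord

end Model

/-! ### Renaming and substitution -/

section RawTerms

variable {A : AutSignature.{u, v}}

theorem upRen_id (k : ℕ) : upRen k id = id := by
  funext i; simp only [upRen, id]; split_ifs <;> omega

theorem upRen_comp (k : ℕ) (ρ ρ' : ℕ → ℕ) : upRen k (ρ ∘ ρ') = upRen k ρ ∘ upRen k ρ' := by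
  funext i
  simp only [upRen, Function.comp]
  split_ifs <;> first | rfl | omega | simp

theorem upRen_upRen (k l : ℕ) (ρ : ℕ → ℕ) : upRen l (upRen k ρ) = upRen (k + l) ρ := by
  funext i
  simp only [upRen]
  split_ifs <;> first | omega | (rw [show i - l - k = i - (k + l) by omega]; omega)

theorem upRen_injective {ρ : ℕ → ℕ} (h : Function.Injective ρ) (k : ℕ) :
    Function.Injective (upRen k ρ) := by
  intro i j hij
  simp only [upRen] at hij
  split_ifs at hij <;> first | omega | (have := h (Nat.add_right_cancel hij); omega)

theorem add_injective (k : ℕ) : Function.Injective fun i : ℕ => i + k := add_left_injective k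

namespace Raw

theorem rename_id (s : Raw A) : s.rename id = s := by
  induction s with
  | var x => rfl
  | lam as s ih => simp only [rename, upRen_id, ih]
  | app s t ih ih' => simp only [rename, ih, ih']
  | tup ss ih => simp only [rename, ih]
  | sub as s t ih ih' => simp only [rename, upRen_id, ih, ih']
  | con f ss ih => simp only [rename, ih]

theorem rename_rename (s : Raw A) (ρ ρ' : ℕ → ℕ) : (s.rename ρ').rename ρ = s.rename (ρ ∘ ρ') := by
  induction s generalizing ρ ρ' with
  | var x => rfl
  | lam as s ih => simp only [rename, upRen_comp, ih]
  | app s t ih ih' => simp only [rename, ih, ih']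
  | tup ss ih => simp only [rename, ih]
  | sub as s t ih ih' => simp only [rename, upRen_comp, ih, ih']
  | con f ss ih => simp only [rename, ih]

theorem upSub_comp_upRen (k : ℕ) (σ : ℕ → Raw A) (ρ : ℕ → ℕ) :
    upSub k σ ∘ upRen k ρ = upSub k (σ ∘ ρ) := by
  funext i
  simp only [upSub, upRen, Function.comp]
  split_ifs <;> first | rfl | omega | simp

theorem subst_rename (s : Raw A) (σ : ℕ → Raw A) (ρ : ℕ → ℕ) :
    (s.rename ρ).subst σ = s.subst (σ ∘ ρ) := by
  induction s generalizing σ ρ with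
  | var x => rfl
  | lam as s ih => simp only [rename, subst, upSub_comp_upRen, ih]
  | app s t ih ih' => simp only [rename, subst, ih, ih']
  | tup ss ih => simp only [rename, subst, ih]
  | sub as s t ih ih' => simp only [rename, subst, upSub_comp_upRen, ih, ih']
  | con f ss ih => simp only [rename, subst, ih]

theorem rename_upSub (k : ℕ) (σ : ℕ → Raw A) (ρ : ℕ → ℕ) :
    (fun i => (upSub k σ i).rename (upRen k ρ)) = upSub k fun i => (σ i).rename ρ := by
  funext i
  simp only [upSub]
  split_ifs with h
  · simp [rename, upRen, h]
  · simp only [shift, rename_rename]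
    congr 1
    funext j
    simp [upRen]

theorem rename_subst (s : Raw A) (σ : ℕ → Raw A) (ρ : ℕ → ℕ) :
    (s.subst σ).rename ρ = s.subst fun i => (σ i).rename ρ := by
  induction s generalizing σ ρ with
  | var x => rfl
  | lam as s ih => simp only [rename, subst, ← rename_upSub, ih]
  | app s t ih ih' => simp only [rename, subst, ih, ih']
  | tup ss ih => simp only [rename, subst, ih]
  | sub as s t ih ih' => simp only [rename, subst, ← rename_upSub, ih, ih']
  | con f ss ih => simp only [rename, subst, ih]

theorem subst_upSub (k : ℕ) (σ τ : ℕ → Raw A) :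
    (fun i => (upSub k σ i).subst (upSub k τ)) = upSub k fun i => (σ i).subst τ := by
  funext i
  simp only [upSub]
  split_ifs with h
  · simp [subst, upSub, h]
  · simp only [shift, subst_rename, rename_subst]
    congr 1
    funext j
    simp [upSub, shift]

theorem subst_subst (s : Raw A) (σ τ : ℕ → Raw A) :
    (s.subst σ).subst τ = s.subst fun i => (σ i).subst τ := by
  induction s generalizing σ τ with
  | var x => rfl
  | lam as s ih => simp only [subst, ← subst_upSub, ih]
  | app s t ih ih' => simp only [subst, ih, ih']
  | tup ss ih => simp only [subst, ih]
  | sub as s t ih ih' => simp only [subst, ← subst_upSub, ih, ih']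
  | con f ss ih => simp only [subst, ih]

theorem upSub_var (k : ℕ) : upSub k (var : ℕ → Raw A) = var := by
  funext i
  simp only [upSub, shift, rename]
  split_ifs
  · rfl
  · congr 1; omega

theorem subst_var (s : Raw A) : s.subst var = s := by
  induction s with
  | var x => rfl
  | lam as s ih => simp only [subst, upSub_var, ih]
  | app s t ih ih' => simp only [subst, ih, ih']
  | tup ss ih => simp only [subst, ih]
  | sub as s t ih ih' => simp only [subst, upSub_var, ih, ih']
  | con f ss ih => simp only [subst, ih]

theorem rename_eq_subst (s : Raw A) (ρ : ℕ → ℕ) : s.rename ρ = s.subst fun i => var (ρ i) := by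
  conv_lhs => rw [← subst_var (s.rename ρ), subst_rename]
  rfl

/-- The number of free occurrences of a variable. -/
def occ : Raw A → ℕ → ℕ
  | var y, x => if y = x then 1 else 0
  | lam as s, x => s.occ (x + as.length)
  | app s t, x => s.occ x + t.occ x
  | tup ss, x => ∑ i, (ss i).occ x
  | sub as s t, x => s.occ (x + as.length) + t.occ x
  | con _ ss, x => ∑ i, (ss i).occ x
termination_by structural s => s

theorem subst_congr (s : Raw A) {σ τ : ℕ → Raw A} (h : ∀ x, s.occ x ≠ 0 → σ x = τ x) :
    s.subst σ = s.subst τ := by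
  have key : ∀ (k : ℕ) (s : Raw A) (σ τ : ℕ → Raw A), (∀ x, s.occ (x + k) ≠ 0 → σ x = τ x) →
      ∀ x, s.occ x ≠ 0 → upSub k σ x = upSub k τ x := by
    intro k s σ τ h x hx
    simp only [upSub]
    split_ifs with hk
    · rfl
    · rw [h (x - k)]
      rwa [Nat.sub_add_cancel (by omega)]
  induction s generalizing σ τ with
  | var x => exact h x (by simp [occ])
  | lam as s ih => simp only [subst, ih (key _ _ _ _ h)]
  | app s t ih ih' =>
    simp only [subst]
    rw [ih fun x hx => h x (by simp only [occ]; omega),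
      ih' fun x hx => h x (by simp only [occ]; omega)]
  | tup ss ih =>
    simp only [subst]
    congr 1
    funext i
    refine ih i fun x hx => h x fun h0 => hx ?_
    simp only [occ, Finset.sum_eq_zero_iff] at h0
    exact h0 i (Finset.mem_univ i)
  | sub as s t ih ih' =>
    simp only [subst]
    rw [ih (key _ _ _ _ fun x hx => h x (by simp only [occ]; omega)),
      ih' fun x hx => h x (by simp only [occ]; omega)]
  | con f ss ih =>
    simp only [subst]
    congr 1
    funext i
    refine ih i fun x hx => h x fun h0 => hx ?_
    simp only [occ, Finset.sum_eq_zero_iff] at h0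
    exact h0 i (Finset.mem_univ i)

theorem rename_congr (s : Raw A) {ρ ρ' : ℕ → ℕ} (h : ∀ x, s.occ x ≠ 0 → ρ x = ρ' x) :
    s.rename ρ = s.rename ρ' := by
  rw [rename_eq_subst, rename_eq_subst]
  exact subst_congr s fun x hx => by rw [h x hx]

theorem occ_rename {ρ : ℕ → ℕ} (h : Function.Injective ρ) (s : Raw A) (x : ℕ) :
    (s.rename ρ).occ (ρ x) = s.occ x := by
  have key : ∀ (k : ℕ) (ρ : ℕ → ℕ) (x : ℕ), ρ x + k = upRen k ρ (x + k) := by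
    intro k ρ x; simp [upRen]
  induction s generalizing ρ x with
  | var y => simp [rename, occ, h.eq_iff]
  | lam as s ih => simp only [rename, occ, key, ih (upRen_injective h _)]
  | app s t ih ih' => simp only [rename, occ, ih h, ih' h]
  | tup ss ih => simp only [rename, occ, ih _ h]
  | sub as s t ih ih' => simp only [rename, occ, key, ih (upRen_injective h _), ih' h]
  | con f ss ih => simp only [rename, occ, ih _ h]

theorem occ_rename_eq_zero {ρ : ℕ → ℕ} (s : Raw A) (y : ℕ) (h : ∀ x, ρ x ≠ y) :
    (s.rename ρ).occ y = 0 := by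
  have key : ∀ (k : ℕ) (ρ : ℕ → ℕ) (y : ℕ), (∀ x, ρ x ≠ y) → ∀ x, upRen k ρ x ≠ y + k := by
    intro k ρ y h x
    simp only [upRen]
    split_ifs
    · omega
    · have := h (x - k); omega
  induction s generalizing ρ y with
  | var x => simpa [rename, occ] using h x
  | lam as s ih => simp only [rename, occ]; exact ih _ (key _ _ _ h)
  | app s t ih ih' => simp [rename, occ, ih _ h, ih' _ h]
  | tup ss ih => simp [rename, occ, fun i => ih i _ h]
  | sub as s t ih ih' => simp [rename, occ, ih _ (key _ _ _ h), ih' _ h]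
  | con f ss ih => simp [rename, occ, fun i => ih i _ h]

theorem occ_shift_add (k : ℕ) (s : Raw A) (x : ℕ) : (s.shift k).occ (x + k) = s.occ x :=
  occ_rename (add_injective k) s x

theorem occ_shift_lt {k : ℕ} (s : Raw A) {x : ℕ} (h : x < k) : (s.shift k).occ x = 0 :=
  occ_rename_eq_zero s x fun y => by omega

/-- Each bound variable occurs exactly once in the scope of its binder. -/
def Lin : Raw A → Prop
  | var _ => True
  | lam as s => (∀ i < as.length, s.occ i = 1) ∧ s.Lin
  | app s t => s.Lin ∧ t.Lin
  | tup ss => ∀ i, (ss i).Lin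
  | sub as s t => (∀ i < as.length, s.occ i = 1) ∧ s.Lin ∧ t.Lin
  | con _ ss => ∀ i, (ss i).Lin
termination_by structural s => s

theorem lin_rename {ρ : ℕ → ℕ} (h : Function.Injective ρ) (s : Raw A) :
    (s.rename ρ).Lin ↔ s.Lin := by
  have key : ∀ (k : ℕ) (s : Raw A) (ρ : ℕ → ℕ), Function.Injective ρ →
      ((∀ i < k, (s.rename (upRen k ρ)).occ i = 1) ↔ ∀ i < k, s.occ i = 1) := by
    intro k s ρ h
    refine forall₂_congr fun i hi => ?_
    conv_lhs => rw [show i = upRen k ρ i by simp [upRen, hi]]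
    rw [occ_rename (upRen_injective h k)]
  induction s generalizing ρ with
  | var y => simp [rename, Lin]
  | lam as s ih => simp only [rename, Lin, ih (upRen_injective h _), key _ _ _ h]
  | app s t ih ih' => simp only [rename, Lin, ih h, ih' h]
  | tup ss ih => simp only [rename, Lin, fun i => ih i h]
  | sub as s t ih ih' => simp only [rename, Lin, ih (upRen_injective h _), ih' h, key _ _ _ h]
  | con f ss ih => simp only [rename, Lin, fun i => ih i h]

end Raw

/-- An assignment of types to variables, in the scope of a binder. -/
def upEnv (as : List A.Node) (τ : ℕ → A.Node) (i : ℕ) : A.Node :=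
  if h : i < as.length then as.get ⟨i, h⟩ else τ (i - as.length)

theorem upEnv_comp_upRen (as : List A.Node) (τ : ℕ → A.Node) (ρ : ℕ → ℕ) :
    upEnv as τ ∘ upRen as.length ρ = upEnv as (τ ∘ ρ) := by
  funext i
  simp only [upEnv, upRen, Function.comp]
  split_ifs <;> first | rfl | omega | simp

namespace Raw

/-- Simple typing, which ignores linearity. -/
def STy : (ℕ → A.Node) → Raw A → A.Node → Prop
  | τ, var x, b => τ x = b
  | τ, lam as s, b => ∃ c, b = .lolli as c ∧ STy (upEnv as τ) s c
  | τ, app s t, b => ∃ as, STy τ s (.lolli as b) ∧ STy τ t (.tensor as)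
  | τ, tup (k := k) ss, b => ∃ as : Fin k → A.Node, b = .tensor (List.ofFn as) ∧
      ∀ i, STy τ (ss i) (as i)
  | τ, sub as s t, b => STy (upEnv as τ) s b ∧ STy τ t (.tensor as)
  | τ, con (as := as) (b := c) _ ss, b => b = c ∧ ∀ i, STy τ (ss i) (as.get i)
termination_by structural _ s => s

theorem sty_rename (τ : ℕ → A.Node) (s : Raw A) (ρ : ℕ → ℕ) (b : A.Node) :
    STy τ (s.rename ρ) b ↔ STy (τ ∘ ρ) s b := by
  induction s generalizing τ ρ b with
  | var y => simp [rename, STy]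
  | lam as s ih => simp only [rename, STy, ih, upEnv_comp_upRen]
  | app s t ih ih' => simp only [rename, STy, ih, ih']
  | tup ss ih => simp only [rename, STy, ih]
  | sub as s t ih ih' => simp only [rename, STy, ih, ih', upEnv_comp_upRen]
  | con f ss ih => simp only [rename, STy, ih]

theorem STy.congr {τ τ' : ℕ → A.Node} {s : Raw A} {b : A.Node} (h : STy τ s b)
    (hτ : ∀ x, s.occ x ≠ 0 → τ x = τ' x) : STy τ' s b := by
  have key : ∀ (as : List A.Node) (s : Raw A) (τ τ' : ℕ → A.Node),
      (∀ x, s.occ (x + as.length) ≠ 0 → τ x = τ' x) →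
      ∀ x, s.occ x ≠ 0 → upEnv as τ x = upEnv as τ' x := by
    intro as s τ τ' h x hx
    simp only [upEnv]
    split_ifs with hk
    · rfl
    · rw [h (x - as.length)]
      rwa [Nat.sub_add_cancel (by omega)]
  induction s generalizing τ τ' b with
  | var y => exact (hτ y (by simp [occ])).symm.trans h
  | lam as s ih =>
    obtain ⟨c, rfl, h⟩ := h
    exact ⟨c, rfl, ih h (key _ _ _ _ hτ)⟩
  | app s t ih ih' =>
    obtain ⟨as, h, h'⟩ := h
    exact ⟨as, ih h fun x hx => hτ x (by simp only [occ]; omega),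
      ih' h' fun x hx => hτ x (by simp only [occ]; omega)⟩
  | tup ss ih =>
    obtain ⟨as, rfl, h⟩ := h
    refine ⟨as, rfl, fun i => ih i (h i) fun x hx => hτ x fun h0 => hx ?_⟩
    simp only [occ, Finset.sum_eq_zero_iff] at h0
    exact h0 i (Finset.mem_univ i)
  | sub as s t ih ih' =>
    exact ⟨ih h.1 (key _ _ _ _ fun x hx => hτ x (by simp only [occ]; omega)),
      ih' h.2 fun x hx => hτ x (by simp only [occ]; omega)⟩
  | con f ss ih =>
    refine ⟨h.1, fun i => ih i (h.2 i) fun x hx => hτ x fun h0 => hx ?_⟩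
    simp only [occ, Finset.sum_eq_zero_iff] at h0
    exact h0 i (Finset.mem_univ i)

theorem STy.unique {τ : ℕ → A.Node} {s : Raw A} {b b' : A.Node} (h : STy τ s b)
    (h' : STy τ s b') : b = b' := by
  induction s generalizing τ b b' with
  | var y => exact h.symm.trans h'
  | lam as s ih =>
    obtain ⟨c, rfl, h⟩ := h
    obtain ⟨c', rfl, h'⟩ := h'
    rw [ih h h']
  | app s t ih ih' =>
    obtain ⟨as, h, -⟩ := h
    obtain ⟨as', h', -⟩ := h'
    have := ih h h'
    injection this
  | tup ss ih =>
    obtain ⟨as, rfl, h⟩ := h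
    obtain ⟨as', rfl, h'⟩ := h'
    rw [show as = as' from funext fun i => ih i (h i) (h' i)]
  | sub as s t ih ih' => exact ih h.1 h'.1
  | con f ss ih => exact h.1.trans h'.1.symm

end Raw

namespace Cx

theorem rename_rename (C : Cx A) (ρ ρ' : ℕ → ℕ) : (C.rename ρ').rename ρ = C.rename (ρ ∘ ρ') := by
  induction C generalizing ρ ρ' with
  | hole => rfl
  | _ => simp_all only [rename, upRen_comp, Raw.rename_rename]

theorem depth_rename (C : Cx A) (ρ : ℕ → ℕ) : (C.rename ρ).depth = C.depth := by
  induction C generalizing ρ with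
  | hole => rfl
  | _ => simp_all only [rename, depth]

theorem plug_rename (C : Cx A) (s : Raw A) (ρ : ℕ → ℕ) :
    (C.plug s).rename ρ = (C.rename ρ).plug (s.rename (upRen C.depth ρ)) := by
  induction C generalizing ρ with
  | hole => simp only [plug, depth, rename]; congr 1
  | lam as C ih => simp only [plug, depth, rename, Raw.rename, ih, upRen_upRen]
  | appL C t ih => simp only [plug, depth, rename, Raw.rename, ih]
  | appR t C ih => simp only [plug, depth, rename, Raw.rename, ih]
  | tup ss i C ih =>
    simp only [plug, depth, rename, Raw.rename, ← ih]
    congr 1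
    funext j
    rw [Function.apply_update (fun _ s => Raw.rename ρ s)]
  | subL as C t ih => simp only [plug, depth, rename, Raw.rename, ih, upRen_upRen]
  | subR as t C ih => simp only [plug, depth, rename, Raw.rename, ih]
  | con f ss i C ih =>
    simp only [plug, depth, rename, Raw.rename, ← ih]
    congr 1
    funext j
    rw [Function.apply_update (fun _ s => Raw.rename ρ s)]

/-- Substitution into a renamed context, whose effect on the context is again a renaming. -/
theorem plug_subst (C : Cx A) (s : Raw A) (ρ ρ' : ℕ → ℕ) (σ : ℕ → Raw A)
    (h : ∀ x, σ (ρ x) = .var (ρ' x)) :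
    ((C.rename ρ).plug s).subst σ = (C.rename ρ').plug (s.subst (Raw.upSub C.depth σ)) := by
  have hup : ∀ k ρ ρ' (σ : ℕ → Raw A), (∀ x, σ (ρ x) = .var (ρ' x)) →
      ∀ x, Raw.upSub k σ (upRen k ρ x) = .var (upRen k ρ' x) := by
    intro k ρ ρ' σ h x
    simp only [Raw.upSub, upRen]
    split_ifs <;> first | rfl | omega | simp [h, Raw.shift, Raw.rename]
  have hupup : ∀ k l (σ : ℕ → Raw A), Raw.upSub l (Raw.upSub k σ) = Raw.upSub (k + l) σ := by
    intro k l σ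
    funext i
    simp only [Raw.upSub, Raw.shift]
    split_ifs <;> try first | rfl | omega
    · simp only [Raw.rename]; congr 1; omega
    · rw [Raw.rename_rename, show i - l - k = i - (k + l) by omega]
      congr 1; funext j; simp; omega
  have hr : ∀ (t : Raw A) ρ ρ' (σ : ℕ → Raw A), (∀ x, σ (ρ x) = .var (ρ' x)) →
      (t.rename ρ).subst σ = t.rename ρ' := by
    intro t ρ ρ' σ h
    rw [Raw.subst_rename, Raw.rename_eq_subst]
    congr 1
    funext x
    exact h x
  induction C generalizing ρ ρ' σ with
  | hole =>
    simp only [plug, depth, rename]; congr 1; funext i; simp [Raw.upSub, Raw.shift]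
    exact (Raw.rename_id _).symm
  | lam as C ih => simp only [plug, depth, rename, Raw.subst, ih _ _ _ (hup _ _ _ _ h), hupup]
  | appL C t ih => simp only [plug, depth, rename, Raw.subst, ih _ _ _ h, hr _ _ _ _ h]
  | appR t C ih => simp only [plug, depth, rename, Raw.subst, ih _ _ _ h, hr _ _ _ _ h]
  | tup ss i C ih =>
    simp only [plug, depth, rename, Raw.subst, ← ih _ _ _ h]
    congr 1
    funext j
    rw [Function.apply_update (fun _ s => Raw.subst σ s)]
    congr 1
    funext j
    exact hr _ _ _ _ h
  | subL as C t ih =>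
    simp only [plug, depth, rename, Raw.subst, ih _ _ _ (hup _ _ _ _ h), hupup, hr _ _ _ _ h]
  | subR as t C ih =>
    simp only [plug, depth, rename, Raw.subst, ih _ _ _ h, hr _ _ _ _ (hup _ _ _ _ h)]
  | con f ss i C ih =>
    simp only [plug, depth, rename, Raw.subst, ← ih _ _ _ h]
    congr 1
    funext j
    rw [Function.apply_update (fun _ s => Raw.subst σ s)]
    congr 1
    funext j
    exact hr _ _ _ _ h

/-- Composition of contexts. -/
def comp : Cx A → Cx A → Cx A
  | hole, D => D
  | lam as C, D => lam as (C.comp D)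
  | appL C t, D => appL (C.comp D) t
  | appR s C, D => appR s (C.comp D)
  | tup ss i C, D => tup ss i (C.comp D)
  | subL as C t, D => subL as (C.comp D) t
  | subR as s C, D => subR as s (C.comp D)
  | con f ss i C, D => con f ss i (C.comp D)

theorem plug_comp (C D : Cx A) (s : Raw A) : (C.comp D).plug s = C.plug (D.plug s) := by
  induction C with
  | hole => rfl
  | _ => simp_all only [comp, plug]

end Cx

end RawTerms

/-! ### A characterization of typing -/

section Typing

variable {A : AutSignature.{u, v}}

theorem IsShuffle.perm {α : Type*} {k : ℕ} {γ : Fin k → List α} {Θ : List α}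
    (h : IsShuffle γ Θ) : (List.ofFn γ).flatten.Perm Θ := by
  obtain ⟨σ, -, hσ⟩ := h
  have h₁ : (List.ofFn γ).flatten = List.ofFn (Θ.get ∘ (finSigmaFinEquiv.symm.trans σ)) := by
    rw [show Θ.get ∘ (finSigmaFinEquiv.symm.trans σ) = blockConcat fun i => (γ i).get from
      funext fun p => hσ _ _, ofFn_blockConcat]
    congr 2
    funext i
    exact (List.ofFn_get _).symm
  rw [h₁]
  exact (ofFn_comp_equiv_perm _ _).trans (by rw [List.ofFn_get])

/-- For lists without repetition, the order of a shuffle is determined: it suffices that each list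
is a sublist. -/
theorem IsShuffle.of_sublist {α : Type*} {k : ℕ} {γ : Fin k → List α} {Θ : List α}
    (hs : ∀ i, (γ i).Sublist Θ) (hp : (List.ofFn γ).flatten.Perm Θ) (hn : Θ.Nodup) :
    IsShuffle γ Θ := by
  have h := fun i => List.sublist_iff_exists_fin_orderEmbedding_get_eq.1 (hs i)
  choose f hf using h
  have hn' := hp.nodup_iff.2 hn
  rw [List.nodup_flatten, List.pairwise_ofFn] at hn'
  have hd : ∀ i j, i ≠ j → List.Disjoint (γ i) (γ j) := by
    intro i j hij
    rcases lt_or_gt_of_ne hij with h | h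
    · exact hn'.2 h
    · exact (hn'.2 h).symm
  have hinj : Function.Injective fun q : Σ i, Fin (γ i).length => f q.1 q.2 := by
    rintro ⟨i, j⟩ ⟨i', j'⟩ h
    have h' := (hf i j).trans ((congrArg Θ.get h).trans (hf i' j').symm)
    by_cases hi : i = i'
    · subst hi
      exact congrArg (Sigma.mk i) ((f i).injective h)
    · exact (hd i i' hi (List.get_mem _ j) (h' ▸ List.get_mem _ j')).elim
  have hc : Fintype.card (Σ i, Fin (γ i).length) = Fintype.card (Fin Θ.length) := by
    rw [← Fintype.card_congr finSigmaFinEquiv.symm, Fintype.card_fin, Fintype.card_fin,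
      ← hp.length_eq, List.length_flatten, List.map_ofFn, List.sum_ofFn]
    rfl
  refine ⟨Equiv.ofBijective _ ((Fintype.bijective_iff_injective_and_card _).2 ⟨hinj, hc⟩), ?_, ?_⟩
  · intro i j j' hj
    exact (f i).monotone hj
  · intro i j
    exact (hf i j).symm

/-- As the variables of a context are distinct, it extends to an assignment of types to all
variables. -/
theorem exists_env {Θ : TyCtx A} (h : (Θ.map Prod.fst).Nodup) (τ₀ : ℕ → A.Node) :
    ∃ τ : ℕ → A.Node, ∀ p ∈ Θ, τ p.1 = p.2 := by
  induction Θ with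
  | nil => exact ⟨τ₀, by simp⟩
  | cons p Θ ih =>
    rw [List.map_cons, List.nodup_cons] at h
    obtain ⟨τ, hτ⟩ := ih h.2
    refine ⟨Function.update τ p.1 p.2, fun q hq => ?_⟩
    rcases List.mem_cons.1 hq with rfl | hq
    · simp
    · rw [Function.update_of_ne, hτ q hq]
      intro e
      exact h.1 (e ▸ List.mem_map_of_mem hq)

/-- The numbers of occurrences of the variables of a term are those of a linear term in the
context `Θ`. -/
def OccIn (o : ℕ → ℕ) (Θ : TyCtx A) : Prop := ∀ x, o x = if x ∈ Θ.map Prod.fst then 1 else 0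

/-- An order-free description of the typing judgement: simple typing, together with linearity. -/
structure WT (Θ : TyCtx A) (s : Raw A) (b : A.Node) : Prop where
  nodup : (Θ.map Prod.fst).Nodup
  lin : s.Lin
  occ : OccIn s.occ Θ
  sty : ∃ τ : ℕ → A.Node, (∀ p ∈ Θ, τ p.1 = p.2) ∧ Raw.STy τ s b

theorem WT.sty_all {Θ : TyCtx A} {s : Raw A} {b : A.Node} (h : WT Θ s b) {τ : ℕ → A.Node}
    (hτ : ∀ p ∈ Θ, τ p.1 = p.2) : Raw.STy τ s b := by
  obtain ⟨τ', hτ', hs⟩ := h.sty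
  refine hs.congr fun x hx => ?_
  rw [h.occ x] at hx
  obtain ⟨p, hp, rfl⟩ := List.mem_map.1 (not_not.1 fun hm => hx (if_neg hm))
  rw [hτ p hp, hτ' p hp]

theorem WT.perm {Θ Θ' : TyCtx A} {s : Raw A} {b : A.Node} (h : WT Θ s b) (hp : Θ.Perm Θ') :
    WT Θ' s b := by
  refine ⟨(hp.map _).nodup_iff.1 h.nodup, h.lin, fun x => ?_, ?_⟩
  · rw [h.occ x]
    exact if_congr (hp.map _).mem_iff rfl rfl
  · obtain ⟨τ, hτ, hs⟩ := h.sty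
    exact ⟨τ, fun p hp' => hτ p (hp.mem_iff.2 hp'), hs⟩

theorem enumCtx_names (as : List A.Node) : (enumCtx as).map Prod.fst = List.range as.length := by
  rw [enumCtx_eq_ofFn, List.map_ofFn]
  apply List.ext_get <;> simp

theorem enumCtx_types (as : List A.Node) : (enumCtx as).map Prod.snd = as := by
  rw [enumCtx_eq_ofFn, List.map_ofFn]
  apply List.ext_get <;> simp

theorem shift_names (γ : TyCtx A) (k : ℕ) :
    (γ.shift k).map Prod.fst = (γ.map Prod.fst).map (· + k) := by
  simp [TyCtx.shift]

theorem shift_types (γ : TyCtx A) (k : ℕ) : (γ.shift k).map Prod.snd = γ.map Prod.snd := by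
  simp [TyCtx.shift]

theorem mem_enumCtx {as : List A.Node} {p : ℕ × A.Node} :
    p ∈ enumCtx as ↔ ∃ h : p.1 < as.length, as.get ⟨p.1, h⟩ = p.2 := by
  rw [enumCtx_eq_ofFn, List.mem_ofFn']
  constructor
  · rintro ⟨i, rfl⟩; exact ⟨i.2, rfl⟩
  · rintro ⟨h, e⟩; exact ⟨⟨p.1, h⟩, Prod.ext rfl e⟩

theorem upEnv_agree {γ : TyCtx A} {as : List A.Node} {τ : ℕ → A.Node} (h : ∀ p ∈ γ, τ p.1 = p.2) :
    ∀ p ∈ γ.shift as.length ++ enumCtx as, upEnv as τ p.1 = p.2 := by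
  intro p hp
  rcases List.mem_append.1 hp with hp | hp
  · obtain ⟨q, hq, rfl⟩ := List.mem_map.1 hp
    simpa [upEnv] using h q hq
  · obtain ⟨h, e⟩ := mem_enumCtx.1 hp
    simpa [upEnv, h] using e

theorem upEnv_eq_of_agree {as : List A.Node} {τ : ℕ → A.Node} (h : ∀ p ∈ enumCtx as, τ p.1 = p.2) :
    upEnv as (fun i => τ (i + as.length)) = τ := by
  funext i
  simp only [upEnv]
  split_ifs with hi
  · exact (h (i, as.get ⟨i, hi⟩) (mem_enumCtx.2 ⟨hi, rfl⟩)).symm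
  · congr 1; omega

theorem mem_shift_names {γ : TyCtx A} {as : List A.Node} {x : ℕ} :
    x ∈ (γ.shift as.length ++ enumCtx as).map Prod.fst ↔
      x < as.length ∨ as.length ≤ x ∧ x - as.length ∈ γ.map Prod.fst := by
  rw [List.map_append, List.mem_append, shift_names, enumCtx_names, List.mem_range, List.mem_map]
  constructor
  · rintro (⟨y, hy, rfl⟩ | h)
    · exact .inr ⟨by omega, by simpa using hy⟩
    · exact .inl h
  · rintro (h | ⟨h, h'⟩)
    · exact .inr h
    · exact .inl ⟨_, h', by omega⟩

theorem shift_nodup {γ : TyCtx A} {as : List A.Node} :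
    ((γ.shift as.length ++ enumCtx as).map Prod.fst).Nodup ↔ (γ.map Prod.fst).Nodup := by
  rw [List.map_append, shift_names, enumCtx_names, List.nodup_append]
  constructor
  · rintro ⟨h, -, -⟩
    exact h.of_map
  · intro h
    refine ⟨h.map (add_injective _), List.nodup_range, ?_⟩
    intro a ha b hb e
    obtain ⟨y, -, rfl⟩ := List.mem_map.1 ha
    rw [List.mem_range] at hb
    omega

/-- Typing of the body of a binder. -/
theorem wt_bind_iff {γ : TyCtx A} {as : List A.Node} {s : Raw A} {b : A.Node} :
    WT (γ.shift as.length ++ enumCtx as) s b ↔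
      (γ.map Prod.fst).Nodup ∧ s.Lin ∧ (∀ i < as.length, s.occ i = 1) ∧
      OccIn (fun x => s.occ (x + as.length)) γ ∧
      ∃ τ : ℕ → A.Node, (∀ p ∈ γ, τ p.1 = p.2) ∧ Raw.STy (upEnv as τ) s b := by
  constructor
  · rintro ⟨hn, hl, ho, τ, hτ, hs⟩
    refine ⟨shift_nodup.1 hn, hl, fun i hi => ?_, fun x => ?_, fun i => τ (i + as.length), ?_, ?_⟩
    · rw [ho, if_pos (mem_shift_names.2 (.inl hi))]
    · refine (ho _).trans (if_congr ?_ rfl rfl)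
      rw [mem_shift_names]
      simp
    · intro p hp
      exact hτ (p.1 + as.length, p.2) (List.mem_append_left _ (List.mem_map.2 ⟨p, hp, rfl⟩))
    · rwa [upEnv_eq_of_agree fun p hp => hτ p (List.mem_append_right _ hp)]
  · rintro ⟨hn, hl, hi, ho, τ, hτ, hs⟩
    refine ⟨shift_nodup.2 hn, hl, fun x => ?_, upEnv as τ, upEnv_agree hτ, hs⟩
    by_cases hx : x < as.length
    · rw [hi x hx, if_pos (mem_shift_names.2 (.inl hx))]
    · have := ho (x - as.length)
      simp only [Nat.sub_add_cancel (not_lt.1 hx)] at this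
      rw [this]
      congr 1
      rw [mem_shift_names]
      simp [hx, not_lt.1 hx]

theorem Merge.nodup {k : ℕ} {γ : Fin k → TyCtx A} {Θ : TyCtx A} (h : Merge γ Θ)
    (hn : ∀ i, ((γ i).map Prod.fst).Nodup) : (Θ.map Prod.fst).Nodup := by
  rw [← (h.2.perm.map Prod.fst).nodup_iff, List.map_flatten, List.nodup_flatten, List.map_ofFn,
    List.pairwise_ofFn]
  refine ⟨fun l hl => ?_, fun i j hij => h.1 i j hij.ne⟩
  obtain ⟨i, rfl⟩ := (List.mem_ofFn' _ _).1 hl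
  exact hn i

theorem Merge.subset {k : ℕ} {γ : Fin k → TyCtx A} {Θ : TyCtx A} (h : Merge γ Θ) (i : Fin k)
    {p : ℕ × A.Node} (hp : p ∈ γ i) : p ∈ Θ :=
  h.2.perm.mem_iff.1 (List.mem_flatten.2 ⟨_, (List.mem_ofFn' _ _).2 ⟨i, rfl⟩, hp⟩)

theorem Merge.occIn {k : ℕ} {γ : Fin k → TyCtx A} {Θ : TyCtx A} (h : Merge γ Θ)
    {o : Fin k → ℕ → ℕ} (ho : ∀ i, OccIn (o i) (γ i)) : OccIn (fun x => ∑ i, o i x) Θ := by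
  intro x
  simp only [fun i => ho i x]
  by_cases hx : x ∈ Θ.map Prod.fst
  · rw [← (h.2.perm.map Prod.fst).mem_iff, List.map_flatten, List.mem_flatten, List.map_ofFn] at hx
    obtain ⟨l, hl, hx⟩ := hx
    obtain ⟨i, rfl⟩ := (List.mem_ofFn' _ _).1 hl
    have hx' : x ∈ (γ i).map Prod.fst := hx
    rw [Finset.sum_eq_single i, if_pos hx', if_pos]
    · obtain ⟨p, hp, rfl⟩ := List.mem_map.1 hx'
      exact List.mem_map_of_mem (h.subset i hp)
    · intro j _ hj
      exact if_neg fun hxj => h.1 j i hj hxj hx'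
    · simp
  · rw [if_neg hx]
    refine Finset.sum_eq_zero fun i _ => if_neg fun hxi => hx ?_
    obtain ⟨p, hp, rfl⟩ := List.mem_map.1 hxi
    exact List.mem_map_of_mem (h.subset i hp)

/-- The part of a context that a term uses. -/
def usedCtx (Θ : TyCtx A) (o : ℕ → ℕ) : TyCtx A := Θ.filter fun p => o p.1 ≠ 0

theorem sum_occ_unique {k : ℕ} {o : Fin k → ℕ → ℕ} {x : ℕ} (h : ∑ i, o i x ≤ 1) {i j : Fin k}
    (hij : i ≠ j) (hi : o i x ≠ 0) : o j x = 0 := by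
  by_contra hj
  have h₁ : o i x + o j x ≤ ∑ i, o i x := by
    rw [← Finset.sum_pair (f := fun i => o i x) hij]
    exact Finset.sum_le_sum_of_subset (Finset.subset_univ _)
  omega

/-- A context is a shuffle of the parts of it that are used by terms, provided that each variable is
used exactly once. -/
theorem merge_usedCtx {k : ℕ} {Θ : TyCtx A} {o : Fin k → ℕ → ℕ} (hn : (Θ.map Prod.fst).Nodup)
    (ho : OccIn (fun x => ∑ i, o i x) Θ) : Merge (fun i => usedCtx Θ (o i)) Θ := by
  have hle : ∀ x, ∑ i, o i x ≤ 1 := fun x => by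
    have := ho x
    simp only at this
    split_ifs at this <;> omega
  have hd : ∀ i j, i ≠ j →
      List.Disjoint ((usedCtx Θ (o i)).map Prod.fst) ((usedCtx Θ (o j)).map Prod.fst) := by
    intro i j hij x hx hx'
    obtain ⟨p, hp, rfl⟩ := List.mem_map.1 hx
    obtain ⟨q, hq, e⟩ := List.mem_map.1 hx'
    have h₁ := (List.mem_filter.1 hp).2
    have h₂ := (List.mem_filter.1 hq).2
    simp only [ne_eq, decide_not, Bool.not_eq_eq_eq_not, Bool.not_true, decide_eq_false_iff_not]
      at h₁ h₂
    rw [e] at h₂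
    exact h₂ (sum_occ_unique (hle p.1) hij h₁)
  refine ⟨hd, IsShuffle.of_sublist (fun i => List.filter_sublist) ?_ hn.of_map⟩
  rw [List.perm_ext_iff_of_nodup _ hn.of_map]
  · intro p
    simp only [List.mem_flatten, List.mem_ofFn', Set.mem_range, exists_exists_eq_and]
    constructor
    · rintro ⟨i, hi⟩
      exact (List.mem_filter.1 hi).1
    · intro hp
      have := ho p.1
      simp only [if_pos (List.mem_map_of_mem (f := Prod.fst) hp)] at this
      obtain ⟨i, -, hi⟩ := Finset.exists_ne_zero_of_sum_ne_zero (this.trans_ne one_ne_zero)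
      exact ⟨i, List.mem_filter.2 ⟨hp, by simpa using hi⟩⟩
  · rw [List.nodup_flatten, List.pairwise_ofFn]
    refine ⟨fun l hl => ?_, fun i j hij p hp hp' =>
      hd i j hij.ne (List.mem_map_of_mem hp) (List.mem_map_of_mem hp')⟩
    obtain ⟨i, rfl⟩ := (List.mem_ofFn' _ _).1 hl
    exact hn.of_map.filter _

theorem usedCtx_nodup {Θ : TyCtx A} {o : ℕ → ℕ} (hn : (Θ.map Prod.fst).Nodup) :
    ((usedCtx Θ o).map Prod.fst).Nodup :=
  hn.sublist (List.filter_sublist.map _)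

theorem occIn_usedCtx {Θ : TyCtx A} {o : ℕ → ℕ}
    (h : ∀ x, o x ≤ if x ∈ Θ.map Prod.fst then 1 else 0) : OccIn o (usedCtx Θ o) := by
  intro x
  have hx := h x
  by_cases h0 : o x = 0
  · rw [h0, if_neg]
    intro hm
    obtain ⟨p, hp, rfl⟩ := List.mem_map.1 hm
    have := (List.mem_filter.1 hp).2
    simp [h0] at this
  · by_cases hm : x ∈ Θ.map Prod.fst
    · rw [if_pos hm] at hx
      obtain ⟨p, hp, rfl⟩ := List.mem_map.1 hm
      rw [if_pos]
      · omega
      · exact List.mem_map_of_mem (List.mem_filter.2 ⟨hp, by simpa using h0⟩)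
    · rw [if_neg hm] at hx; omega

theorem occIn_usedCtx_of_sum {k : ℕ} {Θ : TyCtx A} {o : Fin k → ℕ → ℕ}
    (ho : OccIn (fun x => ∑ i, o i x) Θ) (i : Fin k) : OccIn (o i) (usedCtx Θ (o i)) := by
  refine occIn_usedCtx fun x => ?_
  rw [← ho x]
  exact Finset.single_le_sum (f := fun i => o i x) (fun _ _ => Nat.zero_le _) (Finset.mem_univ i)

theorem usedCtx_agree {Θ : TyCtx A} {o : ℕ → ℕ} {τ : ℕ → A.Node} (h : ∀ p ∈ Θ, τ p.1 = p.2) :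
    ∀ p ∈ usedCtx Θ o, τ p.1 = p.2 := fun p hp => h p (List.mem_filter.1 hp).1

theorem Typed.wt {Θ : TyCtx A} {s : Raw A} {b : A.Node} (h : Typed Θ s b) : WT Θ s b := by
  induction h with
  | var x a => exact ⟨by simp, trivial, fun y => by simp [Raw.occ, eq_comm], fun _ => a, by simp,
      rfl⟩
  | @tup k γ ss as Θ _ hm ih =>
    have hn := hm.nodup fun i => (ih i).nodup
    obtain ⟨τ, hτ⟩ := exists_env hn fun _ => .tensor []
    exact ⟨hn, fun i => (ih i).lin, hm.occIn fun i => (ih i).occ, τ, hτ, as, rfl,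
      fun i => (ih i).sty_all fun p hp => hτ p (hm.subset i hp)⟩
  | lam _ ih =>
    obtain ⟨hn, hl, hi, ho, τ, hτ, hs⟩ := wt_bind_iff.1 ih
    exact ⟨hn, ⟨hi, hl⟩, ho, τ, hτ, _, rfl, hs⟩
  | @app γ δ Θ s t as b _ _ hm ih ih' =>
    have hn := hm.nodup fun i => by fin_cases i; exacts [ih.nodup, ih'.nodup]
    obtain ⟨τ, hτ⟩ := exists_env hn fun _ => .tensor []
    have ho := hm.occIn (o := ![s.occ, t.occ]) fun i => by fin_cases i; exacts [ih.occ, ih'.occ]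
    exact ⟨hn, ⟨ih.lin, ih'.lin⟩, fun x => by rw [← ho x]; simp [Raw.occ], τ, hτ, as,
      ih.sty_all fun p hp => hτ p (hm.subset 0 hp), ih'.sty_all fun p hp => hτ p (hm.subset 1 hp)⟩
  | @sub γ δ₁ δ₂ Θ s t as b _ _ hm ih ih' =>
    have ih₂ : WT (TyCtx.shift as.length (δ₁ ++ δ₂) ++ enumCtx as) t b := by
      refine ih'.perm ?_
      simp only [TyCtx.shift, List.map_append, List.append_assoc]
      exact List.perm_append_comm.append_left _
    obtain ⟨hn', hl, hi, ho', τ', hτ', hs⟩ := wt_bind_iff.1 ih₂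
    rw [List.map_append] at hn'
    obtain ⟨hn₁, hn₂, hn₃⟩ := List.nodup_append.1 hn'
    have hn := hm.nodup fun i => by fin_cases i; exacts [ih.nodup, hn₁, hn₂]
    obtain ⟨τ, hτ⟩ := exists_env hn fun _ => .tensor []
    have ho := hm.occIn (o := ![s.occ, fun x => if x ∈ δ₁.map Prod.fst then 1 else 0,
      fun x => if x ∈ δ₂.map Prod.fst then 1 else 0]) fun i => by
        fin_cases i
        exacts [ih.occ, fun x => rfl, fun x => rfl]
    refine ⟨hn, ⟨hi, hl, ih.lin⟩, fun x => ?_, τ, hτ, ?_,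
      ih.sty_all fun p hp => hτ p (hm.subset 0 hp)⟩
    · rw [← ho x]
      have h₁ := ho' x
      simp only [List.map_append, List.mem_append] at h₁
      have h₂ := hn₃ x
      simp only [Raw.occ, h₁, Fin.sum_univ_three, Matrix.cons_val_zero, Matrix.cons_val_one,
        Matrix.cons_val]
      by_cases e₁ : x ∈ δ₁.map Prod.fst <;> by_cases e₂ : x ∈ δ₂.map Prod.fst
      · exact (h₂ e₁ x e₂ rfl).elim
      all_goals simp only [e₁, e₂, or_false, or_true, or_self, if_true, if_false]; omega
    · refine ih₂.sty_all (upEnv_agree fun p hp => hτ p ?_)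
      rcases List.mem_append.1 hp with hp | hp
      exacts [hm.subset 1 hp, hm.subset 2 hp]
  | @con as b f γ ss Θ _ hm ih =>
    have hn := hm.nodup fun i => (ih i).nodup
    obtain ⟨τ, hτ⟩ := exists_env hn fun _ => .tensor []
    exact ⟨hn, fun i => (ih i).lin, hm.occIn fun i => (ih i).occ, τ, hτ, rfl,
      fun i => (ih i).sty_all fun p hp => hτ p (hm.subset i hp)⟩

/-- Linearity determines how the context is to be distributed over the subterms: each of them gets
the part of the context that it uses. -/
theorem WT.typed {Θ : TyCtx A} {s : Raw A} {b : A.Node} (h : WT Θ s b) : Typed Θ s b := by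
  induction s generalizing Θ b with
  | var x =>
    obtain ⟨hn, -, ho, τ, hτ, hs⟩ := h
    have hm : ∀ y, y ∈ Θ.map Prod.fst ↔ y = x := fun y => by
      have := ho y
      by_cases hm : y ∈ Θ.map Prod.fst
      · rw [if_pos hm] at this
        refine ⟨fun _ => by_contra fun e => ?_, fun _ => hm⟩
        rw [Raw.occ, if_neg (Ne.symm e)] at this
        omega
      · rw [if_neg hm] at this
        refine ⟨fun h => (hm h).elim, fun e => ?_⟩
        rw [Raw.occ, if_pos e.symm] at this
        omega
    have hΘ : Θ.map Prod.fst = [x] := by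
      rw [← List.perm_singleton, List.perm_ext_iff_of_nodup hn (by simp)]
      simpa using hm
    match Θ, hΘ with
    | [(y, a)], hΘ =>
      obtain rfl : y = x := by simpa using hΘ
      obtain rfl : a = b := (hτ (y, a) (by simp)).symm.trans hs
      exact .var _ _
  | lam as s ih =>
    obtain ⟨hn, ⟨hi, hl⟩, ho, τ, hτ, c, rfl, hs⟩ := h
    exact .lam (ih (wt_bind_iff.2 ⟨hn, hl, hi, ho, τ, hτ, hs⟩))
  | app s t ih ih' =>
    obtain ⟨hn, hl, ho, τ, hτ, as, hs, ht⟩ := h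
    have ho' : OccIn (fun x => ∑ i, (![s.occ, t.occ] : Fin 2 → ℕ → ℕ) i x) Θ := fun x => by
      rw [← ho x]; simp [Raw.occ]
    have hm := merge_usedCtx hn ho'
    rw [show (fun i => usedCtx Θ ((![s.occ, t.occ] : Fin 2 → ℕ → ℕ) i)) =
      ![usedCtx Θ s.occ, usedCtx Θ t.occ] from funext fun i => by fin_cases i <;> rfl] at hm
    exact .app (ih ⟨usedCtx_nodup hn, hl.1, occIn_usedCtx_of_sum ho' 0, τ, usedCtx_agree hτ, hs⟩)
      (ih' ⟨usedCtx_nodup hn, hl.2, occIn_usedCtx_of_sum ho' 1, τ, usedCtx_agree hτ, ht⟩) hm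
  | tup ss ih =>
    obtain ⟨hn, hl, ho, τ, hτ, as, rfl, hs⟩ := h
    exact .tup (fun i => ih i ⟨usedCtx_nodup hn, hl i, occIn_usedCtx_of_sum ho i, τ,
      usedCtx_agree hτ, hs i⟩) (merge_usedCtx hn ho)
  | sub as s t ih ih' =>
    obtain ⟨hn, ⟨hi, hl, hl'⟩, ho, τ, hτ, hs, ht⟩ := h
    have ho' : OccIn (fun x => ∑ i,
        (![t.occ, fun x => s.occ (x + as.length), fun _ => 0] : Fin 3 → ℕ → ℕ) i x) Θ :=
      fun x => by
        rw [← ho x]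
        simp only [Raw.occ, Fin.sum_univ_three, Matrix.cons_val_zero, Matrix.cons_val_one,
          Matrix.cons_val]
        omega
    have hm := merge_usedCtx hn ho'
    rw [show (fun i => usedCtx Θ
        ((![t.occ, fun x => s.occ (x + as.length), fun _ => 0] : Fin 3 → ℕ → ℕ) i)) =
      ![usedCtx Θ t.occ, usedCtx Θ fun x => s.occ (x + as.length), []] from
        funext fun i => by fin_cases i <;> simp [usedCtx]] at hm
    refine .sub (ih' ⟨usedCtx_nodup hn, hl', occIn_usedCtx_of_sum ho' 0, τ, usedCtx_agree hτ, ht⟩)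
      ?_ hm
    rw [show TyCtx.shift as.length ([] : TyCtx A) = [] from rfl, List.append_nil]
    exact ih (wt_bind_iff.2 ⟨usedCtx_nodup hn, hl, hi, occIn_usedCtx_of_sum ho' 1, τ,
      usedCtx_agree hτ, hs⟩)
  | con f ss ih =>
    obtain ⟨hn, hl, ho, τ, hτ, rfl, hs⟩ := h
    exact .con f (fun i => ih i ⟨usedCtx_nodup hn, hl i, occIn_usedCtx_of_sum ho i, τ,
      usedCtx_agree hτ, hs i⟩) (merge_usedCtx hn ho)

theorem typed_iff_wt {Θ : TyCtx A} {s : Raw A} {b : A.Node} : Typed Θ s b ↔ WT Θ s b :=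
  ⟨Typed.wt, WT.typed⟩

theorem Typed.perm {Θ Θ' : TyCtx A} {s : Raw A} {b : A.Node} (h : Typed Θ s b)
    (hp : Θ.Perm Θ') : Typed Θ' s b := (h.wt.perm hp).typed

end Typing

/-! ### Structural equivalence preserves typing -/

section StrEqTyping

variable {A : AutSignature.{u, v}}

/-- Terms with the same occurrences of free variables and the same simple types, of which one is
linear if and only if the other one is. -/
structure SameTyping (s t : Raw A) : Prop where
  occ (x : ℕ) : s.occ x = t.occ x
  lin : s.Lin ↔ t.Lin
  sty (τ : ℕ → A.Node) (b : A.Node) : Raw.STy τ s b ↔ Raw.STy τ t b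

namespace SameTyping

theorem refl (s : Raw A) : SameTyping s s := ⟨fun _ => rfl, Iff.rfl, fun _ _ => Iff.rfl⟩

theorem symm {s t : Raw A} (h : SameTyping s t) : SameTyping t s :=
  ⟨fun x => (h.occ x).symm, h.lin.symm, fun τ b => (h.sty τ b).symm⟩

theorem trans {s t r : Raw A} (h : SameTyping s t) (h' : SameTyping t r) : SameTyping s r :=
  ⟨fun x => (h.occ x).trans (h'.occ x), h.lin.trans h'.lin,
    fun τ b => (h.sty τ b).trans (h'.sty τ b)⟩

theorem typed_iff {s t : Raw A} (h : SameTyping s t) {Θ : TyCtx A} {b : A.Node} :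
    Typed Θ s b ↔ Typed Θ t b := by
  rw [typed_iff_wt, typed_iff_wt]
  constructor
  · rintro ⟨hn, hl, ho, τ, hτ, hs⟩
    exact ⟨hn, h.lin.1 hl, fun x => (h.occ x).symm.trans (ho x), τ, hτ, (h.sty τ b).1 hs⟩
  · rintro ⟨hn, hl, ho, τ, hτ, hs⟩
    exact ⟨hn, h.lin.2 hl, fun x => (h.occ x).trans (ho x), τ, hτ, (h.sty τ b).2 hs⟩

theorem update {k : ℕ} {ss : Fin k → Raw A} {i : Fin k} {s t : Raw A} (h : SameTyping s t)
    (j : Fin k) : SameTyping (Function.update ss i s j) (Function.update ss i t j) := by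
  by_cases hj : j = i
  · subst hj; simpa using h
  · simp only [Function.update_of_ne hj]; exact refl _

theorem tup {k : ℕ} {ss ts : Fin k → Raw A} (h : ∀ i, SameTyping (ss i) (ts i)) :
    SameTyping (.tup ss) (.tup ts) :=
  ⟨fun x => Finset.sum_congr rfl fun i _ => (h i).occ x, forall_congr' fun i => (h i).lin,
    fun τ _ => exists_congr fun as => and_congr_right fun _ =>
      forall_congr' fun i => (h i).sty τ (as i)⟩

theorem con {as : List A.Node} {b : A.Node} (f : A.Arr as b) {ss ts : Fin as.length → Raw A}
    (h : ∀ i, SameTyping (ss i) (ts i)) : SameTyping (.con f ss) (.con f ts) :=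
  ⟨fun x => Finset.sum_congr rfl fun i _ => (h i).occ x, forall_congr' fun i => (h i).lin,
    fun τ _ => and_congr_right fun _ => forall_congr' fun i => (h i).sty τ (as.get i)⟩

theorem sub {as : List A.Node} {s s' t t' : Raw A} (h : SameTyping s s') (h' : SameTyping t t') :
    SameTyping (.sub as s t) (.sub as s' t') :=
  ⟨fun x => by simp only [Raw.occ, h.occ, h'.occ], by simp only [Raw.Lin, h.occ, h.lin, h'.lin],
    fun τ b => by simp only [Raw.STy, h.sty, h'.sty]⟩

theorem app {s s' t t' : Raw A} (h : SameTyping s s') (h' : SameTyping t t') :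
    SameTyping (.app s t) (.app s' t') :=
  ⟨fun x => by simp only [Raw.occ, h.occ, h'.occ], by simp only [Raw.Lin, h.lin, h'.lin],
    fun τ b => by simp only [Raw.STy, h.sty, h'.sty]⟩

theorem lam {as : List A.Node} {s s' : Raw A} (h : SameTyping s s') :
    SameTyping (.lam as s) (.lam as s') :=
  ⟨fun x => by simp only [Raw.occ, h.occ], by simp only [Raw.Lin, h.occ, h.lin],
    fun τ b => by simp only [Raw.STy, h.sty]⟩

theorem plug (C : Cx A) {s t : Raw A} (h : SameTyping s t) :
    SameTyping (C.plug s) (C.plug t) := by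
  induction C with
  | hole => exact h
  | lam as C ih => exact lam ih
  | appL C t ih => exact app ih (refl _)
  | appR t C ih => exact app (refl _) ih
  | tup ss i C ih => exact tup fun j => update ih j
  | subL as C t ih => exact sub ih (refl _)
  | subR as t C ih => exact sub (refl _) ih
  | con f ss i C ih => exact con f fun j => update ih j

end SameTyping

theorem exchange_injective (k d : ℕ) : Function.Injective (exchange k d) := by
  intro i j h
  simp only [exchange] at h
  split_ifs at h <;> omega

theorem exchange_zero (k : ℕ) : exchange k 0 = id := by
  funext i; simp only [exchange, id]; split_ifs <;> omega

theorem occ_exchange_lt {k d x : ℕ} (s : Raw A) (h : x < d) :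
    (s.rename (exchange k d)).occ x = s.occ (x + k) := by
  rw [← Raw.occ_rename (exchange_injective k d) s]
  congr 1
  simp only [exchange]
  split_ifs <;> omega

theorem occ_exchange_mid {k d x : ℕ} (s : Raw A) (h : x < k) :
    (s.rename (exchange k d)).occ (x + d) = s.occ x := by
  rw [← Raw.occ_rename (exchange_injective k d) s]
  congr 1
  simp [exchange, h]

theorem occ_exchange_add {k d x : ℕ} (s : Raw A) :
    (s.rename (exchange k d)).occ (x + k + d) = s.occ (x + d + k) := by
  rw [← Raw.occ_rename (exchange_injective k d) s]
  congr 1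
  simp only [exchange]
  split_ifs <;> omega

theorem upEnv_upEnv_exchange (as bs : List A.Node) (τ : ℕ → A.Node) :
    upEnv bs (upEnv as τ) ∘ exchange as.length bs.length = upEnv as (upEnv bs τ) := by
  funext i
  rw [Function.comp]
  by_cases h : i < as.length
  · rw [show exchange as.length bs.length i = i + bs.length by simp [exchange, h]]
    simp [upEnv, h]
  · by_cases h' : i < as.length + bs.length
    · rw [show exchange as.length bs.length i = i - as.length by simp [exchange, h, h']]
      simp only [upEnv]
      rw [dif_pos (by omega), dif_neg h, dif_pos (by omega)]
    · rw [show exchange as.length bs.length i = i by simp [exchange, h, h']]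
      simp only [upEnv]
      rw [dif_neg (by omega), dif_neg (by omega), dif_neg (by omega), dif_neg (by omega)]
      congr 1; omega

theorem upEnv_comp_add (as : List A.Node) (τ : ℕ → A.Node) :
    (upEnv as τ) ∘ (· + as.length) = τ := by
  funext i; simp [upEnv]

theorem sty_shift (as : List A.Node) (τ : ℕ → A.Node) (s : Raw A) (b : A.Node) :
    Raw.STy (upEnv as τ) (s.shift as.length) b ↔ Raw.STy τ s b := by
  rw [Raw.shift, Raw.sty_rename, upEnv_comp_add]

theorem lin_shift (k : ℕ) (s : Raw A) : (s.shift k).Lin ↔ s.Lin :=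
  Raw.lin_rename (add_injective k) s

theorem lin_exchange (k d : ℕ) (s : Raw A) : (s.rename (exchange k d)).Lin ↔ s.Lin :=
  Raw.lin_rename (exchange_injective k d) s

theorem sameTyping_lam (as bs : List A.Node) (s t : Raw A) :
    SameTyping (.lam bs (.sub as s (t.shift bs.length)))
      (.sub as (.lam bs (s.rename (exchange as.length bs.length))) t) := by
  refine ⟨fun x => ?_, ?_, fun τ b => ?_⟩
  · simp only [Raw.occ, occ_exchange_add, Raw.occ_shift_add]
  · simp +contextual only [Raw.Lin, Raw.occ, occ_exchange_lt, occ_exchange_mid, Raw.occ_shift_lt,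
      lin_shift, lin_exchange, add_zero]
    tauto
  · simp only [Raw.STy, Raw.sty_rename, upEnv_upEnv_exchange, sty_shift]
    constructor
    · rintro ⟨c, rfl, h, h'⟩; exact ⟨⟨c, rfl, h⟩, h'⟩
    · rintro ⟨⟨c, rfl, h⟩, h'⟩; exact ⟨c, rfl, h, h'⟩

theorem sameTyping_subL (as bs : List A.Node) (s t r : Raw A) :
    SameTyping (.sub bs (.sub as s (t.shift bs.length)) r)
      (.sub as (.sub bs (s.rename (exchange as.length bs.length)) (r.shift as.length)) t) := by
  refine ⟨fun x => ?_, ?_, fun τ b => ?_⟩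
  · simp only [Raw.occ, occ_exchange_add, Raw.occ_shift_add]; omega
  · simp +contextual only [Raw.Lin, Raw.occ, occ_exchange_lt, occ_exchange_mid, Raw.occ_shift_lt,
      lin_shift, lin_exchange, add_zero]
    tauto
  · simp only [Raw.STy, Raw.sty_rename, upEnv_upEnv_exchange, sty_shift]
    tauto

theorem sameTyping_subR (as bs : List A.Node) (s t r : Raw A) :
    SameTyping (.sub bs r (.sub as s t))
      (.sub as (.sub bs (r.rename (upRen bs.length (· + as.length))) s) t) := by
  have h₁ : ∀ i, (r.rename (upRen bs.length (· + as.length))).occ (i + as.length + bs.length) =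
      r.occ (i + bs.length) := by
    intro i
    rw [← Raw.occ_rename (upRen_injective (add_injective as.length) bs.length) r]
    congr 1; simp [upRen]
  have h₂ : ∀ i < bs.length, (r.rename (upRen bs.length (· + as.length))).occ i = r.occ i := by
    intro i hi
    rw [← Raw.occ_rename (upRen_injective (add_injective as.length) bs.length) r]
    congr 1; simp [upRen, hi]
  have h₃ : ∀ i < as.length,
      (r.rename (upRen bs.length (· + as.length))).occ (i + bs.length) = 0 := by
    intro i hi
    refine Raw.occ_rename_eq_zero r _ fun x => ?_
    simp only [upRen]
    split_ifs <;> omega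
  refine ⟨fun x => ?_, ?_, fun τ b => ?_⟩
  · simp only [Raw.occ, h₁]; omega
  · simp +contextual only [Raw.Lin, Raw.occ, h₂, h₃, zero_add,
      Raw.lin_rename (upRen_injective (add_injective as.length) bs.length)]
    tauto
  · simp only [Raw.STy, Raw.sty_rename, upEnv_comp_upRen, upEnv_comp_add]
    tauto

theorem sameTyping_appL (as : List A.Node) (s t r : Raw A) :
    SameTyping (.app (.sub as s t) r) (.sub as (.app s (r.shift as.length)) t) := by
  refine ⟨fun x => ?_, ?_, fun τ b => ?_⟩
  · simp only [Raw.occ, Raw.occ_shift_add]; omega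
  · simp +contextual only [Raw.Lin, Raw.occ, Raw.occ_shift_lt, lin_shift, add_zero]
    tauto
  · simp only [Raw.STy, sty_shift]
    constructor
    · rintro ⟨c, ⟨h, h'⟩, h''⟩; exact ⟨⟨c, h, h''⟩, h'⟩
    · rintro ⟨⟨c, h, h''⟩, h'⟩; exact ⟨c, ⟨h, h'⟩, h''⟩

theorem sameTyping_appR (as : List A.Node) (s t r : Raw A) :
    SameTyping (.app r (.sub as s t)) (.sub as (.app (r.shift as.length) s) t) := by
  refine ⟨fun x => ?_, ?_, fun τ b => ?_⟩
  · simp only [Raw.occ, Raw.occ_shift_add]; omega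
  · simp +contextual only [Raw.Lin, Raw.occ, Raw.occ_shift_lt, lin_shift, zero_add]
    tauto
  · simp only [Raw.STy, sty_shift]
    constructor
    · rintro ⟨c, h'', h, h'⟩; exact ⟨⟨c, h'', h⟩, h'⟩
    · rintro ⟨⟨c, h'', h⟩, h'⟩; exact ⟨c, h'', h, h'⟩

theorem sum_occ_update {k : ℕ} (ss : Fin k → Raw A) (i : Fin k) (s : Raw A) (x : ℕ) :
    ∑ j, (Function.update ss i s j).occ x = s.occ x + ∑ j ∈ Finset.univ.erase i, (ss j).occ x := by
  rw [← Finset.add_sum_erase _ _ (Finset.mem_univ i), Function.update_self]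
  congr 1
  refine Finset.sum_congr rfl fun j hj => ?_
  rw [Function.update_of_ne (Finset.ne_of_mem_erase hj)]

theorem sameTyping_tup (as : List A.Node) {k : ℕ} (ss : Fin k → Raw A) (i : Fin k) (s t : Raw A) :
    SameTyping (.tup (Function.update ss i (.sub as s t)))
      (.sub as (.tup (Function.update (fun j => (ss j).shift as.length) i s)) t) := by
  refine ⟨fun x => ?_, ?_, fun τ b => ?_⟩
  · simp only [Raw.occ, sum_occ_update, Raw.occ_shift_add]; omega
  · simp +contextual only [Raw.Lin, Raw.occ, sum_occ_update, Raw.occ_shift_lt,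
      Finset.sum_const_zero, add_zero, Function.forall_update_iff ss (p := fun _ s => Raw.Lin s),
      Function.forall_update_iff (fun j => (ss j).shift as.length) (p := fun _ s => Raw.Lin s),
      lin_shift]
    tauto
  · simp only [Raw.STy]
    constructor
    · rintro ⟨c, rfl, h⟩
      rw [Function.forall_update_iff ss (p := fun j s => Raw.STy τ s (c j))] at h
      refine ⟨⟨c, rfl, ?_⟩, h.1.2⟩
      rw [Function.forall_update_iff (fun j => (ss j).shift as.length)
        (p := fun j s => Raw.STy (upEnv as τ) s (c j))]
      exact ⟨h.1.1, fun j hj => (sty_shift _ _ _ _).2 (h.2 j hj)⟩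
    · rintro ⟨⟨c, rfl, h⟩, h'⟩
      rw [Function.forall_update_iff (fun j => (ss j).shift as.length)
        (p := fun j s => Raw.STy (upEnv as τ) s (c j))] at h
      refine ⟨c, rfl, ?_⟩
      rw [Function.forall_update_iff ss (p := fun j s => Raw.STy τ s (c j))]
      exact ⟨⟨h.1, h'⟩, fun j hj => (sty_shift _ _ _ _).1 (h.2 j hj)⟩

theorem sameTyping_con (as : List A.Node) {bs : List A.Node} {b : A.Node} (f : A.Arr bs b)
    (ss : Fin bs.length → Raw A) (i : Fin bs.length) (s t : Raw A) :
    SameTyping (.con f (Function.update ss i (.sub as s t)))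
      (.sub as (.con f (Function.update (fun j => (ss j).shift as.length) i s)) t) := by
  have h := sameTyping_tup as ss i s t
  refine ⟨h.occ, h.lin, fun τ b => ?_⟩
  simp only [Raw.STy]
  rw [Function.forall_update_iff (fun j => (ss j).shift as.length)
        (p := fun j s => Raw.STy (upEnv as τ) s (bs.get j)),
    Function.forall_update_iff ss (p := fun j s => Raw.STy τ s (bs.get j))]
  simp only [sty_shift, Raw.STy]
  tauto

theorem exchange_comp (k l d : ℕ) :
    upRen d (exchange k l) ∘ exchange k d = exchange k (l + d) := by
  funext i
  simp only [exchange, upRen, Function.comp]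
  split_ifs <;> omega

/-- The result of moving a substitution out of a context, in two steps. -/
theorem Cx.plug_exchange (C : Cx A) (k l : ℕ) (s : Raw A) :
    ((C.shift k).plug (s.rename (exchange k C.depth))).rename (exchange k l) =
      (C.rename (upRen l (· + k))).plug (s.rename (exchange k (l + C.depth))) := by
  rw [Cx.plug_rename, Cx.shift, Cx.depth_rename, Cx.rename_rename, Raw.rename_rename,
    exchange_comp]
  congr 2
  funext i
  simp only [exchange, upRen, Function.comp]
  split_ifs <;> omega

/-- Moving a substitution out of a context preserves typing. It suffices to move it past one term
former at a time. -/
theorem sameTyping_root (C : Cx A) (as : List A.Node) (s t : Raw A) :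
    SameTyping (C.plug (.sub as s (t.shift C.depth)))
      (.sub as ((C.shift as.length).plug (s.rename (exchange as.length C.depth))) t) := by
  have hid : ∀ s : Raw A, s.rename (exchange as.length 0) = s := fun s => by
    rw [exchange_zero, Raw.rename_id]
  have hsh : ∀ (l d : ℕ), (t.shift l).shift d = t.shift (l + d) := fun l d => by
    simp only [Raw.shift, Raw.rename_rename]
    congr 1; funext i; simp; omega
  induction C generalizing t with
  | hole =>
    simp only [Cx.plug, Cx.depth, Cx.shift, Cx.rename, hid, Raw.shift]
    have : t.rename (· + 0) = t := Raw.rename_id t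
    rw [this]; exact .refl _
  | lam bs C ih =>
    have := (SameTyping.lam (as := bs) (ih (t.shift bs.length) fun l d => by
      simp only [Raw.shift, Raw.rename_rename]; congr 1; funext i; simp; omega)).trans
        (sameTyping_lam as bs _ t)
    rw [hsh, Cx.plug_exchange] at this
    exact this
  | appL C r ih => exact (SameTyping.app (ih t hsh) (.refl r)).trans (sameTyping_appL as _ t r)
  | appR r C ih => exact (SameTyping.app (.refl r) (ih t hsh)).trans (sameTyping_appR as _ t r)
  | tup ss i C ih =>
    exact (SameTyping.tup fun j => (ih t hsh).update j).trans (sameTyping_tup as ss i _ t)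
  | subL bs C r ih =>
    have := (SameTyping.sub (as := bs) (ih (t.shift bs.length) fun l d => by
      simp only [Raw.shift, Raw.rename_rename]; congr 1; funext i; simp; omega) (.refl r)).trans
        (sameTyping_subL as bs _ t r)
    rw [hsh, Cx.plug_exchange] at this
    exact this
  | subR bs r C ih =>
    exact (SameTyping.sub (.refl r) (ih t hsh)).trans (sameTyping_subR as bs _ t r)
  | con f ss i C ih =>
    exact (SameTyping.con f fun j => (ih t hsh).update j).trans (sameTyping_con as f ss i _ t)

theorem StrEq.sameTyping {s t : Raw A} (h : StrEq s t) : SameTyping s t := by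
  induction h with
  | root C as s t => exact sameTyping_root C as s t
  | congr C _ ih => exact ih.plug C
  | refl s => exact .refl s
  | symm _ ih => exact ih.symm
  | trans _ _ ih ih' => exact ih.trans ih'

end StrEqTyping

/-! ### The interpretation of terms in a model -/

section Den

variable {A : AutSignature.{u, v}}

/-- `IsOp 𝓜 u ts as b o`: the term `u` is the application of a term former without binders to the
list `ts`, and this term former is interpreted by composition with the multiarrow `o`. -/
inductive IsOp (𝓜 : Model.{u, v, w} A) : Raw A → List (Raw A) →
    ∀ (as : List A.Node) (b : A.Node), 𝓜.H as b → Prop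
  | tup {k : ℕ} (ss : Fin k → Raw A) (as : List A.Node) :
      IsOp 𝓜 (.tup ss) (List.ofFn ss) as (.tensor as) (𝓜.re as)
  | app (s t : Raw A) (as : List A.Node) (b : A.Node) :
      IsOp 𝓜 (.app s t) [s, t] [.lolli as b, .tensor as] b (𝓜.ap as b)
  | con {as : List A.Node} {b : A.Node} (f : A.Arr as b) (ss : Fin as.length → Raw A) :
      IsOp 𝓜 (.con f ss) (List.ofFn ss) as b (𝓜.gen f)

/-- `Den 𝓜 xs s Γ b m`: in the context that gives the types `Γ` to the variables `xs`, the
multiarrow `m` interprets the term `s` of type `b`. Each rule includes a permutation of the context,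
so that the rules are syntax directed. -/
inductive Den (𝓜 : Model.{u, v, w} A) :
    List ℕ → Raw A → ∀ (Γ : List A.Node) (b : A.Node), 𝓜.H Γ b → Prop
  | var (x : ℕ) (a : A.Node) : Den 𝓜 [x] (.var x) [a] a (𝓜.M.id a)
  | op {u : Raw A} {ts : List (Raw A)} {as : List A.Node} {b : A.Node} {o : 𝓜.H as b}
      {xs : List ℕ} {Γ : List A.Node} {gs : Tuple 𝓜.H Γ as} {ys : List ℕ} {Δ : List A.Node}
      {m : 𝓜.H Δ b} : IsOp 𝓜 u ts as b o → TRel (Den 𝓜) xs ts Γ as gs → xs.Nodup →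
      Reord 𝓜.S xs Γ b (𝓜.M.comp o gs) ys Δ b m → Den 𝓜 ys u Δ b m
  | lam {as : List A.Node} {s : Raw A} {xs : List ℕ} {Γ : List A.Node} {b : A.Node}
      {n : 𝓜.H (Γ ++ as) b} {ys : List ℕ} {Δ : List A.Node} {m : 𝓜.H Δ (.lolli as b)} :
      xs.length = Γ.length →
      Den 𝓜 (xs.map (· + as.length) ++ List.range as.length) s (Γ ++ as) b n →
      Reord 𝓜.S xs Γ _ (𝓜.lamb n) ys Δ _ m → Den 𝓜 ys (.lam as s) Δ (.lolli as b) m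
  | sub {as : List A.Node} {s t : Raw A} {xs zs : List ℕ} {Γ Δ : List A.Node} {b : A.Node}
      {n : 𝓜.H (as ++ Γ) b} {p : 𝓜.H Δ (.tensor as)} {ys : List ℕ} {Θ : List A.Node}
      {m : 𝓜.H Θ b} :
      Den 𝓜 (List.range as.length ++ xs.map (· + as.length)) s (as ++ Γ) b n →
      Den 𝓜 zs t Δ (.tensor as) p → (zs ++ xs).Nodup →
      Reord 𝓜.S (zs ++ xs) (Δ ++ Γ) b
        (𝓜.M.comp (𝓜.unre n) (.cons p (Tuple.ids 𝓜.M.id Γ) rfl)) ys Θ b m →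
      Den 𝓜 ys (.sub as s t) Θ b m

variable {𝓜 : Model.{u, v, w} A}

/-- Induction on interpretations, with the induction hypotheses for a list of terms in the form of
a relation between the list and the tuple of their interpretations. -/
@[elab_as_elim]
theorem Den.ind {motive : ∀ (xs : List ℕ) (s : Raw A) (Γ : List A.Node) (b : A.Node) (m : 𝓜.H Γ b),
      Den 𝓜 xs s Γ b m → Prop}
    (var : ∀ (x : ℕ) (a : A.Node), motive [x] (.var x) [a] a (𝓜.M.id a) (.var x a))
    (op : ∀ {u : Raw A} {ts : List (Raw A)} {as : List A.Node} {b : A.Node} {o : 𝓜.H as b}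
      {xs : List ℕ} {Γ : List A.Node} {gs : Tuple 𝓜.H Γ as} {ys : List ℕ} {Δ : List A.Node}
      {m : 𝓜.H Δ b} (ho : IsOp 𝓜 u ts as b o) (hg : TRel (Den 𝓜) xs ts Γ as gs),
      TRel (fun xs s Γ b g => ∃ h : Den 𝓜 xs s Γ b g, motive xs s Γ b g h) xs ts Γ as gs →
      ∀ (hn : xs.Nodup) (r : Reord 𝓜.S xs Γ b (𝓜.M.comp o gs) ys Δ b m),
      motive ys u Δ b m (.op ho hg hn r))
    (lam : ∀ {as : List A.Node} {s : Raw A} {xs : List ℕ} {Γ : List A.Node} {b : A.Node}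
      {n : 𝓜.H (Γ ++ as) b} {ys : List ℕ} {Δ : List A.Node} {m : 𝓜.H Δ (.lolli as b)}
      (hx : xs.length = Γ.length)
      (h : Den 𝓜 (xs.map (· + as.length) ++ List.range as.length) s (Γ ++ as) b n),
      motive (xs.map (· + as.length) ++ List.range as.length) s (Γ ++ as) b n h →
      ∀ r : Reord 𝓜.S xs Γ _ (𝓜.lamb n) ys Δ _ m,
      motive ys (.lam as s) Δ (.lolli as b) m (.lam hx h r))
    (sub : ∀ {as : List A.Node} {s t : Raw A} {xs zs : List ℕ} {Γ Δ : List A.Node} {b : A.Node}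
      {n : 𝓜.H (as ++ Γ) b} {p : 𝓜.H Δ (.tensor as)} {ys : List ℕ} {Θ : List A.Node}
      {m : 𝓜.H Θ b}
      (h : Den 𝓜 (List.range as.length ++ xs.map (· + as.length)) s (as ++ Γ) b n)
      (h' : Den 𝓜 zs t Δ (.tensor as) p),
      motive (List.range as.length ++ xs.map (· + as.length)) s (as ++ Γ) b n h →
      motive zs t Δ (.tensor as) p h' → ∀ (hn : (zs ++ xs).Nodup)
      (r : Reord 𝓜.S (zs ++ xs) (Δ ++ Γ) b
        (𝓜.M.comp (𝓜.unre n) (.cons p (Tuple.ids 𝓜.M.id Γ) rfl)) ys Θ b m),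
      motive ys (.sub as s t) Θ b m (.sub h h' hn r))
    {xs : List ℕ} {s : Raw A} {Γ : List A.Node} {b : A.Node} {m : 𝓜.H Γ b}
    (h : Den 𝓜 xs s Γ b m) : motive xs s Γ b m h :=
  Den.rec (motive_1 := fun xs s Γ b m h => motive xs s Γ b m h)
    (motive_2 := fun xs ts Γ as gs _ =>
      TRel (fun xs s Γ b g => ∃ h : Den 𝓜 xs s Γ b g, motive xs s Γ b g h) xs ts Γ as gs)
    var (fun ho hg hn r ih => op ho hg ih hn r) (fun hx h r ih => lam hx h ih r)
    (fun h h' hn r ih ih' => sub h h' ih ih' hn r) .nil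
    (fun e h _ ih ih' => .cons e ⟨h, ih⟩ ih') h

theorem Den.length_eq {xs : List ℕ} {s : Raw A} {Γ : List A.Node} {b : A.Node} {m : 𝓜.H Γ b}
    (h : Den 𝓜 xs s Γ b m) : xs.length = Γ.length := by
  cases h with
  | var => rfl
  | op _ _ _ r => exact r.length_right
  | lam _ _ r => exact r.length_right
  | sub _ _ _ r => exact r.length_right

theorem den_length (xs : List ℕ) (s : Raw A) (Γ : List A.Node) (b : A.Node) (m : 𝓜.H Γ b)
    (h : Den 𝓜 xs s Γ b m) : xs.length = Γ.length := h.length_eq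

theorem zip_shift (xs : List ℕ) (Γ : List A.Node) (k : ℕ) :
    (xs.map (· + k)).zip Γ = TyCtx.shift (A := A) k (xs.zip Γ) := by
  rw [List.zip_map_left]; rfl

theorem zip_range (as : List A.Node) : (List.range as.length).zip as = enumCtx as := by
  rw [enumCtx_eq_ofFn]
  apply List.ext_get <;> simp

theorem zip_fst_snd {α β : Type*} (l : List (α × β)) :
    (l.map Prod.fst).zip (l.map Prod.snd) = l := by
  induction l with
  | nil => rfl
  | cons p l ih => simp [ih]

theorem map_fst_zip {α β : Type*} {xs : List α} {Γ : List β} (h : xs.length = Γ.length) :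
    (xs.zip Γ).map Prod.fst = xs := List.map_fst_zip h.le

theorem map_snd_zip {α β : Type*} {xs : List α} {Γ : List β} (h : xs.length = Γ.length) :
    (xs.zip Γ).map Prod.snd = Γ := List.map_snd_zip h.ge

/-! #### Interpreted terms are typed -/

theorem IsOp.occ {u : Raw A} {ts : List (Raw A)} {as : List A.Node} {b : A.Node} {o : 𝓜.H as b}
    (h : IsOp 𝓜 u ts as b o) (x : ℕ) : u.occ x = (ts.map fun t => t.occ x).sum := by
  cases h <;> simp [Raw.occ, List.sum_ofFn]

theorem IsOp.lin {u : Raw A} {ts : List (Raw A)} {as : List A.Node} {b : A.Node} {o : 𝓜.H as b}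
    (h : IsOp 𝓜 u ts as b o) : u.Lin ↔ ∀ t ∈ ts, t.Lin := by
  cases h <;> simp [Raw.Lin]

theorem IsOp.sty {u : Raw A} {ts : List (Raw A)} {as : List A.Node} {b : A.Node} {o : 𝓜.H as b}
    (h : IsOp 𝓜 u ts as b o) {τ : ℕ → A.Node} (ht : List.Forall₂ (Raw.STy τ) ts as) :
    Raw.STy τ u b := by
  cases h with
  | @tup k ss as =>
    obtain rfl : k = as.length := by simpa using ht.length_eq
    refine ⟨as.get, by rw [List.ofFn_get], fun i => ?_⟩
    simpa using (List.forall₂_iff_get.1 ht).2 i (by simp) (by simp)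
  | app s t as b =>
    cases ht with
    | cons h ht =>
      cases ht with
      | cons h' ht => exact ⟨as, h, h'⟩
  | con f ss =>
    refine ⟨rfl, fun i => ?_⟩
    simpa using (List.forall₂_iff_get.1 ht).2 i (by simp) (by simp)

theorem TRel.wt {xs : List ℕ} {ts : List (Raw A)} {Γ as : List A.Node} {gs : Tuple 𝓜.H Γ as}
    (h : TRel (fun xs s Γ b _ => xs.length = Γ.length ∧ WT (xs.zip Γ) s b) xs ts Γ as gs)
    (hn : xs.Nodup) :
    (∀ t ∈ ts, t.Lin) ∧ OccIn (A := A) (fun x => (ts.map fun t => t.occ x).sum) (xs.zip Γ) ∧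
      ∀ τ : ℕ → A.Node, (∀ p ∈ xs.zip Γ, τ p.1 = p.2) → List.Forall₂ (Raw.STy τ) ts as := by
  induction h with
  | nil => exact ⟨by simp, fun x => by simp, fun _ _ => .nil⟩
  | @cons xs ys s ts γ δ Γ a as g gs e h h' ih =>
    subst e
    obtain ⟨hl, h⟩ := h
    have hl' : ys.length = δ.length := h'.names_length fun _ _ _ _ _ h => h.1
    obtain ⟨hn₁, hn₂, hn₃⟩ := List.nodup_append.1 hn
    obtain ⟨i₁, i₂, i₃⟩ := ih hn₂
    refine ⟨by simpa using ⟨h.lin, i₁⟩, fun x => ?_, fun τ hτ => ?_⟩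
    · have h₁ := h.occ x
      have h₂ := i₂ x
      rw [map_fst_zip hl] at h₁
      rw [map_fst_zip hl'] at h₂
      simp only [] at h₂
      simp only []
      rw [List.map_cons, List.sum_cons, h₁, h₂, List.zip_append hl, List.map_append,
        map_fst_zip hl, map_fst_zip hl']
      have h₃ := hn₃ x
      by_cases e₁ : x ∈ xs <;> by_cases e₂ : x ∈ ys
      · exact (h₃ e₁ x e₂ rfl).elim
      all_goals simp [e₁, e₂]
    · rw [List.zip_append hl] at hτ
      exact .cons (h.sty_all fun p hp => hτ p (List.mem_append_left _ hp))
        (i₃ τ fun p hp => hτ p (List.mem_append_right _ hp))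

/-- Only typed terms have an interpretation. -/
theorem Den.wt {xs : List ℕ} {s : Raw A} {Γ : List A.Node} {b : A.Node} {m : 𝓜.H Γ b}
    (h : Den 𝓜 xs s Γ b m) : WT (xs.zip Γ) s b := by
  induction h using Den.ind with
  | var x a => exact (Typed.var x a).wt
  | @op u ts as b o xs Γ gs ys Δ m ho _ hg hn r =>
    have hx := r.length_left
    have hg' := hg.mono (P' := fun xs s Γ b _ => xs.length = Γ.length ∧ WT (xs.zip Γ) s b) id
      fun _ _ _ _ _ _ ⟨h, h'⟩ => ⟨h.length_eq, h'⟩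
    rw [List.map_id] at hg'
    obtain ⟨h₁, h₂, h₃⟩ := hg'.wt hn
    have hn' : ((xs.zip Γ).map Prod.fst).Nodup := by rwa [map_fst_zip hx]
    obtain ⟨τ, hτ⟩ := exists_env (A := A) hn' fun _ => b
    exact WT.perm ⟨hn', ho.lin.2 h₁, fun x => by rw [ho.occ x, ← h₂ x], τ, hτ, ho.sty (h₃ τ hτ)⟩
      r.zip_perm
  | @lam as s xs Γ b n ys Δ m hx _ ih r =>
    rw [List.zip_append (by simpa using hx), zip_shift, zip_range] at ih
    obtain ⟨hn, hl, hi, ho, τ, hτ, hs⟩ := wt_bind_iff.1 ih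
    exact WT.perm ⟨hn, ⟨hi, hl⟩, ho, τ, hτ, b, rfl, hs⟩ r.zip_perm
  | @sub as s t xs zs Γ Δ b n p ys Θ m h h' ih ih' hn r =>
    have hz := h'.length_eq
    have hx : xs.length = Γ.length := by simpa using h.length_eq
    rw [List.zip_append (by simp), zip_shift, zip_range] at ih
    obtain ⟨hn₁, hl, hi, ho, -⟩ := wt_bind_iff.1 (ih.perm List.perm_append_comm)
    have hn' : (((zs ++ xs).zip (Δ ++ Γ)).map Prod.fst).Nodup := by
      rwa [map_fst_zip r.length_left]
    obtain ⟨τ, hτ⟩ := exists_env (A := A) hn' fun _ => b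
    refine WT.perm ⟨hn', ⟨hi, hl, ih'.lin⟩, fun x => ?_, τ, hτ, ?_, ?_⟩ r.zip_perm
    · have h₁ := ho x
      have h₂ := ih'.occ x
      rw [map_fst_zip hx] at h₁
      rw [map_fst_zip hz] at h₂
      simp only [] at h₁
      rw [Raw.occ, h₁, h₂, map_fst_zip r.length_left]
      have h₃ := (List.nodup_append.1 hn).2.2 x
      by_cases e₁ : x ∈ zs <;> by_cases e₂ : x ∈ xs
      · exact (h₃ e₁ x e₂ rfl).elim
      all_goals simp [e₁, e₂]
    · rw [List.zip_append hz] at hτ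
      exact (ih.perm List.perm_append_comm).sty_all
        (upEnv_agree fun p hp => hτ p (List.mem_append_right _ hp))
    · rw [List.zip_append hz] at hτ
      exact ih'.sty_all fun p hp => hτ p (List.mem_append_left _ hp)

theorem Den.nodup {xs : List ℕ} {s : Raw A} {Γ : List A.Node} {b : A.Node} {m : 𝓜.H Γ b}
    (h : Den 𝓜 xs s Γ b m) : xs.Nodup := by
  have := h.wt.nodup
  rwa [map_fst_zip h.length_eq] at this

theorem Den.occ {xs : List ℕ} {s : Raw A} {Γ : List A.Node} {b : A.Node} {m : 𝓜.H Γ b}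
    (h : Den 𝓜 xs s Γ b m) (x : ℕ) : s.occ x = if x ∈ xs then 1 else 0 := by
  have := h.wt.occ x
  rwa [map_fst_zip h.length_eq] at this

theorem Den.occ_ne_zero {xs : List ℕ} {s : Raw A} {Γ : List A.Node} {b : A.Node} {m : 𝓜.H Γ b}
    (h : Den 𝓜 xs s Γ b m) {x : ℕ} : s.occ x ≠ 0 ↔ x ∈ xs := by
  rw [h.occ]; split_ifs with hx <;> simp [hx]

theorem Den.typed {xs : List ℕ} {s : Raw A} {Γ : List A.Node} {b : A.Node} {m : 𝓜.H Γ b}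
    (h : Den 𝓜 xs s Γ b m) : Typed (xs.zip Γ) s b := h.wt.typed

/-- The type of a term is determined by the types of its variables. -/
theorem Den.type_unique {xs ys : List ℕ} {s : Raw A} {Γ Δ : List A.Node} {b c : A.Node}
    {m : 𝓜.H Γ b} {n : 𝓜.H Δ c} (h : Den 𝓜 xs s Γ b m) (h' : Den 𝓜 ys s Δ c n)
    (hp : (xs.zip Γ).Perm (ys.zip Δ)) : b = c := by
  obtain ⟨τ, hτ, hs⟩ := (h.wt.perm hp).sty
  exact hs.unique (h'.wt.sty_all hτ)

/-- Interpretations are closed under permutations of the context, as each rule absorbs them. -/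
theorem Den.reord {xs ys : List ℕ} {s : Raw A} {Γ Δ : List A.Node} {b : A.Node}
    {m : 𝓜.H Γ b} {n : 𝓜.H Δ b} (h : Den 𝓜 xs s Γ b m) (r : Reord 𝓜.S xs Γ b m ys Δ b n) :
    Den 𝓜 ys s Δ b n := by
  cases h with
  | var x a =>
    obtain rfl : ys = [x] := by simpa using r.perm.symm
    have hp := r.zip_perm.symm
    obtain ⟨a', rfl⟩ := List.length_eq_one_iff.1 r.length_right.symm
    obtain rfl : a' = b := by simpa using hp
    rw [← r.eq_of_same (by simp)]
    exact .var x a'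
  | op ho hg hn r' => exact .op ho hg hn (r'.trans r)
  | lam hx h r' => exact .lam hx h (r'.trans r)
  | sub h h' hn r' => exact .sub h h' hn (r'.trans r)

theorem Den.exists_perm {xs ys : List ℕ} {s : Raw A} {Γ Δ : List A.Node} {b : A.Node}
    {m : 𝓜.H Γ b} (h : Den 𝓜 xs s Γ b m) (hy : ys.length = Δ.length)
    (hp : (xs.zip Γ).Perm (ys.zip Δ)) :
    ∃ n : 𝓜.H Δ b, Den 𝓜 ys s Δ b n ∧ Reord 𝓜.S xs Γ b m ys Δ b n := by
  obtain ⟨n, r⟩ := Reord.exists_of_perm 𝓜.S m h.length_eq hy hp h.nodup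
  exact ⟨n, h.reord r, r⟩

/-! #### Each typed term has an interpretation -/

theorem exists_den_op {u : Raw A} {k : ℕ} {ts : Fin k → Raw A} {as : Fin k → A.Node} {b : A.Node}
    {o : 𝓜.H (List.ofFn as) b} (ho : IsOp 𝓜 u (List.ofFn ts) (List.ofFn as) b o)
    {γ : Fin k → TyCtx A} {Θ : TyCtx A} (hm : Merge γ Θ) (hn : (Θ.map Prod.fst).Nodup)
    (h : ∀ i, ∃ m : 𝓜.H ((γ i).map Prod.snd) (as i),
      Den 𝓜 ((γ i).map Prod.fst) (ts i) ((γ i).map Prod.snd) (as i) m) :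
    ∃ m : 𝓜.H (Θ.map Prod.snd) b, Den 𝓜 (Θ.map Prod.fst) u (Θ.map Prod.snd) b m := by
  choose m hm' using h
  have ht := TRel.of_blocks m rfl hm'
  have h₁ : (List.ofFn fun i => (γ i).map Prod.fst).flatten =
      (List.ofFn γ).flatten.map Prod.fst := by
    rw [List.map_flatten, List.map_ofFn]; rfl
  have h₂ : (List.ofFn fun i => (γ i).map Prod.snd).flatten =
      (List.ofFn γ).flatten.map Prod.snd := by
    rw [List.map_flatten, List.map_ofFn]; rfl
  obtain ⟨n, r⟩ := Reord.exists_of_perm (xs := (List.ofFn fun i => (γ i).map Prod.fst).flatten)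
    (ys := Θ.map Prod.fst) (Δ := Θ.map Prod.snd) 𝓜.S (𝓜.M.comp o (Tuple.ofFn m rfl))
    (by rw [h₁, h₂, List.length_map, List.length_map]) (by simp)
    (by rw [h₁, h₂, zip_fst_snd, zip_fst_snd]; exact hm.2.perm)
    (by rw [h₁]; exact (hm.2.perm.map Prod.fst).nodup_iff.2 hn)
  exact ⟨n, .op ho ht (r.perm.nodup_iff.2 hn) r⟩

/-- Typed terms have an interpretation in each model. -/
theorem Typed.exists_den (𝓜 : Model.{u, v, w} A) {Θ : TyCtx A} {s : Raw A} {b : A.Node}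
    (h : Typed Θ s b) :
    ∃ m : 𝓜.H (Θ.map Prod.snd) b, Den 𝓜 (Θ.map Prod.fst) s (Θ.map Prod.snd) b m := by
  induction h with
  | var x a => exact ⟨_, .var x a⟩
  | tup h hm ih =>
    exact exists_den_op (.tup _ _) hm (hm.nodup fun i => (h i).wt.nodup) ih
  | @lam γ as s b h ih =>
    rw [List.map_append, List.map_append, shift_names, shift_types, enumCtx_names,
      enumCtx_types] at ih
    obtain ⟨m, hm⟩ := ih
    exact ⟨_, .lam (by simp) hm (.refl 𝓜.S (by simp) _)⟩
  | @app γ δ Θ s t as b h h' hm ih ih' =>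
    have e : List.ofFn ![s, t] = [s, t] := by simp [List.ofFn_succ]
    have e' : List.ofFn ![Ty.lolli as b, Ty.tensor as] = [.lolli as b, .tensor as] := by
      simp [List.ofFn_succ]
    have ho := IsOp.app (𝓜 := 𝓜) s t as b
    have key : ∀ (l : List A.Node) (o : 𝓜.H l b), IsOp 𝓜 (.app s t) [s, t] l b o →
        List.ofFn ![Ty.lolli as b, Ty.tensor as] = l →
        ∃ m : 𝓜.H (Θ.map Prod.snd) b,
          Den 𝓜 (Θ.map Prod.fst) (.app s t) (Θ.map Prod.snd) b m := by
      rintro _ o ho rfl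
      rw [← e] at ho
      refine exists_den_op ho hm (hm.nodup fun i => ?_) fun i => ?_
      · fin_cases i; exacts [h.wt.nodup, h'.wt.nodup]
      · fin_cases i; exacts [ih, ih']
    exact key _ _ ho e'
  | @sub γ δ₁ δ₂ Θ s t as b h h' hm ih ih' =>
    obtain ⟨p, hp⟩ := ih
    obtain ⟨n, hn⟩ := ih'
    obtain ⟨n', hn', -⟩ := hn.exists_perm (ys := List.range as.length ++
      ((δ₁ ++ δ₂).map Prod.fst).map (· + as.length)) (Δ := as ++ (δ₁ ++ δ₂).map Prod.snd)
      (by simp) (by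
        rw [zip_fst_snd, List.zip_append (by simp), zip_shift, zip_fst_snd, zip_range]
        simp only [TyCtx.shift, List.map_append, ← List.append_assoc]
        exact List.perm_append_comm.append_right _)
    have hΘ : (Θ.map Prod.fst).Nodup := by
      have hd := h'.wt.nodup
      have hd' : (((δ₁ ++ δ₂).map Prod.fst)).Nodup := by
        have := hn'.nodup
        exact (List.nodup_append.1 this).2.1.of_map
      rw [List.map_append] at hd'
      exact hm.nodup fun i => by
        fin_cases i
        exacts [h.wt.nodup, (List.nodup_append.1 hd').1, (List.nodup_append.1 hd').2.1]
    have hperm : (γ ++ (δ₁ ++ δ₂)).Perm Θ := by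
      have := hm.2.perm
      simpa [List.ofFn_succ] using this
    have hnames := hperm.map Prod.fst
    rw [List.map_append] at hnames
    obtain ⟨m, r⟩ := Reord.exists_of_perm (xs := γ.map Prod.fst ++ (δ₁ ++ δ₂).map Prod.fst)
      (ys := Θ.map Prod.fst) (Δ := Θ.map Prod.snd) 𝓜.S
      (𝓜.M.comp (𝓜.unre n') (.cons p (Tuple.ids 𝓜.M.id _) rfl)) (by simp) (by simp)
      (by rw [List.zip_append (by simp), zip_fst_snd, zip_fst_snd, zip_fst_snd]; exact hperm)
      (hnames.nodup_iff.2 hΘ)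
    exact ⟨m, .sub hn' hp (hnames.nodup_iff.2 hΘ) r⟩
  | @con as b f γ ss Θ h hm ih =>
    have key : ∀ (l : List A.Node) (o : 𝓜.H l b), IsOp 𝓜 (.con f ss) (List.ofFn ss) l b o →
        List.ofFn as.get = l →
        ∃ m : 𝓜.H (Θ.map Prod.snd) b,
          Den 𝓜 (Θ.map Prod.fst) (.con f ss) (Θ.map Prod.snd) b m := by
      rintro _ o ho rfl
      exact exists_den_op ho hm (hm.nodup fun i => (h i).wt.nodup) ih
    exact key _ _ (.con f ss) (List.ofFn_get as)

end Den

section DenSubst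

variable {A : AutSignature.{u, v}} {𝓜 : Model.{u, v, w} A}

/-! #### Renaming and substitution -/

theorem IsOp.rename {u : Raw A} {ts : List (Raw A)} {as : List A.Node} {b : A.Node}
    {o : 𝓜.H as b} (h : IsOp 𝓜 u ts as b o) (ρ : ℕ → ℕ) :
    IsOp 𝓜 (u.rename ρ) (ts.map fun t => t.rename ρ) as b o := by
  cases h with
  | tup ss as => rw [List.map_ofFn]; exact .tup _ as
  | app s t as b => exact .app _ _ as b
  | con f ss => rw [List.map_ofFn]; exact .con f _

theorem IsOp.subst {u : Raw A} {ts : List (Raw A)} {as : List A.Node} {b : A.Node}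
    {o : 𝓜.H as b} (h : IsOp 𝓜 u ts as b o) (σ : ℕ → Raw A) :
    IsOp 𝓜 (u.subst σ) (ts.map fun t => t.subst σ) as b o := by
  cases h with
  | tup ss as => rw [List.map_ofFn]; exact .tup _ as
  | app s t as b => exact .app _ _ as b
  | con f ss => rw [List.map_ofFn]; exact .con f _

theorem map_upRen_shift (xs : List ℕ) (k : ℕ) (ρ : ℕ → ℕ) :
    (xs.map (· + k)).map (upRen k ρ) = (xs.map ρ).map (· + k) := by
  simp [upRen]

theorem map_upRen_range (k : ℕ) (ρ : ℕ → ℕ) :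
    (List.range k).map (upRen k ρ) = List.range k := by
  conv_rhs => rw [← List.map_id (List.range k)]
  refine List.map_congr_left fun i hi => ?_
  simp [upRen, List.mem_range.1 hi]

theorem Den.rename {xs : List ℕ} {s : Raw A} {Γ : List A.Node} {b : A.Node} {m : 𝓜.H Γ b}
    (h : Den 𝓜 xs s Γ b m) {ρ : ℕ → ℕ} (hρ : Function.Injective ρ) :
    Den 𝓜 (xs.map ρ) (s.rename ρ) Γ b m := by
  induction h using Den.ind generalizing ρ with
  | var x a => exact .var (ρ x) a
  | op ho _ hg hn r =>
    have hg' := hg.mono (P' := fun xs s Γ b g => Den 𝓜 (xs.map ρ) s Γ b g) (fun t => t.rename ρ)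
      fun _ _ _ _ _ _ ⟨_, h⟩ => h hρ
    exact .op (ho.rename ρ) (by
      have := hg'.map_names (P' := Den 𝓜) ρ fun _ _ _ _ _ _ h => h
      exact this) (hn.map hρ) (r.map ρ)
  | @lam as s xs Γ b n ys Δ m hx _ ih r =>
    have ih := ih (upRen_injective hρ as.length)
    rw [List.map_append, map_upRen_shift, map_upRen_range] at ih
    exact .lam (by simpa using hx) ih (r.map ρ)
  | @sub as s t xs zs Γ Δ b n p ys Θ m _ _ ih ih' hn r =>
    have ih := ih (upRen_injective hρ as.length)
    rw [List.map_append, map_upRen_shift, map_upRen_range] at ih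
    refine .sub ih (ih' hρ) ?_ (by have := r.map ρ; rwa [List.map_append] at this)
    rw [← List.map_append]
    exact hn.map hρ

theorem Den.shift {xs : List ℕ} {s : Raw A} {Γ : List A.Node} {b : A.Node} {m : 𝓜.H Γ b}
    (h : Den 𝓜 xs s Γ b m) (k : ℕ) : Den 𝓜 (xs.map (· + k)) (s.shift k) Γ b m :=
  h.rename (add_injective k)

/-- `SubstRel 𝓜 σ ys x Γ b g`: the multiarrow `g` interprets the term that `σ` substitutes
for `x`. -/
def SubstRel (𝓜 : Model.{u, v, w} A) (σ : ℕ → Raw A) (ys : List ℕ) (x : ℕ) (Γ : List A.Node)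
    (b : A.Node) (g : 𝓜.H Γ b) : Prop := Den 𝓜 ys (σ x) Γ b g

theorem SubstRel.length (σ : ℕ → Raw A) (ys : List ℕ) (x : ℕ) (Γ : List A.Node) (b : A.Node)
    (g : 𝓜.H Γ b) (h : SubstRel 𝓜 σ ys x Γ b g) : ys.length = Γ.length := Den.length_eq h

theorem SubstRel.vars {σ : ℕ → Raw A} {ρ : ℕ → ℕ} {xs : List ℕ} {Γ : List A.Node}
    (h : ∀ x ∈ xs, σ x = .var (ρ x)) (hl : xs.length = Γ.length) :
    TRel (SubstRel 𝓜 σ) (xs.map ρ) xs Γ Γ (Tuple.ids 𝓜.M.id Γ) := by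
  induction Γ generalizing xs with
  | nil =>
    obtain rfl : xs = [] := by simpa using hl
    exact .nil
  | cons a Γ ih =>
    cases xs with
    | nil => simp at hl
    | cons x xs =>
      refine .cons (xs := [ρ x]) (γ := [a]) rfl ?_
        (ih (fun y hy => h y (by simp [hy])) (by simpa using hl))
      rw [SubstRel, h x (by simp)]
      exact .var _ a

/-- A substitution in the scope of a binder: the part for the free variables. -/
theorem SubstRel.up {σ : ℕ → Raw A} {ys xs : List ℕ} {Δ Γ : List A.Node} {hs : Tuple 𝓜.H Δ Γ}
    (h : TRel (SubstRel 𝓜 σ) ys xs Δ Γ hs) (k : ℕ) :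
    TRel (SubstRel 𝓜 (Raw.upSub k σ)) (ys.map (· + k)) (xs.map (· + k)) Δ Γ hs := by
  have h' := h.map_names (P' := fun ys x => SubstRel 𝓜 (Raw.upSub k σ) ys (x + k)) (· + k)
    fun ys x _ Γ b g h => by
      have h := Den.shift h k
      simpa [SubstRel, Raw.upSub] using h
  exact h'.mono (· + k) fun _ _ _ _ _ _ h => h

/-- A substitution in the scope of a binder: the part for the bound variables. -/
theorem SubstRel.up_range (σ : ℕ → Raw A) (as : List A.Node) :
    TRel (SubstRel 𝓜 (Raw.upSub as.length σ)) (List.range as.length) (List.range as.length) as as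
      (Tuple.ids 𝓜.M.id as) := by
  have := SubstRel.vars (𝓜 := 𝓜) (σ := Raw.upSub as.length σ) (ρ := id)
    (xs := List.range as.length) (Γ := as)
    (fun x hx => by simp [Raw.upSub, List.mem_range.1 hx]) (by simp)
  rwa [List.map_id] at this

theorem TRel.subst_args {σ : ℕ → Raw A} {zs : List ℕ} {ts : List (Raw A)} {Z as : List A.Node}
    {gs : Tuple 𝓜.H Z as}
    (h : TRel (fun xs s Γ b g => ∃ _ : Den 𝓜 xs s Γ b g,
      ∀ {σ : ℕ → Raw A} {ys : List ℕ} {Δ : List A.Node} {hs : Tuple 𝓜.H Δ Γ},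
        TRel (SubstRel 𝓜 σ) ys xs Δ Γ hs → ys.Nodup →
          Den 𝓜 ys (s.subst σ) Δ b (𝓜.M.comp g hs)) zs ts Z as gs)
    {ys : List ℕ} {Δ : List A.Node} {hs : Tuple 𝓜.H Δ Z}
    (hσ : TRel (SubstRel 𝓜 σ) ys zs Δ Z hs) (hn : ys.Nodup) :
    TRel (Den 𝓜) ys (ts.map fun t => t.subst σ) Δ as (gs.comp 𝓜.M.comp hs) := by
  induction h generalizing ys Δ with
  | nil => cases hσ; exact .nil
  | cons e h _ ih =>
    subst e
    obtain ⟨hd, h⟩ := h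
    obtain ⟨Δ₁, Δ₂, rfl, t₁, t₂, y₁, y₂, rfl, rfl, r₁, r₂⟩ := hσ.of_append hd.length_eq
    rw [Tuple.comp_cons]
    exact .cons rfl (h r₁ (List.nodup_append.1 hn).1) (ih r₂ (List.nodup_append.1 hn).2.1)

theorem nodup_shift_range {xs : List ℕ} (h : xs.Nodup) (k : ℕ) :
    (xs.map (· + k) ++ List.range k).Nodup := by
  rw [List.nodup_append]
  refine ⟨h.map (add_injective k), List.nodup_range, ?_⟩
  intro a ha b hb e
  obtain ⟨y, -, rfl⟩ := List.mem_map.1 ha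
  rw [List.mem_range] at hb
  omega

theorem nodup_range_shift {xs : List ℕ} (h : xs.Nodup) (k : ℕ) :
    (List.range k ++ xs.map (· + k)).Nodup :=
  List.perm_append_comm.nodup_iff.1 (nodup_shift_range h k)

/-- Substitution is interpreted by composition. -/
theorem Den.subst {xs : List ℕ} {s : Raw A} {Γ : List A.Node} {b : A.Node} {m : 𝓜.H Γ b}
    (h : Den 𝓜 xs s Γ b m) {σ : ℕ → Raw A} {ys : List ℕ} {Δ : List A.Node} {hs : Tuple 𝓜.H Δ Γ}
    (hσ : TRel (SubstRel 𝓜 σ) ys xs Δ Γ hs) (hn : ys.Nodup) :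
    Den 𝓜 ys (s.subst σ) Δ b (𝓜.M.comp m hs) := by
  induction h using Den.ind generalizing σ ys Δ with
  | var x a =>
    have key : ∀ {X : List A.Node} (hs : Tuple 𝓜.H Δ X) (e : X = [a]) (hs' : Tuple 𝓜.H Δ [a]),
        HEq hs hs' → TRel (SubstRel 𝓜 σ) ys [x] Δ X hs →
        Den 𝓜 ys (σ x) Δ a (𝓜.M.comp (𝓜.M.id a) hs') := by
      intro X hs e hs' heq h
      cases h with
      | @cons xs' ys' _ _ γ δ _ a' as g gs e' h h' =>
        cases h'
        obtain rfl : a' = a := by simpa using e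
        cases heq
        have hγ : γ ++ [] = γ := List.append_nil γ
        obtain rfl : Δ = γ := e'.trans hγ
        rw [𝓜.M.id_comp, List.append_nil]
        exact h
    exact key hs rfl hs HEq.rfl hσ
  | @op u ts as b o xs Γ gs _ _ m ho _ hg hn' r =>
    -- The permutation in the rule is moved to the tuple of substituted terms.
    obtain ⟨ys', Γ', hs', h', r'⟩ := r.symm.comp_left (SubstRel.length σ) hσ
    rw [𝓜.M.assoc] at r'
    have hn'' := r'.perm.nodup_iff.1 hn
    exact .op (ho.subst σ) (hg.subst_args h' hn'') hn'' r'.symm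
  | @lam as s xs Γ b n _ _ m hx _ ih r =>
    obtain ⟨ys', Γ', hs', h', r'⟩ := r.symm.comp_left (SubstRel.length σ) hσ
    have hn'' := r'.perm.nodup_iff.1 hn
    rw [𝓜.comp_lamb] at r'
    exact .lam (h'.names_length (SubstRel.length σ))
      (ih ((SubstRel.up h' _).append (SubstRel.up_range σ as)) (nodup_shift_range hn'' _)) r'.symm
  | @sub as s t xs zs Γ Δ' b n p _ Θ m h₁ h₂ ih ih' hn' r =>
    obtain ⟨ys', Γ', hs', h', r'⟩ := r.symm.comp_left (SubstRel.length σ) hσ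
    have hn'' := r'.perm.nodup_iff.1 hn
    obtain ⟨Δ₁, Δ₂, rfl, t₁, t₂, y₁, y₂, rfl, rfl, r₁, r₂⟩ := h'.of_append h₂.length_eq
    simp only [𝓜.comp_unre] at r'
    refine .sub (ih ((SubstRel.up_range σ as).append (SubstRel.up r₂ _))
      (nodup_range_shift (List.nodup_append.1 hn'').2.1 _))
      (ih' r₁ (List.nodup_append.1 hn'').1) hn'' r'.symm

/-! #### Interpretations are unique -/

theorem IsOp.args_unique {u : Raw A} {ts ts' : List (Raw A)} {as as' : List A.Node} {b b' : A.Node}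
    {o : 𝓜.H as b} {o' : 𝓜.H as' b'} (h : IsOp 𝓜 u ts as b o) (h' : IsOp 𝓜 u ts' as' b' o') :
    ts = ts' := by
  cases h <;> cases h' <;> rfl

theorem IsOp.unique {u : Raw A} {ts ts' : List (Raw A)} {as : List A.Node} {b b' : A.Node}
    {o : 𝓜.H as b} {o' : 𝓜.H as b'} (h : IsOp 𝓜 u ts as b o) (h' : IsOp 𝓜 u ts' as b' o') :
    b = b' ∧ HEq o o' := by
  cases h with
  | tup => cases h'; exact ⟨rfl, HEq.rfl⟩
  | app => cases h'; exact ⟨rfl, HEq.rfl⟩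
  | con => cases h'; exact ⟨rfl, HEq.rfl⟩

theorem filter_zip_of_mem {xs ys : List ℕ} {Γ Δ : List A.Node} {s : Raw A} {b : A.Node}
    {m : 𝓜.H Γ b} (h : Den 𝓜 xs s Γ b m) (hy : ∀ y ∈ ys, y ∉ xs) (hl : ys.length = Δ.length) :
    ((xs ++ ys).zip (Γ ++ Δ)).filter (fun p => s.occ p.1 ≠ 0) = xs.zip Γ ∧
    ((xs ++ ys).zip (Γ ++ Δ)).filter (fun p => s.occ p.1 = 0) = ys.zip Δ := by
  have h₁ : ∀ p ∈ xs.zip Γ, s.occ p.1 ≠ 0 := fun p hp => by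
    rw [h.occ_ne_zero, ← map_fst_zip h.length_eq]
    exact List.mem_map_of_mem hp
  have h₂ : ∀ p ∈ ys.zip Δ, s.occ p.1 = 0 := fun p hp => by
    by_contra h0
    rw [← ne_eq, h.occ_ne_zero] at h0
    refine hy p.1 ?_ h0
    rw [← map_fst_zip hl]
    exact List.mem_map_of_mem hp
  rw [List.zip_append h.length_eq]
  constructor
  · rw [List.filter_append, List.filter_eq_self.2 fun p hp => by simpa using h₁ p hp,
      List.filter_eq_nil_iff.2 fun p hp => by simpa using h₂ p hp, List.append_nil]
  · rw [List.filter_append, List.filter_eq_nil_iff.2 fun p hp => by simpa using h₁ p hp,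
      List.filter_eq_self.2 fun p hp => by simpa using h₂ p hp, List.nil_append]

/-- A context that is shared by a term and other terms determines the part of the term. -/
theorem split_perm {xs ys xs' ys' : List ℕ} {Γ Δ Γ' Δ' : List A.Node} {s : Raw A} {b b' : A.Node}
    {m : 𝓜.H Γ b} {m' : 𝓜.H Γ' b'} (h : Den 𝓜 xs s Γ b m) (h' : Den 𝓜 xs' s Γ' b' m')
    (hn : (xs ++ ys).Nodup) (hn' : (xs' ++ ys').Nodup) (hl : ys.length = Δ.length)
    (hl' : ys'.length = Δ'.length)
    (hp : ((xs ++ ys).zip (Γ ++ Δ)).Perm ((xs' ++ ys').zip (Γ' ++ Δ'))) :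
    (xs.zip Γ).Perm (xs'.zip Γ') ∧ (ys.zip Δ).Perm (ys'.zip Δ') := by
  obtain ⟨e₁, e₂⟩ := filter_zip_of_mem h
    (fun y hy hx => (List.nodup_append.1 hn).2.2 y hx y hy rfl) hl
  obtain ⟨e₃, e₄⟩ := filter_zip_of_mem h'
    (fun y hy hx => (List.nodup_append.1 hn').2.2 y hx y hy rfl) hl'
  rw [← e₁, ← e₂, ← e₃, ← e₄]
  exact ⟨hp.filter _, hp.filter _⟩

theorem TRel.treord {zs zs' : List ℕ} {ts : List (Raw A)} {Z Z' as as' : List A.Node}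
    {gs : Tuple 𝓜.H Z as} {gs' : Tuple 𝓜.H Z' as'}
    (h : TRel (fun xs s Γ b g => ∃ _ : Den 𝓜 xs s Γ b g,
      ∀ {ys : List ℕ} {Δ : List A.Node} {c : A.Node} {n : 𝓜.H Δ c},
        Den 𝓜 ys s Δ c n → (xs.zip Γ).Perm (ys.zip Δ) → Reord 𝓜.S xs Γ b g ys Δ c n) zs ts Z as gs)
    (h' : TRel (Den 𝓜) zs' ts Z' as' gs') (hn : zs.Nodup) (hn' : zs'.Nodup)
    (hp : (zs.zip Z).Perm (zs'.zip Z')) :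
    as = as' ∧ TReord 𝓜.S zs Z as gs zs' Z' as' gs' := by
  induction h generalizing zs' Z' as' with
  | nil => cases h'; exact ⟨rfl, .nil⟩
  | cons e h ht ih =>
    subst e
    cases h' with
    | cons e' h₁ ht' =>
      subst e'
      obtain ⟨hd, h⟩ := h
      obtain ⟨p₁, p₂⟩ := split_perm hd h₁ hn hn'
        (ht.names_length fun _ _ _ _ _ ⟨h, _⟩ => h.length_eq) (ht'.names_length den_length) hp
      obtain ⟨rfl, r⟩ := ih ht' (List.nodup_append.1 hn).2.1 (List.nodup_append.1 hn').2.1 p₂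
      obtain rfl := hd.type_unique h₁ p₁
      exact ⟨rfl, .cons rfl rfl (h h₁ p₁) r⟩

/-- A term has at most one interpretation, up to the order of the context. -/
theorem Den.unique {xs ys : List ℕ} {s : Raw A} {Γ Δ : List A.Node} {b c : A.Node} {m : 𝓜.H Γ b}
    {n : 𝓜.H Δ c} (h : Den 𝓜 xs s Γ b m) (h' : Den 𝓜 ys s Δ c n)
    (hp : (xs.zip Γ).Perm (ys.zip Δ)) : Reord 𝓜.S xs Γ b m ys Δ c n := by
  induction h using Den.ind generalizing ys Δ c with
  | var x a =>
    cases h' with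
    | var y c =>
      obtain rfl : a = c := by simpa using hp
      exact .refl 𝓜.S (xs := [x]) (Γ := [a]) rfl _
    | op ho => cases ho
  | op ho _ hg hn r =>
    cases h' with
    | var => cases ho
    | op ho' hg' hn' r' =>
      obtain rfl := ho.args_unique ho'
      obtain ⟨rfl, hr⟩ := hg.treord hg' hn hn' (r.zip_perm.trans (hp.trans r'.zip_perm.symm))
      obtain ⟨rfl, ho'⟩ := ho.unique ho'
      cases ho'
      exact (r.symm.trans (hr.comp _)).trans r'
    | lam => cases ho
    | sub => cases ho
  | @lam as s xs Γ b n _ _ m hx hd ih r =>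
    cases h' with
    | op ho => cases ho
    | @lam _ _ xs' Γ' b' n' _ _ _ hx' hd' r' =>
      have hp' : ((xs.map (· + as.length) ++ List.range as.length).zip (Γ ++ as)).Perm
          ((xs'.map (· + as.length) ++ List.range as.length).zip (Γ' ++ as)) := by
        rw [List.zip_append (by simpa using hx), List.zip_append (by simpa using hx'), zip_shift,
          zip_shift]
        exact ((r.zip_perm.trans (hp.trans r'.zip_perm.symm)).map _).append_right _
      obtain rfl := hd.type_unique hd' hp'
      have hr := Model.reord_lamb (by simpa using hx) (by simpa using hx') (ih hd' hp') hd.nodup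
      -- The names of the free variables are shifted back.
      have hr' : Reord 𝓜.S xs Γ _ (𝓜.lamb n) xs' Γ' _ (𝓜.lamb n') := by
        have := hr.map (· - as.length)
        simpa [Function.comp_def] using this
      exact (r.symm.trans hr').trans r'
  | @sub as s t xs zs Γ Δ₁ b n₀ p _ Θ m₀ hd₁ hd₂ ih ih' hn r =>
    cases h' with
    | op ho => cases ho
    | @sub _ _ _ xs' zs' Γ' Δ' _ n' p' _ _ _ hd₁' hd₂' hn' r' =>
      have hx : xs.length = Γ.length := by simpa using hd₁.length_eq
      have hx' : xs'.length = Γ'.length := by simpa using hd₁'.length_eq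
      obtain ⟨p₁, p₂⟩ := split_perm hd₂ hd₂' hn hn' hx hx'
        (r.zip_perm.trans (hp.trans r'.zip_perm.symm))
      have hp' : ((List.range as.length ++ xs.map (· + as.length)).zip (as ++ Γ)).Perm
          ((List.range as.length ++ xs'.map (· + as.length)).zip (as ++ Γ')) := by
        rw [List.zip_append (by simp), List.zip_append (by simp), zip_shift, zip_shift]
        exact (p₂.map _).append_left _
      obtain rfl := hd₁.type_unique hd₁' hp'
      have hr := ih hd₁' hp'
      -- The names of the places of `as` are made distinct from all other names.
      have hr' : Reord 𝓜.S ((List.range as.length).map Sum.inl ++ xs.map Sum.inr)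
          (as ++ Γ) _ n₀ ((List.range as.length).map Sum.inl ++ xs'.map Sum.inr)
          (as ++ Γ') _ n' := by
        have := hr.map fun i => if i < as.length then Sum.inl i else Sum.inr (i - as.length)
        have e : (List.range as.length).map
            (fun i => if i < as.length then (Sum.inl i : ℕ ⊕ ℕ) else Sum.inr (i - as.length)) =
            (List.range as.length).map Sum.inl :=
          List.map_congr_left fun i hi => if_pos (List.mem_range.1 hi)
        simpa [Function.comp_def, e] using this
      have hs := Model.reord_sub (zs := (List.range as.length).map Sum.inl)
        (us := zs.map Sum.inr) (us' := zs'.map Sum.inr) (by simp) hr'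
        (by
          rw [List.nodup_append]
          refine ⟨List.nodup_range.map Sum.inl_injective,
            ((List.nodup_append.1 hn).2.1).map Sum.inr_injective, ?_⟩
          intro a ha b hb e
          subst e
          obtain ⟨y, -, rfl⟩ := List.mem_map.1 ha
          obtain ⟨z, -, h⟩ := List.mem_map.1 hb
          cases h) ((ih' hd₂' p₁).map Sum.inr)
      have hs' := hs.map (Sum.elim id id)
      simp only [List.map_append, List.map_map, Sum.elim_comp_inr, List.map_id] at hs'
      exact (r.symm.trans hs').trans r'

theorem Den.eq {xs : List ℕ} {s : Raw A} {Γ : List A.Node} {b : A.Node} {m n : 𝓜.H Γ b}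
    (h : Den 𝓜 xs s Γ b m) (h' : Den 𝓜 xs s Γ b n) : m = n :=
  (h.unique h' (.refl _)).eq_of_same h.nodup

end DenSubst

/-! ### Soundness of reduction and of structural equivalence -/

section RawTerms

variable {A : AutSignature.{u, v}}

namespace Raw

theorem subst_eq_self (s : Raw A) {σ : ℕ → Raw A} (h : ∀ x, σ x = .var x) : s.subst σ = s := by
  rw [show σ = .var from funext h, subst_var]

theorem occ_varTup (k x : ℕ) : (varTup k : Raw A).occ x = if x < k then 1 else 0 := by
  simp only [varTup, occ]
  split_ifs with h
  · rw [Finset.sum_eq_single ⟨x, h⟩ (fun i _ hi => if_neg fun e => hi (Fin.ext e)) (by simp)]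
    simp
  · exact Finset.sum_eq_zero fun i _ => if_neg (by omega)

theorem lin_varTup (k : ℕ) : (varTup k : Raw A).Lin := fun _ => trivial

theorem sty_varTup (as : List A.Node) (τ : ℕ → A.Node) (b : A.Node) :
    STy (upEnv as τ) (varTup as.length) b ↔ b = .tensor as := by
  simp only [varTup, STy]
  constructor
  · rintro ⟨cs, rfl, h⟩
    congr 1
    conv_rhs => rw [← List.ofFn_get as]
    congr 1
    funext i
    rw [← h i]
    simp [upEnv]
  · rintro rfl
    exact ⟨as.get, by rw [List.ofFn_get], fun i => by simp [upEnv]⟩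

end Raw

theorem typed_eta₁ {Θ : TyCtx A} {as : List A.Node} {s : Raw A} {b : A.Node} :
    Typed Θ (.sub as (.varTup as.length) s) b ↔ b = .tensor as ∧ Typed Θ s b := by
  have ho : ∀ x, (Raw.sub as (.varTup as.length) s).occ x = s.occ x := fun x => by
    simp [Raw.occ, Raw.occ_varTup]
  have hl : (Raw.sub as (.varTup as.length) s).Lin ↔ s.Lin := by
    simp +contextual [Raw.Lin, Raw.occ_varTup, Raw.lin_varTup]
  rw [typed_iff_wt, typed_iff_wt]
  constructor
  · rintro ⟨hn, h₁, h₂, τ, hτ, h₃, h₄⟩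
    rw [Raw.sty_varTup] at h₃
    subst h₃
    exact ⟨rfl, hn, hl.1 h₁, fun x => (ho x).symm.trans (h₂ x), τ, hτ, h₄⟩
  · rintro ⟨rfl, hn, h₁, h₂, τ, hτ, h₃⟩
    exact ⟨hn, hl.2 h₁, fun x => (ho x).trans (h₂ x), τ, hτ, (Raw.sty_varTup _ _ _).2 rfl, h₃⟩

theorem typed_eta₂ {Θ : TyCtx A} {as : List A.Node} {s : Raw A} {b : A.Node} :
    Typed Θ (.lam as (.app (s.shift as.length) (.varTup as.length))) b ↔
      (∃ c, b = .lolli as c) ∧ Typed Θ s b := by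
  have ho : ∀ x, (Raw.lam as (.app (s.shift as.length) (.varTup as.length))).occ x = s.occ x :=
    fun x => by simp [Raw.occ, Raw.occ_varTup, Raw.occ_shift_add]
  have hl : (Raw.lam as (.app (s.shift as.length) (.varTup as.length))).Lin ↔ s.Lin := by
    simp +contextual [Raw.Lin, Raw.occ, Raw.occ_varTup, Raw.lin_varTup, lin_shift, Raw.occ_shift_lt]
  rw [typed_iff_wt, typed_iff_wt]
  constructor
  · rintro ⟨hn, h₁, h₂, τ, hτ, c, rfl, bs, h₃, h₄⟩
    rw [Raw.sty_varTup] at h₄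
    injection h₄ with h₄
    subst h₄
    exact ⟨⟨c, rfl⟩, hn, hl.1 h₁, fun x => (ho x).symm.trans (h₂ x), τ, hτ,
      (sty_shift _ _ _ _).1 h₃⟩
  · rintro ⟨⟨c, rfl⟩, hn, h₁, h₂, τ, hτ, h₃⟩
    exact ⟨hn, hl.2 h₁, fun x => (ho x).trans (h₂ x), τ, hτ, c, rfl, as, (sty_shift _ _ _ _).2 h₃,
      (Raw.sty_varTup _ _ _).2 rfl⟩

theorem Cx.rename_id (C : Cx A) : C.rename id = C := by
  induction C with
  | hole => rfl
  | _ => simp_all only [rename, upRen_id, Raw.rename_id]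

theorem shift_zero (s : Raw A) : s.shift 0 = s := Raw.rename_id s

/-- A substitution context in the argument of a substitution can be moved out of it. -/
theorem StrEq.sub_plug {L : Cx A} (hL : L.IsL) (as : List A.Node) (s t : Raw A) :
    StrEq (.sub as s (L.plug t))
      (L.plug (.sub as (s.rename (upRen as.length (· + L.depth))) t)) := by
  induction L generalizing s with
  | hole =>
    simp only [Cx.plug, Cx.depth]
    rw [show (fun x : ℕ => x + 0) = id from rfl, upRen_id, Raw.rename_id]
    exact .refl _
  | subL bs L r ih =>
    have h₁ := StrEq.root (.subR as s .hole) bs (L.plug t) r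
    simp only [Cx.plug, Cx.depth, Cx.shift, Cx.rename, shift_zero, exchange_zero,
      Raw.rename_id] at h₁
    have h₂ := StrEq.congr (.subL bs .hole r) (ih hL (s.rename (upRen as.length (· + bs.length))))
    simp only [Cx.plug, Raw.rename_rename, ← upRen_comp] at h₂
    simp only [Cx.plug, Cx.depth]
    refine h₁.trans ?_
    convert h₂ using 7
    simp only [Function.comp]
    omega
  | _ => exact hL.elim

/-- A substitution context in the function of an application can be moved out of it. -/
theorem StrEq.app_plug {L : Cx A} (hL : L.IsL) (s t : Raw A) :
    StrEq (.app (L.plug s) t) (L.plug (.app s (t.shift L.depth))) := by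
  induction L generalizing t with
  | hole =>
    simp only [Cx.plug, Cx.depth, shift_zero]
    exact .refl _
  | subL bs L r ih =>
    have h₁ := StrEq.root (.appL .hole t) bs (L.plug s) r
    simp only [Cx.plug, Cx.depth, Cx.shift, Cx.rename, shift_zero, exchange_zero,
      Raw.rename_id] at h₁
    have h₂ := StrEq.congr (.subL bs .hole r) (ih hL (t.shift bs.length))
    simp only [Cx.plug, Raw.shift, Raw.rename_rename] at h₂
    simp only [Cx.plug, Cx.depth]
    refine h₁.trans ?_
    simp only [Raw.shift]
    convert h₂ using 6
    simp only [Function.comp]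
    omega
  | _ => exact hL.elim

end RawTerms

section Soundness

variable {A : AutSignature.{u, v}} (𝓜 : Model.{u, v, w} A)

/-- Each interpretation of `s` in the model is an interpretation of `t`. -/
def SemLe (s t : Raw A) : Prop :=
  ∀ (xs : List ℕ) (Γ : List A.Node) (b : A.Node) (m : 𝓜.H Γ b), Den 𝓜 xs s Γ b m → Den 𝓜 xs t Γ b m

variable {𝓜}

theorem TRel.forall₂ {xs : List ℕ} {ts ts' : List (Raw A)} {Γ as : List A.Node}
    {gs : Tuple 𝓜.H Γ as} (h : TRel (Den 𝓜) xs ts Γ as gs) (ht : List.Forall₂ (SemLe 𝓜) ts ts') :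
    TRel (Den 𝓜) xs ts' Γ as gs := by
  induction h generalizing ts' with
  | nil => cases ht; exact .nil
  | cons e h _ ih =>
    cases ht with
    | cons h₁ h₂ => exact .cons e (h₁ _ _ _ _ h) (ih h₂)

namespace SemLe

theorem refl (s : Raw A) : SemLe 𝓜 s s := fun _ _ _ _ h => h

theorem trans {s t r : Raw A} (h : SemLe 𝓜 s t) (h' : SemLe 𝓜 t r) : SemLe 𝓜 s r :=
  fun _ _ _ _ hd => h' _ _ _ _ (h _ _ _ _ hd)

theorem op {s s' : Raw A} {ts ts' : List (Raw A)}
    (h : ∀ {us as b} {o : 𝓜.H as b}, IsOp 𝓜 s us as b o → us = ts ∧ IsOp 𝓜 s' ts' as b o)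
    (hv : ∀ x, s ≠ .var x) (hl : ∀ as r, s ≠ .lam as r) (hs : ∀ as r t, s ≠ .sub as r t)
    (ht : List.Forall₂ (SemLe 𝓜) ts ts') : SemLe 𝓜 s s' := by
  intro xs Γ b m hd
  cases hd with
  | var x => exact (hv _ rfl).elim
  | lam => exact (hl _ _ rfl).elim
  | sub => exact (hs _ _ _ rfl).elim
  | op ho hg hn r =>
    obtain ⟨rfl, ho'⟩ := h ho
    exact .op ho' (hg.forall₂ ht) hn r

theorem lam {as : List A.Node} {s s' : Raw A} (h : SemLe 𝓜 s s') :
    SemLe 𝓜 (.lam as s) (.lam as s') := by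
  intro xs Γ b m hd
  cases hd with
  | op ho => cases ho
  | lam hx hd r => exact .lam hx (h _ _ _ _ hd) r

theorem sub {as : List A.Node} {s s' t t' : Raw A} (h : SemLe 𝓜 s s') (h' : SemLe 𝓜 t t') :
    SemLe 𝓜 (.sub as s t) (.sub as s' t') := by
  intro xs Γ b m hd
  cases hd with
  | op ho => cases ho
  | sub hd hd' hn r => exact .sub (h _ _ _ _ hd) (h' _ _ _ _ hd') hn r

theorem app {s s' t t' : Raw A} (h : SemLe 𝓜 s s') (h' : SemLe 𝓜 t t') :
    SemLe 𝓜 (.app s t) (.app s' t') :=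
  op (ts := [s, t]) (ts' := [s', t']) (fun ho => by cases ho; exact ⟨rfl, .app _ _ _ _⟩)
    (by simp) (by simp) (by simp) (.cons h (.cons h' .nil))

theorem ofFn {k : ℕ} {ss ts : Fin k → Raw A} (h : ∀ i, SemLe 𝓜 (ss i) (ts i)) :
    List.Forall₂ (SemLe 𝓜) (List.ofFn ss) (List.ofFn ts) := by
  rw [List.forall₂_iff_get]
  exact ⟨by simp, fun i _ _ => by simpa using h _⟩

theorem tup {k : ℕ} {ss ts : Fin k → Raw A} (h : ∀ i, SemLe 𝓜 (ss i) (ts i)) :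
    SemLe 𝓜 (.tup ss) (.tup ts) :=
  op (fun ho => by cases ho; exact ⟨rfl, .tup _ _⟩) (by simp) (by simp) (by simp) (ofFn h)

theorem con {as : List A.Node} {b : A.Node} (f : A.Arr as b) {ss ts : Fin as.length → Raw A}
    (h : ∀ i, SemLe 𝓜 (ss i) (ts i)) : SemLe 𝓜 (.con f ss) (.con f ts) :=
  op (fun ho => by cases ho; exact ⟨rfl, .con f _⟩) (by simp) (by simp) (by simp) (ofFn h)

theorem update {k : ℕ} {ss : Fin k → Raw A} {i : Fin k} {s t : Raw A} (h : SemLe 𝓜 s t)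
    (j : Fin k) : SemLe 𝓜 (Function.update ss i s j) (Function.update ss i t j) := by
  by_cases hj : j = i
  · subst hj; simpa using h
  · simp only [Function.update_of_ne hj]; exact refl _

theorem plug (C : Cx A) {s t : Raw A} (h : SemLe 𝓜 s t) : SemLe 𝓜 (C.plug s) (C.plug t) := by
  induction C with
  | hole => exact h
  | lam as C ih => exact lam ih
  | appL C t ih => exact app ih (refl _)
  | appR t C ih => exact app (refl _) ih
  | tup ss i C ih => exact tup fun j => update ih j
  | subL as C t ih => exact sub ih (refl _)
  | subR as t C ih => exact sub (refl _) ih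
  | con f ss i C ih => exact con f fun j => update ih j

end SemLe

theorem Typed.exists_den_zip (𝓜 : Model.{u, v, w} A) {xs : List ℕ} {s : Raw A} {Γ : List A.Node}
    {b : A.Node} (h : Typed (xs.zip Γ) s b) (hl : xs.length = Γ.length) :
    ∃ m : 𝓜.H Γ b, Den 𝓜 xs s Γ b m := by
  have key : ∀ (Γ' : List A.Node) (xs' : List ℕ), Γ' = Γ → xs' = xs →
      (∃ m : 𝓜.H Γ' b, Den 𝓜 xs' s Γ' b m) → ∃ m : 𝓜.H Γ b, Den 𝓜 xs s Γ b m := by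
    rintro _ _ rfl rfl h
    exact h
  exact key _ _ (map_snd_zip hl) (map_fst_zip hl) (h.exists_den 𝓜)

/-- As typed terms have unique interpretations, an inclusion of the interpretations of `t` in those
of `s` is an equality if `t` is typed. -/
theorem Den.reverse {xs : List ℕ} {s t : Raw A} {Γ : List A.Node} {b : A.Node} {m : 𝓜.H Γ b}
    (h : Den 𝓜 xs s Γ b m) (ht : Typed (xs.zip Γ) t b)
    (hle : ∀ m', Den 𝓜 xs t Γ b m' → Den 𝓜 xs s Γ b m') : Den 𝓜 xs t Γ b m := by
  obtain ⟨m', hm⟩ := ht.exists_den_zip 𝓜 h.length_eq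
  rwa [h.eq (hle _ hm)]

/-! #### Beta -/

theorem SubstRel.inst {k : ℕ} {ts : Fin k → Raw A} {zs : List ℕ} {Δ as : List A.Node}
    {gs : Tuple 𝓜.H Δ as} (h : TRel (Den 𝓜) zs (List.ofFn ts) Δ as gs) :
    TRel (SubstRel 𝓜 (instSub ts)) zs (List.range k) Δ as gs := by
  have e : List.ofFn ts = (List.range k).map (instSub ts) := by
    apply List.ext_get
    · simp
    · intro i h₁ h₂
      have hi : i < k := by simpa using h₁
      simp [instSub, hi]
  rw [e] at h
  exact h.of_map

theorem SubstRel.inst_vars {k : ℕ} (ts : Fin k → Raw A) {xs : List ℕ} {Γ : List A.Node}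
    (hx : xs.length = Γ.length) :
    TRel (SubstRel 𝓜 (instSub ts)) xs (xs.map (· + k)) Γ Γ (Tuple.ids 𝓜.M.id Γ) := by
  have := SubstRel.vars (𝓜 := 𝓜) (σ := instSub ts) (ρ := (· - k)) (xs := xs.map (· + k))
    (Γ := Γ) (fun x hx => by
      obtain ⟨y, -, rfl⟩ := List.mem_map.1 hx
      simp [instSub]) (by simpa using hx)
  simpa [Function.comp_def] using this

/-- The transpose of `n` along `re`, composed with `re`, is `n`. -/
theorem SemLe.beta₁ (as : List A.Node) (s : Raw A) (ts : Fin as.length → Raw A) :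
    SemLe 𝓜 (.sub as s (.tup ts)) (s.subst (instSub ts)) := by
  intro ys Θ b m hd
  cases hd with
  | op ho => cases ho
  | @sub _ _ _ xs zs Γ Δ _ n p _ _ _ h₁ h₂ hn r =>
    have hx : xs.length = Γ.length := by simpa using h₁.length_eq
    cases h₂ with
    | @op _ _ _ _ _ zs' Δ' gs _ _ _ ho hg hn' r' =>
      cases ho with
      | tup =>
        have hr := TReord.comp (.cons rfl rfl r' (TReord.refl 𝓜.S
          (Model.HeadRel.length (us := zs) (p := p) r'.length_right)
          (Model.HeadRel.ids hx))) (𝓜.unre n)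
        refine Den.reord ?_ (hr.trans r)
        have hn'' := hr.perm.nodup_iff.2 hn
        have := h₁.subst ((SubstRel.inst hg).append (SubstRel.inst_vars ts hx)) hn''
        have e := 𝓜.M.assoc (𝓜.unre n) (.cons (𝓜.re as) (Tuple.ids 𝓜.M.id Γ) rfl)
          (gs.append (Tuple.ids 𝓜.M.id Γ))
        rw [𝓜.unre_spec, Tuple.comp_cons, Tuple.ids_comp] at e
        rwa [e] at this

theorem SemLe.beta₂ (as : List A.Node) (s : Raw A) (ts : Fin as.length → Raw A) :
    SemLe 𝓜 (.app (.lam as s) (.tup ts)) (s.subst (instSub ts)) := by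
  intro ys Θ b m hd
  cases hd with
  | @op _ _ _ _ _ zs Δ gs _ _ _ ho hg hn r =>
    cases ho with
    | app _ _ as' _ =>
    cases hg with
    | @cons zs₁ _ _ _ γ _ _ _ _ g _ e h₁ hg =>
    cases hg with
    | @cons zs₂ _ _ _ δ _ _ _ _ p _ e' h₂ hg =>
    cases hg
    cases h₁ with
    | op ho => cases ho
    | @lam _ _ xs Γ _ n _ _ _ hx h₁ r₁ =>
    cases h₂ with
    | @op _ _ _ _ _ zs' Δ' gs _ _ _ ho hg hn' r₂ =>
    cases ho with
    | tup =>
    have hr := TReord.comp (.cons (Γ := Γ ++ Δ') rfl e r₁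
      (.cons (List.append_nil _).symm e' r₂ .nil)) (𝓜.ap as b)
    have hn'' := hr.perm.nodup_iff.2 hn
    rw [List.append_nil zs'] at hr hn''
    refine Den.reord ?_ (hr.trans r)
    have := h₁.subst ((SubstRel.inst_vars ts hx).append (SubstRel.inst hg)) hn''
    have e := 𝓜.ap_comp (𝓜.lamb n) (Tuple.ids 𝓜.M.id Γ) gs
    rw [𝓜.lamb_spec, 𝓜.M.comp_id] at e
    rwa [e] at this

/-! #### Eta -/

theorem IsOp.den_vars {u : Raw A} {ts : List (Raw A)} {as : List A.Node} {b : A.Node}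
    {o : 𝓜.H as b} (h : IsOp 𝓜 u ts as b o) (ht : ts = (List.range as.length).map .var) :
    Den 𝓜 (List.range as.length) u as b o := by
  subst ht
  have h' := (SubstRel.vars (𝓜 := 𝓜) (σ := .var) (ρ := id) (xs := List.range as.length) (Γ := as)
    (fun x _ => rfl) (by simp)).mono (P' := Den 𝓜) Raw.var fun _ _ _ _ _ _ h => h
  rw [List.map_id] at h'
  have := Den.op h h' List.nodup_range (.refl 𝓜.S (by simp) _)
  rwa [𝓜.M.comp_id] at this

theorem den_varTup (as : List A.Node) :
    Den 𝓜 (List.range as.length) (.varTup as.length) as (.tensor as) (𝓜.re as) :=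
  (IsOp.tup (fun i : Fin as.length => .var i) as).den_vars (by apply List.ext_get <;> simp)

theorem reord_append_nil {xs : List ℕ} {Γ : List A.Node} {b : A.Node} (m : 𝓜.H Γ b)
    (hx : xs.length = Γ.length) : Reord 𝓜.S (xs ++ []) (Γ ++ []) b
      (𝓜.M.comp (𝓜.M.id b) (.cons m .nil rfl)) xs Γ b m := by
  have key : ∀ (ys : List ℕ) (Δ : List A.Node) (e : Δ = Γ ++ []), ys = xs →
      Reord 𝓜.S ys Δ b (𝓜.M.comp (𝓜.M.id b) (.cons m .nil e)) xs Γ b m := by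
    rintro ys Δ e rfl
    obtain rfl : Δ = Γ := e.trans (List.append_nil Γ)
    rw [𝓜.M.id_comp]
    exact .refl 𝓜.S hx m
  exact key _ _ rfl (List.append_nil xs)

theorem Den.eta₁ {xs : List ℕ} {s : Raw A} {Γ as : List A.Node} {m : 𝓜.H Γ (.tensor as)}
    (h : Den 𝓜 xs s Γ (.tensor as) m) :
    Den 𝓜 xs (.sub as (.varTup as.length) s) Γ (.tensor as) m := by
  have h₁ := (den_varTup (𝓜 := 𝓜) as).reord (reord_append_nil (𝓜.re as) (by simp)).symm
  refine Den.sub (xs := []) (Γ := []) h₁ h (by simpa using h.nodup) ?_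
  have e := 𝓜.eq_unre (δ := []) (g := 𝓜.M.id (.tensor as)) rfl
  rw [Tuple.ids] at e ⊢
  rw [← e]
  exact reord_append_nil m h.length_eq

theorem Den.eta₂ {xs : List ℕ} {s : Raw A} {Γ as : List A.Node} {b : A.Node}
    {m : 𝓜.H Γ (.lolli as b)} (h : Den 𝓜 xs s Γ (.lolli as b) m) :
    Den 𝓜 xs (.lam as (.app (s.shift as.length) (.varTup as.length))) Γ (.lolli as b) m := by
  have h₁ := Den.op (.app _ _ as b) (.cons (Γ := Γ ++ as) rfl (h.shift as.length)
    (.cons (List.append_nil as).symm (den_varTup as) .nil))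
    (by rw [List.append_nil]; exact nodup_shift_range h.nodup _)
    (.refl 𝓜.S (by simp [h.length_eq]) _)
  rw [List.append_nil] at h₁
  refine .lam h.length_eq h₁ ?_
  rw [← 𝓜.eq_lamb (g := m) rfl]
  exact .refl 𝓜.S h.length_eq m

/-- As `Den.eta₁` goes from `s` to its expansion, the converse needs that `s` is typed. -/
theorem SemLe.eta₁ (as : List A.Node) (s : Raw A) :
    SemLe 𝓜 (.sub as (.varTup as.length) s) s := by
  intro xs Γ b m h
  obtain ⟨rfl, hs⟩ := typed_eta₁.1 h.typed
  exact h.reverse hs fun m' h' => h'.eta₁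

theorem SemLe.eta₂ (as : List A.Node) (s : Raw A) :
    SemLe 𝓜 (.lam as (.app (s.shift as.length) (.varTup as.length))) s := by
  intro xs Γ b m h
  obtain ⟨⟨c, rfl⟩, hs⟩ := typed_eta₂.1 h.typed
  exact h.reverse hs fun m' h' => h'.eta₂

/-! #### Structural equivalence -/

theorem exchange_comp_upRen (k d : ℕ) (ρ : ℕ → ℕ) :
    exchange k d ∘ upRen k (upRen d ρ) = upRen d (upRen k ρ) ∘ exchange k d := by
  funext i
  simp only [exchange, upRen, Function.comp]
  split_ifs <;> first | omega | (rw [show i - k - d = i - d - k by omega]; omega)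

theorem subst_instSub_exchange (k d : ℕ) :
    (fun i => (Raw.upSub k (Raw.upSub d (Raw.var (A := A) ∘ (· + k))) i).subst
      (instSub fun i : Fin k => .var (i + d))) = fun i => .var (exchange k d i) := by
  funext i
  by_cases h : i < k
  · simp [Raw.upSub, Raw.subst, instSub, exchange, h]
  by_cases h' : i < k + d
  · have h₁ : i - k < d := by omega
    have h₂ : i - k + k = i := by omega
    simp [Raw.upSub, Raw.subst, instSub, exchange, h, h', h₁, Raw.shift, Raw.rename, h₂]
  · have h₁ : ¬ i - k < d := by omega
    have h₂ : ¬ (i - k - d + k + d + k < k) := by omega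
    have h₃ : i - k - d + k + d + k - k = i := by omega
    simp only [Raw.upSub, Raw.subst, instSub, exchange, h, h', h₁, Raw.shift, Raw.rename, h₂, h₃,
      if_false, dif_neg, not_false_eq_true, Function.comp]

/-- Substitution of a term for the variable `0`, of type `a`, in a term that has the other free
variables `xs`. -/
theorem Den.subst_head {zs xs : List ℕ} {s : Raw A} {Δ Γ : List A.Node} {a b : A.Node}
    {q : 𝓜.H (a :: Γ) b} {p : 𝓜.H Δ a} {σ : ℕ → Raw A} {ρ : ℕ → ℕ}
    (h : Den 𝓜 (0 :: xs.map (· + 1)) s (a :: Γ) b q) (hp : Den 𝓜 zs (σ 0) Δ a p)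
    (hσ : ∀ x, σ (x + 1) = .var (ρ x)) (hn : (zs ++ xs.map ρ).Nodup) :
    Den 𝓜 (zs ++ xs.map ρ) (s.subst σ) (Δ ++ Γ) b
      (𝓜.M.comp q (.cons p (Tuple.ids 𝓜.M.id Γ) rfl)) := by
  have hx : xs.length = Γ.length := by simpa using h.length_eq
  refine h.subst (.cons rfl hp ?_) hn
  have := SubstRel.vars (𝓜 := 𝓜) (σ := σ) (ρ := fun x => ρ (x - 1)) (xs := xs.map (· + 1)) (Γ := Γ)
    (fun x hx => by
      obtain ⟨y, -, rfl⟩ := List.mem_map.1 hx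
      simp [hσ]) (by simpa using hx)
  simpa [Function.comp_def] using this

/-- A term `C[s][x⃗ := t]` is interpreted as `C[s[x⃗ := t]]`. The interpretation of the latter, with
a variable for `t`, is the transpose of that of `C[s]`, because it is so after the substitution of
`⟨x⃗⟩` for the variable, which yields a `β` redex. -/
theorem SemLe.root (C : Cx A) (as : List A.Node) (s t : Raw A) :
    SemLe 𝓜 (.sub as ((C.shift as.length).plug (s.rename (exchange as.length C.depth))) t)
      (C.plug (.sub as s (t.shift C.depth))) := by
  intro ys Θ b m hd
  cases hd with
  | op ho => cases ho
  | @sub _ _ _ ws zs Γ Δ _ n p _ _ _ h₁ h₂ hn r =>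
  have hw : ws.length = Γ.length := by simpa using h₁.length_eq
  set k := as.length
  set d := C.depth with hd
  set s₁ := s.rename (upRen k (upRen d (· + 1))) with hs₁
  set D := (C.rename (· + 1)).plug (.sub as s₁ (.var d)) with hD
  have hn' : (0 :: ws.map (· + 1)).Nodup := by
    have hws := (List.nodup_append.1 hn).2.1
    simpa using hws.map (add_injective 1)
  -- The term `D`, which is `C[s[x⃗ := x]]` for a variable `x` numbered `0`, is typed.
  have hE : Typed ((0 :: ws.map (· + 1)).zip (.tensor as :: Γ)) D b := by
    have h := sameTyping_root (C.rename (· + 1)) as s₁ (.var 0)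
    rw [Cx.depth_rename, ← hd, Raw.shift, Raw.rename, Nat.zero_add] at h
    refine h.typed_iff.2 ?_
    have h₃ := h₁.rename (upRen_injective (add_injective 1) k)
    rw [List.map_append, map_upRen_range, map_upRen_shift, Cx.plug_rename, Cx.shift,
      Cx.rename_rename, Cx.depth_rename, Raw.rename_rename, ← hd, ← exchange_comp_upRen,
      ← Raw.rename_rename] at h₃
    have h₄ := (Den.sub h₃ (.var 0 (.tensor as)) hn'
      (.refl 𝓜.S (by simpa using hw) _)).typed
    have e : (C.rename (· + 1)).shift k = C.rename (upRen k (· + 1) ∘ (· + k)) := by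
      rw [Cx.shift, Cx.rename_rename]
      congr 1
      funext i
      simp [upRen]
    rw [e]
    exact h₄
  -- The interpretation `q` of `D` yields that of the term on the right, by substitution of `t`.
  obtain ⟨q, hq⟩ := hE.exists_den_zip 𝓜 (by simpa using hw)
  have hplug : ∀ (σ : ℕ → Raw A) (ρ : ℕ → ℕ), (∀ x, σ (x + 1) = .var (ρ x)) → D.subst σ =
      (C.rename ρ).plug (.sub as (s.subst (Raw.upSub k (Raw.upSub d (.var ∘ ρ))))
        ((σ 0).shift d)) := by
    intro σ ρ hσ
    rw [hD, Cx.plug_subst C _ _ ρ σ hσ, Raw.subst, Raw.subst, hs₁, Raw.subst_rename,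
      Raw.upSub_comp_upRen, Raw.upSub_comp_upRen, ← hd]
    rw [show σ ∘ (· + 1) = .var ∘ ρ from funext hσ]
    simp [Raw.upSub, k]
  -- Precomposition of `q` with `re` is the substitution of `⟨x⃗⟩` in `D`; the `β` reduct is `C[s]`.
  have hqn : q = 𝓜.unre n := by
    refine 𝓜.eq_unre ?_
    let σ : ℕ → Raw A := fun x => if x = 0 then .varTup k else .var (x - 1 + k)
    have h₃ := hq.subst_head (σ := σ) (ρ := (· + k)) (den_varTup as) (fun x => by simp [σ])
      (nodup_range_shift (List.nodup_append.1 hn).2.1 k)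
    rw [hplug σ (· + k) fun x => by simp [σ]] at h₃
    have h₄ := (SemLe.beta₁ as _ _).plug _ _ _ _ _ h₃
    refine Den.eq h₄ ?_
    convert h₁ using 2
    congr 1
    rw [Raw.subst_subst, Raw.rename_eq_subst]
    congr 1
    exact (subst_instSub_exchange k d)
  let σ : ℕ → Raw A := fun x => if x = 0 then t else .var (x - 1)
  have h₃ := hq.subst_head (σ := σ) (ρ := id) h₂ (fun x => by simp [σ]) (by rwa [List.map_id])
  rw [hplug σ id fun x => by simp [σ], List.map_id, Cx.rename_id, Function.comp_id, Raw.upSub_var,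
    Raw.upSub_var, Raw.subst_var, hqn] at h₃
  exact h₃.reord r

/-- Structurally equivalent terms have the same interpretations, in each model. -/
theorem StrEq.semLe {s t : Raw A} (h : StrEq s t) : SemLe 𝓜 s t ∧ SemLe 𝓜 t s := by
  induction h with
  | root C as s t =>
    refine ⟨fun xs Γ b m h => ?_, SemLe.root C as s t⟩
    exact h.reverse ((sameTyping_root C as s t).typed_iff.1 h.typed)
      fun _ h' => SemLe.root C as s t _ _ _ _ h'
  | congr C _ ih => exact ⟨ih.1.plug C, ih.2.plug C⟩
  | refl s => exact ⟨.refl s, .refl s⟩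
  | symm _ ih => exact ih.symm
  | trans _ _ ih ih' => exact ⟨ih.1.trans ih'.1, ih'.2.trans ih.2⟩

/-- The `β` rules at a distance are reduced to those for `L = [·]` by moving `L` out of the redex,
which is a structural equivalence. -/
theorem BetaRoot.semLe {s t : Raw A} (h : BetaRoot s t) : SemLe 𝓜 s t := by
  cases h with
  | beta₁ as s L ts hL =>
    exact (StrEq.sub_plug hL as s _).semLe.1.trans ((SemLe.beta₁ as _ ts).plug L)
  | beta₂ as s L ts hL =>
    exact (StrEq.app_plug hL _ _).semLe.1.trans ((SemLe.beta₂ as s _).plug L)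

/-- The reduction relation and structural equivalence preserve interpretations. -/
theorem Den.of_step {xs : List ℕ} {s t : Raw A} {Γ : List A.Node} {b : A.Node} {m : 𝓜.H Γ b}
    (hst : StrEq s t ∨ RawStep s t) (hs : Typed (xs.zip Γ) s b) (ht : Typed (xs.zip Γ) t b) :
    Den 𝓜 xs s Γ b m ↔ Den 𝓜 xs t Γ b m := by
  have key : ∀ {s t : Raw A}, SemLe 𝓜 s t → Typed (xs.zip Γ) s b →
      (Den 𝓜 xs s Γ b m ↔ Den 𝓜 xs t Γ b m) := fun h hs =>
    ⟨h _ _ _ _, fun hd => hd.reverse hs fun m' h' => h _ _ _ _ h'⟩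
  rcases hst with h | h
  · exact key h.semLe.1 hs
  · cases h with
    | beta C h => exact key (h.semLe.plug C) hs
    | eta₁ E _ h =>
      cases h with
      | eta => exact (key ((SemLe.eta₁ _ _).plug E) ht).symm
    | eta₂ D _ h =>
      cases h with
      | eta => exact (key ((SemLe.eta₂ _ _).plug D) ht).symm

end Soundness

/-! ### Conversion of typed terms -/

section Conv

variable {A : AutSignature.{u, v}}

/-- The model in which each set of multiarrows is a singleton. -/
def trivialModel (A : AutSignature.{u, v}) : Model.{u, v, 0} A where
  H _ _ := PUnit
  M :=
    { id _ := ⟨⟩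
      comp _ _ := ⟨⟩
      id_comp _ := rfl
      comp_id _ := rfl
      assoc _ _ _ := rfl }
  S :=
    { act := @fun _ _ _ _ _ _ _ _ _ _ => PUnit.unit
      act_refl := by intros; rfl
      act_trans := by intros; rfl
      comp_act := by intros; rfl }
  re _ := ⟨⟩
  re_bij _ _ _ := ⟨fun _ _ _ => rfl, fun _ => ⟨PUnit.unit, rfl⟩⟩
  ap _ _ := ⟨⟩
  ap_bij _ _ _ := ⟨fun _ _ _ => rfl, fun _ => ⟨PUnit.unit, rfl⟩⟩
  gen _ := ⟨⟩

/-- In the trivial model, to have an interpretation is to be typed; hence soundness in this model is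
subject reduction. -/
theorem Typed.of_semLe {Θ : TyCtx A} {s t : Raw A} {b : A.Node}
    (h : SemLe (trivialModel A) s t) (hs : Typed Θ s b) : Typed Θ t b := by
  obtain ⟨m, hm⟩ := hs.exists_den (trivialModel A)
  have := (h _ _ _ _ hm).typed
  rwa [zip_fst_snd] at this

/-- The equivalence relation on the terms `s` with `Θ ⊢ s : b` that is generated by structural
equivalence and reduction. -/
def Conv (Θ : TyCtx A) (b : A.Node) : Raw A → Raw A → Prop :=
  Relation.EqvGen fun s t => Typed Θ s b ∧ Typed Θ t b ∧ (StrEq s t ∨ RawStep s t)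

namespace Conv

theorem refl {Θ : TyCtx A} {b : A.Node} (s : Raw A) : Conv Θ b s s := Relation.EqvGen.refl s

theorem symm {Θ : TyCtx A} {b : A.Node} {s t : Raw A} (h : Conv Θ b s t) : Conv Θ b t s :=
  Relation.EqvGen.symm _ _ h

theorem trans {Θ : TyCtx A} {b : A.Node} {s t r : Raw A} (h : Conv Θ b s t) (h' : Conv Θ b t r) :
    Conv Θ b s r := Relation.EqvGen.trans _ _ _ h h'

theorem typed_iff {Θ : TyCtx A} {b : A.Node} {s t : Raw A} (h : Conv Θ b s t) :
    Typed Θ s b ↔ Typed Θ t b := by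
  induction h with
  | rel _ _ h => exact iff_of_true h.1 h.2.1
  | refl => rfl
  | symm _ _ _ ih => exact ih.symm
  | trans _ _ _ _ _ ih ih' => exact ih.trans ih'

theorem of_strEq {Θ : TyCtx A} {b : A.Node} {s t : Raw A} (hs : Typed Θ s b) (h : StrEq s t) :
    Conv Θ b s t := .rel _ _ ⟨hs, h.sameTyping.typed_iff.1 hs, .inl h⟩

theorem of_beta (C : Cx A) {Θ : TyCtx A} {b : A.Node} {s t : Raw A} (hs : Typed Θ (C.plug s) b)
    (h : BetaRoot s t) : Conv Θ b (C.plug s) (C.plug t) :=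
  .rel _ _ ⟨hs, hs.of_semLe (h.semLe.plug C), .inr (.beta C h)⟩

theorem perm {Θ Θ' : TyCtx A} {b : A.Node} {s t : Raw A} (h : Conv Θ b s t) (hp : Θ.Perm Θ') :
    Conv Θ' b s t :=
  h.mono fun _ _ ⟨h₁, h₂, h₃⟩ => ⟨h₁.perm hp, h₂.perm hp, h₃⟩

theorem map {Θ Θ' : TyCtx A} {b b' : A.Node} (f : Raw A → Raw A)
    (hT : ∀ s, Typed Θ s b → Typed Θ' (f s) b') (hS : ∀ s t, StrEq s t → StrEq (f s) (f t))
    (hR : ∀ s t, Typed Θ s b → Typed Θ t b → RawStep s t → Conv Θ' b' (f s) (f t)) {s t : Raw A}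
    (h : Conv Θ b s t) : Conv Θ' b' (f s) (f t) := by
  induction h with
  | rel s t h =>
    obtain ⟨h₁, h₂, h₃ | h₃⟩ := h
    · exact .of_strEq (hT _ h₁) (hS _ _ h₃)
    · exact hR _ _ h₁ h₂ h₃
  | refl => exact .refl _
  | symm _ _ _ ih => exact ih.symm
  | trans _ _ _ _ _ ih ih' => exact ih.trans ih'

end Conv

/-- Reduction is closed under contexts that respect the restrictions on `η`. -/
theorem RawStep.congr (C : Cx A) (hE : ∀ E : Cx A, E.IsE → (C.comp E).IsE)
    (hD : ∀ D : Cx A, D.IsD → (C.comp D).IsD) {s t : Raw A} (h : RawStep s t) :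
    RawStep (C.plug s) (C.plug t) := by
  cases h with
  | beta C' h => rw [← Cx.plug_comp, ← Cx.plug_comp]; exact .beta _ h
  | eta₁ E hE' h => rw [← Cx.plug_comp, ← Cx.plug_comp]; exact .eta₁ _ (hE E hE') h
  | eta₂ D hD' h => rw [← Cx.plug_comp, ← Cx.plug_comp]; exact .eta₂ _ (hD D hD') h

namespace Conv

theorem plug {Θ Θ' : TyCtx A} {b b' : A.Node} (C : Cx A) (hE : ∀ E : Cx A, E.IsE → (C.comp E).IsE)
    (hD : ∀ D : Cx A, D.IsD → (C.comp D).IsD) (hT : ∀ s, Typed Θ s b → Typed Θ' (C.plug s) b')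
    {s t : Raw A} (h : Conv Θ b s t) : Conv Θ' b' (C.plug s) (C.plug t) :=
  h.map C.plug hT (fun _ _ => .congr C) fun s t hs ht h =>
    .rel _ _ ⟨hT s hs, hT t ht, .inr (h.congr C hE hD)⟩

theorem lam {γ : TyCtx A} {as : List A.Node} {b : A.Node} {s t : Raw A}
    (h : Conv (γ.shift as.length ++ enumCtx as) b s t) :
    Conv γ (.lolli as b) (.lam as s) (.lam as t) :=
  h.plug (.lam as .hole) (fun _ h => h) (fun _ h => h) fun _ => .lam

theorem appR {γ δ Θ : TyCtx A} {as : List A.Node} {b : A.Node} {s t t' : Raw A}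
    (hs : Typed γ s (.lolli as b)) (h : Conv δ (.tensor as) t t') (hm : Merge ![γ, δ] Θ) :
    Conv Θ b (.app s t) (.app s t') :=
  h.plug (.appR s .hole) (fun _ h => h) (fun _ h => h) fun _ h => .app hs h hm

theorem subL {γ δ₁ δ₂ Θ : TyCtx A} {s t t' : Raw A} {as : List A.Node} {b : A.Node}
    (hs : Typed γ s (.tensor as))
    (h : Conv (δ₁.shift as.length ++ enumCtx as ++ δ₂.shift as.length) b t t')
    (hm : Merge ![γ, δ₁, δ₂] Θ) : Conv Θ b (.sub as t s) (.sub as t' s) :=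
  h.plug (.subL as .hole s) (fun _ h => h) (fun _ h => h) fun _ h => .sub hs h hm

theorem tup_update {k : ℕ} {γ : Fin k → TyCtx A} {ss : Fin k → Raw A} {as : Fin k → A.Node}
    {Θ : TyCtx A} (hs : ∀ j, Typed (γ j) (ss j) (as j)) {i : Fin k} {s t : Raw A}
    (h : Conv (γ i) (as i) s t) (hm : Merge γ Θ) :
    Conv Θ (.tensor (List.ofFn as)) (.tup (Function.update ss i s))
      (.tup (Function.update ss i t)) :=
  h.plug (.tup ss i .hole) (fun _ h => h) (fun _ h => h) fun s h => .tup (fun j => by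
    by_cases hj : j = i
    · subst hj; simpa [Cx.plug] using h
    · simpa only [Function.update_of_ne hj] using hs j) hm

theorem tup {k : ℕ} {γ : Fin k → TyCtx A} {ss ts : Fin k → Raw A} {as : Fin k → A.Node}
    {Θ : TyCtx A} (hs : ∀ j, Typed (γ j) (ss j) (as j)) (h : ∀ i, Conv (γ i) (as i) (ss i) (ts i))
    (hm : Merge γ Θ) : Conv Θ (.tensor (List.ofFn as)) (.tup ss) (.tup ts) := by
  -- The entries are replaced one by one.
  have key : ∀ n ≤ k, Conv Θ (.tensor (List.ofFn as)) (.tup ss)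
      (.tup fun i => if (i : ℕ) < n then ts i else ss i) := by
    intro n hn
    induction n with
    | zero => simpa using refl _
    | succ n ih =>
      refine (ih (by omega)).trans ?_
      have := tup_update (ss := fun i : Fin k => if (i : ℕ) < n then ts i else ss i)
        (fun j => by
          split_ifs
          · exact (h j).typed_iff.1 (hs j)
          · exact hs j) (h ⟨n, hn⟩) hm
      convert this using 2
      · funext i
        by_cases hi : i = ⟨n, hn⟩
        · subst hi; simp
        · rw [Function.update_of_ne hi]
      · funext i
        by_cases hi : i = ⟨n, hn⟩
        · subst hi; simp
        · rw [Function.update_of_ne hi]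
          have : (i : ℕ) ≠ n := fun e => hi (Fin.ext e)
          congr 1
          simp only [eq_iff_iff]
          omega
  simpa using key k le_rfl

end Conv

/-! #### Unconditional eta -/

theorem Raw.STy.of_plug {L : Cx A} (hL : L.IsL) {τ : ℕ → A.Node} {s : Raw A} {b : A.Node}
    (h : Raw.STy τ (L.plug s) b) : ∃ τ', Raw.STy τ' s b := by
  induction L generalizing τ with
  | hole => exact ⟨τ, h⟩
  | subL as L t ih => exact ih hL h.1
  | _ => exact hL.elim

theorem Raw.varTup_subst_instSub {k : ℕ} (ts : Fin k → Raw A) (ρ : ℕ → ℕ) :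
    ((varTup k).rename (upRen k ρ)).subst (instSub ts) = .tup ts := by
  simp only [varTup, rename, subst]
  congr 1
  funext i
  simp [upRen, instSub]

/-- The `η` rule for `⟨x⃗⟩[x⃗ := s]`, without its side condition: if `s` is of the form `L[⟨t⃗⟩]`,
then the expanded term reduces to `s` by `β`. -/
theorem Conv.eta₁ {Θ : TyCtx A} {as : List A.Node} {s : Raw A} (hs : Typed Θ s (.tensor as)) :
    Conv Θ (.tensor as) s (.sub as (.varTup as.length) s) := by
  by_cases h : IsLT s
  · obtain ⟨L, k, ss, hL, rfl⟩ := h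
    obtain ⟨τ, -, hτ⟩ := hs.wt.sty
    obtain ⟨τ', cs, hc, -⟩ := hτ.of_plug hL
    injection hc with hc
    obtain rfl : as.length = k := by rw [hc]; simp
    have := Conv.of_beta .hole (typed_eta₁.2 ⟨rfl, hs⟩) (.beta₁ as (.varTup as.length) L ss hL)
    rw [Raw.varTup_subst_instSub] at this
    exact this.symm
  · exact .rel _ _ ⟨hs, typed_eta₁.2 ⟨rfl, hs⟩, .inr (.eta₁ .hole trivial (.eta Θ as s hs h))⟩

theorem exchange_comp_upRen_add (k d : ℕ) : exchange k d ∘ upRen k (· + d) = (· + d) := by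
  funext i
  simp only [exchange, upRen, Function.comp]
  split_ifs <;> omega

theorem instSub_comp_upRen_add (k : ℕ) :
    instSub (A := A) (fun i : Fin k => .var i) ∘ upRen k (· + k) = .var := by
  funext i
  by_cases h : i < k
  · simp [instSub, upRen, h]
  · simp [instSub, upRen, h, Nat.sub_add_cancel (not_lt.1 h)]

/-- The `β` redex in `λx⃗. (λx⃗. s)⟨x⃗⟩`. -/
theorem betaRoot_lam_varTup (as : List A.Node) (s : Raw A) :
    BetaRoot (.app ((Raw.lam as s).shift as.length) (.varTup as.length)) s := by
  have := BetaRoot.beta₂ as (s.rename (upRen as.length (· + as.length))) .hole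
    (fun i : Fin as.length => .var i) trivial
  simp only [Cx.plug, Cx.depth, shift_zero] at this
  rwa [Raw.subst_rename, instSub_comp_upRen_add, Raw.subst_var] at this

/-- Congruence on the left of an application. The conversion `s ∼ λx⃗. s⟨x⃗⟩` is not a step there;
it is obtained from `s t ∼ s ⟨x⃗⟩[x⃗ := t] ≡ (s ⟨x⃗⟩)[x⃗ := t]`. -/
theorem Conv.appL {γ δ Θ : TyCtx A} {as : List A.Node} {b : A.Node} {s s' t : Raw A}
    (h : Conv γ (.lolli as b) s s') (ht : Typed δ t (.tensor as)) (hm : Merge ![γ, δ] Θ) :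
    Conv Θ b (.app s t) (.app s' t) := by
  have hT : ∀ s, Typed γ s (.lolli as b) → Typed Θ (.app s t) b := fun s h => .app h ht hm
  have key : ∀ s, Typed γ s (.lolli as b) →
      Conv Θ b (.app s t) (.sub as (.app (s.shift as.length) (.varTup as.length)) t) := by
    intro s h
    have h₁ := Conv.appR h (Conv.eta₁ ht) hm
    refine h₁.trans (.of_strEq (h₁.typed_iff.1 (hT s h)) ?_)
    have := StrEq.root (.appR s .hole) as (.varTup as.length) t
    simp only [Cx.plug, Cx.depth, Cx.shift, Cx.rename, shift_zero, exchange_zero,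
      Raw.rename_id] at this
    exact this
  refine h.map (fun s => .app s t) hT (fun _ _ => .congr (.appL .hole t)) fun s s' hs hs' h => ?_
  cases h with
  | beta C h =>
    exact .rel _ _ ⟨hT _ hs, hT _ hs', .inr ((RawStep.beta (.appL C t) h))⟩
  | eta₁ E hE h =>
    exact .rel _ _ ⟨hT _ hs, hT _ hs', .inr ((RawStep.eta₁ (.appL E t) hE h))⟩
  | eta₂ D hD h =>
    by_cases hD' : D = .hole
    · -- The step `s → λx⃗. s⟨x⃗⟩` at the hole: by `key`, both sides become `(s ⟨x⃗⟩)[x⃗ := t]` up to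
      -- `β`.
      subst hD'
      cases h with
      | eta _ cs c _ _ _ =>
      obtain ⟨⟨c', e⟩, -⟩ := typed_eta₂.1 hs'
      injection e with e
      subst e
      refine (key _ hs).trans (.symm ((key _ hs').trans ?_))
      exact Conv.of_beta (.subL as .hole t) ((key _ hs').typed_iff.1 (hT _ hs'))
        (betaRoot_lam_varTup as _)
    · exact .rel _ _ ⟨hT _ hs, hT _ hs', .inr ((RawStep.eta₂ (.appL D t) ⟨hD, hD'⟩ h))⟩

/-- The `η` rule for `λx⃗. s⟨x⃗⟩`, without its side condition: if `s` is of the form `L[λy⃗. u]`,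
then `L` can be moved out of the abstraction, and the rest reduces to `λy⃗. u` by `β`. -/
theorem Conv.eta₂ {Θ : TyCtx A} {as : List A.Node} {b : A.Node} {s : Raw A}
    (hs : Typed Θ s (.lolli as b)) :
    Conv Θ (.lolli as b) s (.lam as (.app (s.shift as.length) (.varTup as.length))) := by
  by_cases h : IsAT s
  · obtain ⟨L, cs, u, hL, rfl⟩ := h
    induction L generalizing Θ with
    | hole =>
      have e : cs = as := by
        cases hs
        rfl
      subst e
      exact (Conv.of_beta (.lam cs .hole) (typed_eta₂.2 ⟨⟨b, rfl⟩, hs⟩)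
        (betaRoot_lam_varTup cs u)).symm
    | subL bs L r ih =>
      cases hs with
      | sub h h' hm =>
      have h₁ := Conv.subL h (ih hL h') hm
      refine h₁.trans (.of_strEq (h₁.typed_iff.1 (.sub h h' hm)) (.symm ?_))
      have := StrEq.root (.lam as (.appL .hole (.varTup as.length))) bs
        ((L.plug (.lam cs u)).rename (upRen bs.length (· + as.length))) r
      simp only [Cx.plug, Cx.depth, Cx.shift, Cx.rename, Raw.rename_rename, add_zero,
        exchange_comp_upRen_add] at this
      have e : (Raw.varTup as.length : Raw A).rename (upRen as.length (· + bs.length)) =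
          .varTup as.length := by
        simp [Raw.varTup, Raw.rename, upRen]
      rw [e] at this
      exact this
    | _ => exact hL.elim
  · exact .rel _ _ ⟨hs, typed_eta₂.2 ⟨⟨b, rfl⟩, hs⟩,
      .inr (.eta₂ .hole trivial (.eta Θ as b s hs h))⟩

/-! #### Conversion and substitution -/

theorem merge_nil_left {Θ : TyCtx A} (hn : (Θ.map Prod.fst).Nodup) : Merge ![[], Θ] Θ := by
  refine ⟨?_, .of_sublist ?_ ?_ hn.of_map⟩
  · intro i j hij
    fin_cases i <;> fin_cases j <;> simp_all
  · intro i
    fin_cases i <;> simp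
  · simp [List.ofFn_succ]

theorem Typed.nodup {Θ : TyCtx A} {s : Raw A} {b : A.Node} (h : Typed Θ s b) :
    (Θ.map Prod.fst).Nodup := h.wt.nodup

theorem Typed.lt_of_occ {as : List A.Node} {s : Raw A} {b : A.Node} (h : Typed (enumCtx as) s b)
    {x : ℕ} (hx : s.occ x ≠ 0) : x < as.length := by
  by_contra h'
  refine hx ((h.wt.occ x).trans (if_neg ?_))
  rwa [enumCtx_names, List.mem_range]

theorem Typed.subst_congr {as : List A.Node} {s : Raw A} {b : A.Node} (h : Typed (enumCtx as) s b)
    {σ τ : ℕ → Raw A} (hσ : ∀ x < as.length, σ x = τ x) : s.subst σ = s.subst τ :=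
  s.subst_congr fun x hx => hσ x (h.lt_of_occ hx)

theorem Typed.redex {Θ : TyCtx A} {as : List A.Node} {b : A.Node} {s t : Raw A}
    (hs : Typed (enumCtx as) s b) (ht : Typed Θ t (.tensor as)) : Typed Θ (.app (.lam as s) t) b :=
  .app (.lam (γ := []) hs) ht (merge_nil_left ht.nodup)

/-- A substitution instance of `s` is the reduct of a `β` redex, so that it inherits typing and
conversion from the latter. -/
theorem Conv.redex {Θ : TyCtx A} {as : List A.Node} {b : A.Node} {s : Raw A} {σ : ℕ → Raw A}
    (hs : Typed (enumCtx as) s b)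
    (ht : Typed Θ (.tup fun i : Fin as.length => σ i) (.tensor as)) :
    Conv Θ b (.app (.lam as s) (.tup fun i : Fin as.length => σ i)) (s.subst σ) := by
  have h := Conv.of_beta .hole (hs.redex ht) (.beta₂ as s .hole (fun i => σ i) trivial)
  simp only [Cx.plug, Cx.depth, shift_zero] at h
  rwa [hs.subst_congr (τ := σ) fun x hx => by simp [instSub, hx]] at h

theorem Typed.subst {Θ : TyCtx A} {as : List A.Node} {b : A.Node} {s : Raw A} {σ : ℕ → Raw A}
    (hs : Typed (enumCtx as) s b)
    (ht : Typed Θ (.tup fun i : Fin as.length => σ i) (.tensor as)) : Typed Θ (s.subst σ) b :=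
  (Conv.redex hs ht).typed_iff.1 (hs.redex ht)

theorem Conv.subst {Θ : TyCtx A} {as : List A.Node} {b : A.Node} {s s' : Raw A} {σ σ' : ℕ → Raw A}
    (h : Conv (enumCtx as) b s s') (hs : Typed (enumCtx as) s b)
    (h' : Conv Θ (.tensor as) (.tup fun i : Fin as.length => σ i)
      (.tup fun i : Fin as.length => σ' i))
    (ht : Typed Θ (.tup fun i : Fin as.length => σ i) (.tensor as)) :
    Conv Θ b (s.subst σ) (s'.subst σ') := by
  have hs' := h.typed_iff.1 hs
  have ht' := h'.typed_iff.1 ht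
  have hm := merge_nil_left ht.nodup
  have h₁ : Conv [] (.lolli as b) (.lam as s) (.lam as s') := .lam h
  exact (Conv.redex hs ht).symm.trans ((h₁.appL ht hm).trans
    ((Conv.appR (.lam (γ := []) hs') h' hm).trans (Conv.redex hs' ht')))

theorem typed_vars {as : List A.Node} {xs : List ℕ} (hl : xs.length = as.length) (hn : xs.Nodup)
    {ρ : ℕ → ℕ} (hρ : (List.range as.length).map ρ = xs) :
    Typed (xs.zip as) (.tup fun i : Fin as.length => .var (ρ i)) (.tensor as) := by
  subst hρ
  have := (den_varTup (𝓜 := trivialModel A) as).subst (σ := fun x => .var (ρ x))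
    (SubstRel.vars (fun x _ => rfl) (by simp)) hn
  exact this.typed

theorem Typed.rename {as : List A.Node} {b : A.Node} {s : Raw A} {xs : List ℕ}
    (h : Typed (enumCtx as) s b) (hn : xs.Nodup) {ρ : ℕ → ℕ}
    (hρ : (List.range as.length).map ρ = xs) : Typed (xs.zip as) (s.rename ρ) b := by
  rw [Raw.rename_eq_subst]
  exact h.subst (typed_vars (by simp [← hρ]) hn hρ)

theorem Conv.rename {as : List A.Node} {b : A.Node} {s s' : Raw A} {xs : List ℕ}
    (h : Conv (enumCtx as) b s s') (hs : Typed (enumCtx as) s b) (hn : xs.Nodup) {ρ : ℕ → ℕ}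
    (hρ : (List.range as.length).map ρ = xs) : Conv (xs.zip as) b (s.rename ρ) (s'.rename ρ) := by
  rw [Raw.rename_eq_subst, Raw.rename_eq_subst]
  exact h.subst hs (.refl _) (typed_vars (by simp [← hρ]) hn hρ)

/-! #### Conversion is the equivalence of terms -/

/-- The relation on terms that is generated by structural equivalence and by the equivalence
generated by reduction can be generated in a single step, on raw terms. -/
theorem conv_iff_sim {as : List A.Node} {b : A.Node} {s t : Term A as b} :
    Conv (enumCtx as) b s.1 t.1 ↔ simSetoid A as b s t := by
  constructor
  · intro h
    have key : ∀ {s t : Raw A}, Conv (enumCtx as) b s t → (Typed (enumCtx as) s b ↔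
        Typed (enumCtx as) t b) ∧ ∀ hs ht, simSetoid A as b ⟨s, hs⟩ ⟨t, ht⟩ := by
      intro s t h
      refine ⟨h.typed_iff, ?_⟩
      induction h with
      | rel s t h =>
        intro hs ht
        refine .rel _ _ (h.2.2.imp id fun h => .rel _ _ h)
      | refl s => intro _ _; exact .refl _
      | symm _ _ _ ih => intro hs ht; exact .symm _ _ (ih ht hs)
      | trans s t r h h' ih ih' =>
        intro hs ht
        have hr := Conv.typed_iff (s := s) (t := t) h |>.1 hs
        exact (simSetoid A as b).trans (ih hs hr) (ih' hr ht)
    exact (key h).2 s.2 t.2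
  · intro h
    induction h with
    | rel s t h =>
      rcases h with h | h
      · exact .of_strEq s.2 h
      · induction h with
        | rel s t h => exact .rel _ _ ⟨s.2, t.2, .inr h⟩
        | refl => exact .refl _
        | symm _ _ _ ih => exact ih.symm
        | trans _ _ _ _ _ ih ih' => exact ih.trans ih'
    | refl => exact .refl _
    | symm _ _ _ ih => exact ih.symm
    | trans _ _ _ _ _ ih ih' => exact ih.trans ih'

theorem FreeHom.mk_eq_mk {as : List A.Node} {b : A.Node} {s t : Term A as b} :
    FreeHom.mk s = FreeHom.mk t ↔ Conv (enumCtx as) b s.1 t.1 := by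
  rw [conv_iff_sim]
  exact Quotient.eq (r := simSetoid A as b)

/-- Convertible terms have the same interpretations. -/
theorem Den.of_conv {𝓜 : Model.{u, v, w} A} {xs : List ℕ} {s t : Raw A} {Γ : List A.Node}
    {b : A.Node} {m : 𝓜.H Γ b} (h : Conv (xs.zip Γ) b s t) :
    Den 𝓜 xs s Γ b m ↔ Den 𝓜 xs t Γ b m := by
  induction h with
  | rel s t h => exact Den.of_step h.2.2 h.1 h.2.1
  | refl => rfl
  | symm _ _ _ ih => exact ih.symm
  | trans _ _ _ _ _ ih ih' => exact ih.trans ih'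

end Conv

/-! ### The multicategory of terms -/

namespace Tuple

variable {O : Type u} {H : List O → O → Type v} {H' : List O → O → Type v₁}

theorem mapHom_mapHom {H'' : List O → O → Type v₂}
    (m : ∀ {as : List O} {b : O}, H as b → H' as b)
    (m' : ∀ {as : List O} {b : O}, H' as b → H'' as b) {Γ as : List O} (t : Tuple H Γ as) :
    (t.mapHom m).mapHom m' = t.mapHom fun f => m' (m f) := by
  induction t with
  | nil => rfl
  | cons g gs h ih => simp only [mapHom, ih]

theorem mapHom_eq_self {m : ∀ {as : List O} {b : O}, H as b → H as b}
    (hm : ∀ {as : List O} {b : O} (f : H as b), m f = f) {Γ as : List O} (t : Tuple H Γ as) :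
    t.mapHom m = t := by
  induction t with
  | nil => rfl
  | cons g gs h ih => simp only [mapHom, ih, hm]

variable (m : ∀ {as : List O} {b : O}, H as b → H' as b)

theorem mapHom_append {Γ Δ as bs : List O} (t : Tuple H Γ as) (t' : Tuple H Δ bs) :
    (t.append t').mapHom m = (t.mapHom m).append (t'.mapHom m) := by
  induction t with
  | nil => rfl
  | cons g gs h ih => simp only [mapHom, append, ih]

theorem mapHom_ids (i : ∀ a, H [a] a) (as : List O) :
    (ids i as).mapHom m = ids (fun a => m (i a)) as := by
  induction as with
  | nil => rfl
  | cons a as ih => simp only [mapHom, ids, ih]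

theorem mapHom_comp {c : ∀ {Γ as : List O} {b : O}, H as b → Tuple H Γ as → H Γ b}
    {c' : ∀ {Γ as : List O} {b : O}, H' as b → Tuple H' Γ as → H' Γ b}
    (hm : ∀ {Γ as : List O} {b : O} (f : H as b) (t : Tuple H Γ as),
      m (c f t) = c' (m f) (t.mapHom m)) {Γ Δ as : List O} (t : Tuple H Γ as) (t' : Tuple H Δ Γ) :
    (t.comp c t').mapHom m = (t.mapHom m).comp c' (t'.mapHom m) := by
  induction t generalizing Δ with
  | nil => rfl
  | @cons γ δ Γ a as g gs h ih =>
    subst h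
    obtain ⟨Δ₁, Δ₂, rfl, t₁, t₂, rfl⟩ := exists_eq_append γ δ t'
    rw [comp_cons, mapHom_append, mapHom, mapHom, comp_cons, ih, hm]

theorem mapHom_ofFn {n : ℕ} {γ : Fin n → List O} {a : Fin n → O} {Γ : List O}
    (g : ∀ i, H (γ i) (a i)) (h : Γ = (List.ofFn γ).flatten) :
    (ofFn g h).mapHom m = ofFn (fun i => m (g i)) h := by
  have key : ∀ (as : List O) (t : Tuple H Γ as), as = List.ofFn a → HEq t (ofFn g h) →
      HEq (t.mapHom m) (ofFn (fun i => m (g i)) h) := by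
    induction n generalizing Γ with
    | zero =>
      intro as t has _
      obtain rfl : as = [] := by simpa using has
      cases t
      exact (ofFn_zero _ _).symm
    | succ n ih =>
      intro as t has ht
      obtain rfl := has.trans (List.ofFn_succ ..)
      obtain rfl := eq_of_heq (ht.trans (ofFn_succ g h))
      exact (cons_heq rfl rfl (ih _ rfl _ _ rfl HEq.rfl)).trans
        (ofFn_succ (H := H') (fun i => m (g i)) h).symm
  exact eq_of_heq (key _ _ rfl HEq.rfl)

end Tuple

section Subst

variable {A : AutSignature.{u, v}}

theorem Raw.shift_shift (s : Raw A) (k l : ℕ) : (s.shift k).shift l = s.shift (k + l) := by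
  simp only [shift, rename_rename]
  congr 1
  funext i
  simp [Nat.add_assoc]

theorem Tuple.toSubst_append {Γ Δ as bs : List A.Node} (t : Tuple (Term A) Γ as)
    (t' : Tuple (Term A) Δ bs) (i : ℕ) : (t.append t').toSubst i =
      if i < as.length then t.toSubst i else (t'.toSubst (i - as.length)).shift Γ.length := by
  induction t generalizing i with
  | nil => simp [append, shift_zero]
  | @cons γ δ Γ a as g gs h ih =>
    subst h
    cases i with
    | zero => simp [append, toSubst]
    | succ i =>
      simp only [append, toSubst, ih, List.length_cons, Nat.add_lt_add_iff_right,
        Nat.add_sub_add_right, List.length_append]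
      split_ifs
      · rfl
      · rw [Raw.shift_shift, Nat.add_comm]

/-- The `i`-th term is moved past the contexts of the terms before it. -/
theorem Tuple.toSubst_ofFn {n : ℕ} {γ : Fin n → List A.Node} {a : Fin n → A.Node}
    {Γ : List A.Node} (g : ∀ i, Term A (γ i) (a i)) (h : Γ = (List.ofFn γ).flatten) (i : Fin n) :
    (ofFn g h).toSubst i =
      (g i).1.shift (∑ j : Fin (i : ℕ), (γ (j.castLE i.2.le)).length) := by
  have key : ∀ (as : List A.Node) (t : Tuple (Term A) Γ as), as = List.ofFn a →
      HEq t (ofFn g h) → t.toSubst i =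
        (g i).1.shift (∑ j : Fin (i : ℕ), (γ (j.castLE i.2.le)).length) := by
    induction n generalizing Γ with
    | zero => exact i.elim0
    | succ n ih =>
      intro as t has ht
      obtain rfl := has.trans (List.ofFn_succ ..)
      obtain rfl := eq_of_heq (ht.trans (ofFn_succ g h))
      induction i using Fin.cases with
      | zero =>
        exact (shift_zero _).symm.trans
          (congrArg (fun k => Raw.shift k _) (Fin.sum_univ_zero _).symm)
      | succ i =>
        have := ih (fun i : Fin n => g i.succ) rfl i _ _ rfl HEq.rfl
        simp only [Fin.val_succ, toSubst, this, Raw.shift_shift]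
        congr 1
        rw [Fin.sum_univ_succ, Nat.add_comm]
        rfl
  exact key _ _ rfl HEq.rfl

/-! #### Typing and conversion of substitutions -/

theorem zip_flatten_ofFn {α β : Type*} {n : ℕ} {k : Fin n → ℕ} (z : ∀ i, Fin (k i) → α)
    (c : ∀ i, Fin (k i) → β) : (List.ofFn fun i => List.ofFn (z i)).flatten.zip
      (List.ofFn fun i => List.ofFn (c i)).flatten =
      (List.ofFn fun i => (List.ofFn (z i)).zip (List.ofFn (c i))).flatten := by
  simp only [zip_ofFn, ← ofFn_blockConcat]
  rfl

theorem merge_flatten {k : ℕ} {γ : Fin k → TyCtx A}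
    (hn : ((List.ofFn γ).flatten.map Prod.fst).Nodup) : Merge γ (List.ofFn γ).flatten := by
  refine ⟨?_, .of_sublist (fun i => List.sublist_flatten_of_mem (by simp)) (.refl _) hn.of_map⟩
  rw [List.map_flatten, List.nodup_flatten, List.pairwise_map, List.pairwise_ofFn] at hn
  intro i j hij
  rcases lt_or_gt_of_ne hij with h | h
  · exact hn.2 h
  · exact (hn.2 h).symm

theorem Raw.tup_congr {k l : ℕ} {ss : Fin k → Raw A} {ts : Fin l → Raw A}
    (h : List.ofFn ss = List.ofFn ts) : Raw.tup ss = .tup ts := by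
  obtain rfl : k = l := by simpa using congrArg List.length h
  rw [List.ofFn_injective h]

/-- The components of convertible tuples of typed terms. -/
def ConvRel (xs : List ℕ) (p : Raw A × Raw A) (Γ : List A.Node) (b : A.Node) (_ : Term A Γ b) :
    Prop :=
  xs.length = Γ.length ∧ Typed (xs.zip Γ) p.1 b ∧ Conv (xs.zip Γ) b p.1 p.2

theorem TRel.conv_tup {xs : List ℕ} {Γ as : List A.Node} {gs : Tuple (Term A) Γ as} {k : ℕ}
    {ss ts : Fin k → Raw A}
    (h : TRel ConvRel xs (List.ofFn fun i => (ss i, ts i)) Γ as gs) (hn : xs.Nodup) :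
    Typed (xs.zip Γ) (.tup ss) (.tensor as) ∧
      Conv (xs.zip Γ) (.tensor as) (.tup ss) (.tup ts) := by
  have hl := h.names_length fun _ _ _ _ _ h => h.1
  obtain ⟨n, B, rfl, rfl, e, rfl, -, hB⟩ := h.exists_blocks fun _ _ _ _ _ h => h.1
  obtain rfl : k = n := by simpa using congrArg List.length e
  have e' := fun i => congrFun (List.ofFn_injective e) i
  rw [← map_fst_zip hl] at hn
  rw [zip_flatten_ofFn] at hn ⊢
  have h₁ : ∀ i, Typed ((List.ofFn (B i).z).zip (List.ofFn (B i).c)) (ss i) (B i).a := fun i => by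
    have := (hB i).2.1
    rwa [← e'] at this
  have h₂ : ∀ i, Conv ((List.ofFn (B i).z).zip (List.ofFn (B i).c)) (B i).a (ss i) (ts i) :=
    fun i => by
      have := (hB i).2.2
      rwa [← e'] at this
  exact ⟨.tup h₁ (merge_flatten hn), .tup h₁ h₂ (merge_flatten hn)⟩

theorem Tuple.convRel {r : ∀ {as : List A.Node} {b : A.Node}, Term A as b → Term A as b}
    (hr : ∀ {as : List A.Node} {b : A.Node} (s : Term A as b), Conv (enumCtx as) b s.1 (r s).1)
    {Γ as : List A.Node} (ts : Tuple (Term A) Γ as) (k : ℕ) :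
    TRel ConvRel ((List.range Γ.length).map (· + k)) (List.ofFn fun i : Fin as.length =>
      ((ts.toSubst i).shift k, ((ts.mapHom r).toSubst i).shift k)) Γ as ts := by
  induction ts generalizing k with
  | nil => exact .nil
  | @cons γ δ Γ a as g gs h ih =>
    subst h
    have := ih (k + γ.length)
    simp only [List.length_cons, List.ofFn_succ, toSubst, mapHom, Raw.shift_shift,
      List.length_append, List.range_add, List.map_append, List.map_map, Fin.val_succ,
      Fin.val_zero]
    refine .cons rfl ?_ ?_
    · have hn := (List.nodup_range (n := γ.length)).map (add_injective k)
      exact ⟨by simp, g.2.rename hn rfl, (hr g).rename g.2 hn rfl⟩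
    · convert this using 3
      · simp only [Function.comp]; omega
      · rw [Nat.add_comm]

theorem Tuple.typed_toSubst {Γ as : List A.Node} (ts : Tuple (Term A) Γ as) :
    Typed (enumCtx Γ) (.tup fun i : Fin as.length => ts.toSubst i) (.tensor as) := by
  have := (ts.convRel (r := fun s => s) (fun _ => .refl _) 0).conv_tup
    (List.nodup_range.map (add_injective 0))
  simpa [shift_zero, zip_range] using this.1

theorem Tuple.conv_toSubst {r : ∀ {as : List A.Node} {b : A.Node}, Term A as b → Term A as b}
    (hr : ∀ {as : List A.Node} {b : A.Node} (s : Term A as b), Conv (enumCtx as) b s.1 (r s).1)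
    {Γ as : List A.Node} (ts : Tuple (Term A) Γ as) :
    Conv (enumCtx Γ) (.tensor as) (.tup fun i : Fin as.length => ts.toSubst i)
      (.tup fun i : Fin as.length => (ts.mapHom r).toSubst i) := by
  have := (ts.convRel hr 0).conv_tup (List.nodup_range.map (add_injective 0))
  simpa [shift_zero, zip_range] using this.2

end Subst

section TermMulticategory

variable {A : AutSignature.{u, v}}

/-! #### Terms form a symmetric multicategory -/

namespace Term

/-- The variable, as a term in the context of one variable. -/
def id (a : A.Node) : Term A [a] a := ⟨.var 0, .var 0 a⟩

/-- Substitution in a term. -/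
def comp {Γ as : List A.Node} {b : A.Node} (s : Term A as b) (ts : Tuple (Term A) Γ as) :
    Term A Γ b := ⟨s.1.subst ts.toSubst, s.2.subst ts.typed_toSubst⟩

theorem toSubst_ids (as : List A.Node) (x : ℕ) : (Tuple.ids id as).toSubst x = .var x := by
  induction as generalizing x with
  | nil => rfl
  | cons a as ih =>
    cases x with
    | zero => rfl
    | succ x =>
      simp only [Tuple.ids, Tuple.toSubst, ih, Raw.shift, Raw.rename, List.length_singleton]

theorem comp_id {as : List A.Node} {b : A.Node} (s : Term A as b) : comp s (Tuple.ids id as) = s :=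
  Subtype.ext (s.1.subst_eq_self (toSubst_ids as))

theorem toSubst_comp {Γ Δ as : List A.Node} (ts : Tuple (Term A) Γ as) (rs : Tuple (Term A) Δ Γ)
    (i : ℕ) : (ts.comp comp rs).toSubst i = (ts.toSubst i).subst rs.toSubst := by
  induction ts generalizing Δ i with
  | nil => rfl
  | @cons γ δ Γ a as g gs h ih =>
    subst h
    obtain ⟨Δ₁, Δ₂, rfl, t₁, t₂, rfl⟩ := Tuple.exists_eq_append γ δ rs
    rw [Tuple.comp_cons]
    cases i with
    | zero => exact g.2.subst_congr fun x hx => by rw [Tuple.toSubst_append, if_pos hx]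
    | succ i =>
      simp only [Tuple.toSubst, ih, Raw.shift, Raw.rename_subst, Raw.subst_rename]
      congr 1
      funext x
      simp [Tuple.toSubst_append, Raw.shift]

theorem comp_assoc {Δ Γ as : List A.Node} {b : A.Node} (s : Term A as b) (ts : Tuple (Term A) Γ as)
    (rs : Tuple (Term A) Δ Γ) : comp (comp s ts) rs = comp s (ts.comp comp rs) := by
  refine Subtype.ext ?_
  simp only [comp, Raw.subst_subst]
  congr 1
  funext i
  exact (toSubst_comp ts rs i).symm

theorem permRen_lt {m n : ℕ} (e : Fin m ≃ Fin n) (i : Fin n) : permRen e i = e.symm i := by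
  simp [permRen]

theorem map_permRen {m n : ℕ} (e : Fin m ≃ Fin n) :
    (List.range n).map (permRen e) = List.ofFn fun i => (e.symm i : ℕ) := by
  apply List.ext_get
  · simp
  · intro i h₁ h₂
    have hi : i < n := by simpa using h₁
    simp [permRen, hi]

theorem nodup_map_permRen {m n : ℕ} (e : Fin m ≃ Fin n) :
    ((List.range n).map (permRen e)).Nodup := by
  rw [map_permRen, List.nodup_ofFn]
  exact Fin.val_injective.comp e.symm.injective

theorem perm_enumCtx {m n : ℕ} (e : Fin m ≃ Fin n) (a : Fin n → A.Node) :
    (((List.range n).map (permRen e)).zip (List.ofFn a)).Perm (enumCtx (List.ofFn (a ∘ e))) := by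
  have : enumCtx (List.ofFn (a ∘ e)) =
      List.ofFn ((fun i => ((e.symm i : ℕ), a i)) ∘ e) := by
    rw [enumCtx_eq_ofFn]
    apply List.ext_get <;> simp
  rw [map_permRen, zip_ofFn, this]
  exact (ofFn_comp_equiv_perm e _).symm

/-- Permutation of the variables of the context. -/
def act {m n : ℕ} (e : Fin m ≃ Fin n) {a : Fin n → A.Node} {b : A.Node} {Γ Δ : List A.Node}
    (hΓ : Γ = List.ofFn a) (hΔ : Δ = List.ofFn (a ∘ e)) (s : Term A Γ b) : Term A Δ b :=
  ⟨s.1.rename (permRen e), by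
    subst hΓ hΔ
    refine (s.2.rename (nodup_map_permRen e) ?_).perm (perm_enumCtx e a)
    rw [List.length_ofFn]⟩

theorem conv_act {m n : ℕ} (e : Fin m ≃ Fin n) {a : Fin n → A.Node} {b : A.Node}
    {Γ Δ : List A.Node} (hΓ : Γ = List.ofFn a) (hΔ : Δ = List.ofFn (a ∘ e)) {s t : Term A Γ b}
    (h : Conv (enumCtx Γ) b s.1 t.1) : Conv (enumCtx Δ) b (act e hΓ hΔ s).1 (act e hΓ hΔ t).1 := by
  subst hΓ hΔ
  refine (h.rename s.2 (nodup_map_permRen e) ?_).perm (perm_enumCtx e a)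
  rw [List.length_ofFn]

theorem act_refl {n : ℕ} {a : Fin n → A.Node} {b : A.Node} {Γ : List A.Node} (hΓ : Γ = List.ofFn a)
    (s : Term A Γ b) : act (Equiv.refl _) hΓ hΓ s = s := by
  refine Subtype.ext ?_
  simp only [act]
  rw [show permRen (Equiv.refl (Fin n)) = _root_.id by funext x; simp [permRen], Raw.rename_id]

theorem act_trans {l m n : ℕ} (e' : Fin l ≃ Fin m) (e : Fin m ≃ Fin n) {a : Fin n → A.Node}
    {b : A.Node} {Γ Δ Θ : List A.Node} (hΓ : Γ = List.ofFn a) (hΔ : Δ = List.ofFn (a ∘ e))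
    (hΘ : Θ = List.ofFn ((a ∘ e) ∘ e')) (s : Term A Γ b) :
    act e' hΔ hΘ (act e hΓ hΔ s) = act (e'.trans e) hΓ hΘ s := by
  refine Subtype.ext ?_
  simp only [act, Raw.rename_rename]
  congr 1
  funext x
  obtain rfl : m = n := by simpa using Fintype.card_congr e
  by_cases h : x < m <;> simp [permRen, h]

theorem comp_act {n : ℕ} {a : Fin n → A.Node} {b : A.Node} {k : Fin n → ℕ}
    {c : ∀ i, Fin (k i) → A.Node} (σ : Equiv.Perm (Fin n)) (π : ∀ i, Equiv.Perm (Fin (k i)))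
    (s : Term A (List.ofFn a) b) (t : ∀ i, Term A (List.ofFn (c i)) (a i)) :
    comp (act σ rfl rfl s) (Tuple.ofFn (a := a ∘ σ) (fun i => act (π (σ i)) rfl rfl (t (σ i)))
      (ofFn_blockConcat_perm c σ π)) =
      act (blockPerm σ π) rfl rfl (comp s (Tuple.ofFn t (ofFn_blockConcat c))) := by
  refine Subtype.ext ?_
  simp only [comp, act, Raw.rename_subst, Raw.subst_rename]
  refine s.2.subst_congr fun x hx => ?_
  rw [List.length_ofFn] at hx
  obtain ⟨i, hi⟩ := σ.surjective ⟨x, hx⟩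
  obtain rfl : x = (σ i : ℕ) := by rw [hi]
  have h₁ := Tuple.toSubst_ofFn (a := a ∘ σ) (fun i => act (π (σ i)) rfl rfl (t (σ i)))
    (ofFn_blockConcat_perm c σ π) i
  rw [Function.comp, permRen_lt, Equiv.symm_apply_apply]
  refine h₁.trans ?_
  rw [Tuple.toSubst_ofFn]
  show Raw.shift _ ((t (σ i)).1.rename (permRen (π (σ i)))) = _
  simp only [Raw.shift, Raw.rename_rename]
  refine Raw.rename_congr _ fun y hy => ?_
  have hy' := (t (σ i)).2.lt_of_occ hy
  rw [List.length_ofFn] at hy'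
  have e₁ : y + ∑ j : Fin (σ i : ℕ), (List.ofFn (c (j.castLE (σ i).2.le))).length =
      (finSigmaFinEquiv (n := k) ⟨σ i, ⟨y, hy'⟩⟩ : ℕ) := by
    rw [finSigmaFinEquiv_apply, Nat.add_comm]
    simp
  have e₂ : permRen (π (σ i)) y = ((π (σ i)).symm ⟨y, hy'⟩ : ℕ) := permRen_lt _ ⟨y, hy'⟩
  rw [Function.comp, Function.comp, e₁, e₂, permRen_lt]
  have e₃ : (blockPerm σ π).symm (finSigmaFinEquiv ⟨σ i, ⟨y, hy'⟩⟩) =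
      finSigmaFinEquiv (n := fun i => k (σ i)) ⟨i, (π (σ i)).symm ⟨y, hy'⟩⟩ := by
    rw [Equiv.symm_apply_eq]
    simp [blockPerm]
  rw [e₃, finSigmaFinEquiv_apply, Nat.add_comm]
  simp

end Term

/-! #### The quotient by conversion -/

namespace FreeHom

theorem mk_surjective {as : List A.Node} {b : A.Node} (q : FreeHom A as b) :
    ∃ s : Term A as b, FreeHom.mk s = q := Quotient.exists_rep q

/-- A representative of a class of terms. -/
noncomputable def out {as : List A.Node} {b : A.Node} (q : FreeHom A as b) : Term A as b :=
  (mk_surjective q).choose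

theorem mk_out {as : List A.Node} {b : A.Node} (q : FreeHom A as b) : FreeHom.mk q.out = q :=
  (mk_surjective q).choose_spec

theorem conv_out {as : List A.Node} {b : A.Node} (s : Term A as b) :
    Conv (enumCtx as) b s.1 (FreeHom.mk s).out.1 := mk_eq_mk.1 (mk_out _).symm

theorem exists_mapHom {Γ as : List A.Node} (gs : Tuple (FreeHom A) Γ as) :
    ∃ ts : Tuple (Term A) Γ as, ts.mapHom mk = gs :=
  ⟨gs.mapHom out, by rw [Tuple.mapHom_mapHom, Tuple.mapHom_eq_self mk_out]⟩

/-- Composition of classes of terms. -/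
noncomputable def comp {Γ as : List A.Node} {b : A.Node} (f : FreeHom A as b)
    (gs : Tuple (FreeHom A) Γ as) : FreeHom A Γ b := mk (f.out.comp (gs.mapHom out))

theorem comp_mk {Γ as : List A.Node} {b : A.Node} (s : Term A as b) (ts : Tuple (Term A) Γ as) :
    comp (mk s) (ts.mapHom mk) = mk (s.comp ts) := by
  rw [comp, Tuple.mapHom_mapHom, mk_eq_mk]
  exact ((conv_out s).subst s.2 (ts.conv_toSubst conv_out) ts.typed_toSubst).symm

/-- The symmetric action on classes of terms. -/
def act {m n : ℕ} (e : Fin m ≃ Fin n) {a : Fin n → A.Node} {b : A.Node} {Γ Δ : List A.Node}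
    (hΓ : Γ = List.ofFn a) (hΔ : Δ = List.ofFn (a ∘ e)) : FreeHom A Γ b → FreeHom A Δ b :=
  Quotient.map (Term.act e hΓ hΔ) fun _ _ h =>
    conv_iff_sim.1 (Term.conv_act e hΓ hΔ (conv_iff_sim.2 h))

end FreeHom

/-- The multicategory of classes of terms. -/
noncomputable def freeMulticategory (A : AutSignature.{u, v}) :
    Multicategory A.Node (FreeHom A) where
  id a := .mk (.id a)
  comp := FreeHom.comp
  id_comp f := by
    obtain ⟨s, rfl⟩ := f.mk_surjective
    exact FreeHom.comp_mk (Term.id _) (.cons s .nil (List.append_nil _).symm)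
  comp_id f := by
    obtain ⟨s, rfl⟩ := f.mk_surjective
    have := FreeHom.comp_mk s (Tuple.ids Term.id _)
    rwa [Tuple.mapHom_ids, Term.comp_id] at this
  assoc f gs hs := by
    obtain ⟨s, rfl⟩ := f.mk_surjective
    obtain ⟨ts, rfl⟩ := FreeHom.exists_mapHom gs
    obtain ⟨rs, rfl⟩ := FreeHom.exists_mapHom hs
    rw [FreeHom.comp_mk, FreeHom.comp_mk, Term.comp_assoc, ← FreeHom.comp_mk,
      Tuple.mapHom_comp (H' := FreeHom A) FreeHom.mk fun f t => (FreeHom.comp_mk f t).symm]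

/-- The symmetric structure of the multicategory of classes of terms. -/
noncomputable def freeSymm (A : AutSignature.{u, v}) :
    SymmetricStructure (freeMulticategory A) where
  act := FreeHom.act
  act_refl hΓ f := by
    obtain ⟨s, rfl⟩ := f.mk_surjective
    exact congrArg FreeHom.mk (Term.act_refl hΓ s)
  act_trans e' e _ _ _ _ _ hΓ hΔ hΘ f := by
    obtain ⟨s, rfl⟩ := f.mk_surjective
    exact congrArg FreeHom.mk (Term.act_trans e' e hΓ hΔ hΘ s)
  comp_act {n a b k c} σ π f g := by
    obtain ⟨s, rfl⟩ := f.mk_surjective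
    choose t ht using fun i => (g i).mk_surjective
    obtain rfl : (fun i => FreeHom.mk (t i)) = g := funext ht
    have h₁ := Tuple.mapHom_ofFn (H' := FreeHom A) FreeHom.mk t (ofFn_blockConcat c)
    have h₂ := Tuple.mapHom_ofFn (H' := FreeHom A) (a := a ∘ σ) FreeHom.mk
      (fun i => (t (σ i)).act (π (σ i)) rfl rfl) (ofFn_blockConcat_perm c σ π)
    rw [← h₁]
    refine (congrArg _ h₂.symm).trans ?_
    have h₃ := FreeHom.comp_mk s (Tuple.ofFn t (ofFn_blockConcat c))
    have h₄ := FreeHom.comp_mk (s.act σ rfl rfl) (Tuple.ofFn (a := a ∘ σ)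
      (fun i => (t (σ i)).act (π (σ i)) rfl rfl) (ofFn_blockConcat_perm c σ π))
    refine h₄.trans ?_
    rw [Term.comp_act]
    exact (congrArg (FreeHom.act (blockPerm σ π) rfl rfl) h₃).symm

end TermMulticategory

section FreeAut

variable {A : AutSignature.{u, v}}

/-! #### Tensor products of types -/

/-- The renaming, for the context `γ, x₁, …, xₖ, δ` with `γ` of length `g`, that takes the variables
`x₁, …, xₖ` to a new innermost scope, and makes place for one variable between `γ` and `δ`. -/
def focus (g k j : ℕ) : ℕ := if j < g then j + k else if j < g + k then j - g else j + 1

theorem map_focus (g k d : ℕ) : (List.range (g + (k + d))).map (focus g k) =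
    (List.range g).map (· + k) ++ List.range k ++ (List.range d).map (· + (g + 1) + k) := by
  rw [List.range_add, List.range_add, List.map_append, List.map_map, List.map_append,
    List.append_assoc]
  have h₁ : (List.range g).map (focus g k) = (List.range g).map (· + k) :=
    List.map_congr_left fun x hx => by simp [focus, List.mem_range.1 hx]
  have h₂ : (List.range k).map (focus g k ∘ (g + ·)) = List.range k := by
    conv_rhs => rw [← List.map_id (List.range k)]
    exact List.map_congr_left fun x hx => by simp [focus, List.mem_range.1 hx]
  have h₃ : (List.range d).map ((focus g k ∘ fun x => g + x) ∘ (k + ·)) =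
      (List.range d).map (· + (g + 1) + k) :=
    List.map_congr_left fun x _ => by
      simp only [focus, Function.comp]
      split_ifs <;> omega
  rw [List.map_map]
  rw [h₁, h₂, h₃]

theorem nodup_map_focus (g k d : ℕ) : ((List.range (g + (k + d))).map (focus g k)).Nodup := by
  refine List.nodup_range.map fun i j h => ?_
  simp only [focus] at h
  split_ifs at h <;> omega

/-- The part `δ` of the context `γ, x, δ`. -/
def tailCtx (g : ℕ) (δ : List A.Node) : TyCtx A := ((List.range δ.length).map (· + (g + 1))).zip δ

theorem enumCtx_append_cons (γ δ : List A.Node) (a : A.Node) :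
    enumCtx (γ ++ a :: δ) = enumCtx γ ++ ((γ.length, a) :: tailCtx γ.length δ) := by
  rw [← zip_range, List.length_append, List.length_cons, List.range_add, List.zip_append (by simp),
    zip_range, List.range_succ_eq_map, List.map_cons, List.zip_cons_cons, List.map_map, tailCtx]
  congr 4
  funext x
  simp only [Function.comp]
  omega

theorem zip_map_focus (γ as δ : List A.Node) :
    ((List.range (γ ++ (as ++ δ)).length).map (focus γ.length as.length)).zip (γ ++ (as ++ δ)) =
      (enumCtx γ).shift as.length ++ enumCtx as ++ (tailCtx γ.length δ).shift as.length := by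
  rw [List.length_append, List.length_append, map_focus, List.append_assoc,
    List.zip_append (by simp), List.zip_append (by simp), zip_shift, zip_range, zip_range,
    tailCtx, ← zip_shift, List.map_map, List.append_assoc]
  rfl

theorem merge_focus (γ δ : List A.Node) (a : A.Node) :
    Merge ![[(γ.length, a)], enumCtx γ, tailCtx γ.length δ] (enumCtx (γ ++ a :: δ)) := by
  have hn : ((enumCtx (γ ++ a :: δ)).map Prod.fst).Nodup := by
    rw [enumCtx_names]; exact List.nodup_range
  rw [enumCtx_append_cons] at hn ⊢
  rw [List.map_append, List.map_cons, List.nodup_append, List.nodup_cons] at hn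
  refine ⟨?_, .of_sublist ?_ ?_ ?_⟩
  · obtain ⟨-, ⟨h₁, -⟩, h₂⟩ := hn
    have h₃ : γ.length ∉ (enumCtx γ).map Prod.fst := fun h => h₂ _ h _ (by simp) rfl
    have h₄ : List.Disjoint ((enumCtx γ).map Prod.fst) ((tailCtx γ.length δ).map Prod.fst) :=
      fun x hx hx' => h₂ x hx x (List.mem_cons_of_mem _ hx') rfl
    intro i j hij
    fin_cases i <;> fin_cases j <;> first | exact (hij rfl).elim | skip
    · simpa using h₃
    · simpa using h₁
    · simpa using h₃
    · exact h₄
    · simpa using h₁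
    · exact h₄.symm
  · intro i
    fin_cases i
    · simp
    · simp
    · exact (List.sublist_cons_self _ _).trans (List.sublist_append_right _ _)
  · simp only [List.ofFn_succ, List.ofFn_zero]
    simpa using List.perm_middle.symm
  · rw [← enumCtx_append_cons]
    refine List.Nodup.of_map Prod.fst ?_
    rw [enumCtx_names]; exact List.nodup_range

/-- The substitution in `s[⟨x⃗⟩ / x][x⃗ := x]`, for a variable `x` at the place `g`. -/
def expandSub (g k i : ℕ) : Raw A := if i = g then .varTup k else .var (i + k)

/-- A term `s` with a variable `x : (a₁ ⊗ … ⊗ aₖ)` is equivalent to `s{⟨x⃗⟩ / x}[x⃗ := x]`: this is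
an instance of `η₁` for `x`, but in a term in which `s` is applied to the variables of its context.
-/
theorem Conv.expand {γ as δ : List A.Node} {b : A.Node} {s : Raw A}
    (hs : Typed (enumCtx (γ ++ .tensor as :: δ)) s b) :
    Conv (enumCtx (γ ++ .tensor as :: δ)) b s
      (.sub as (s.subst (expandSub γ.length as.length)) (.var γ.length)) := by
  -- In `(λy⃗. s) ⟨y⃗⟩`, the entry `x` of `⟨y⃗⟩` is expanded to `⟨x⃗⟩[x⃗ := x]`, and the substitution
  -- is moved out of the application, which then reduces by `β`.
  set cs := γ ++ .tensor as :: δ with hcs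
  have hg : γ.length < cs.length := by simp [hcs]
  have hv : Typed (enumCtx cs) (.tup fun i : Fin cs.length => .var i) (.tensor cs) := by
    have := Typed.tup (fun i : Fin cs.length => Typed.var (i : ℕ) (cs.get i)) (merge_vars cs)
    rwa [List.ofFn_get] at this
  have h₁ := (Conv.redex (σ := .var) hs hv).symm
  rw [Raw.subst_var] at h₁
  have hc : cs.get ⟨γ.length, hg⟩ = .tensor as := by simp [hcs]
  have h₂ := Conv.tup_update (fun i : Fin cs.length => Typed.var (i : ℕ) (cs.get i))
    (i := ⟨γ.length, hg⟩) (s := .var γ.length)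
    (t := .sub as (.varTup as.length) (.var γ.length)) (by
      simp only [hc]
      exact Conv.eta₁ (.var _ _)) (merge_vars cs)
  rw [List.ofFn_get, show Function.update (fun i : Fin cs.length => Raw.var (A := A) i)
    ⟨γ.length, hg⟩ (.var γ.length) = fun i => .var i from Function.update_eq_self _ _] at h₂
  have h₃ := Conv.appR (.lam (γ := []) hs) h₂ (merge_nil_left hv.nodup)
  have h₄ := h₁.trans h₃
  have h₅ := StrEq.root (.appR (.lam cs s) (.tup (fun i : Fin cs.length => .var i)
    ⟨γ.length, hg⟩ .hole)) as (.varTup as.length) (.var γ.length)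
  simp only [Cx.plug, Cx.depth, shift_zero, exchange_zero, Raw.rename_id, Cx.shift,
    Cx.rename] at h₅
  have h₆ := h₄.trans (.of_strEq (h₄.typed_iff.1 hs) h₅)
  refine h₆.trans ?_
  have h₇ := Conv.of_beta (.subL as .hole (.var γ.length)) (h₆.typed_iff.1 hs)
    (.beta₂ cs _ .hole _ trivial)
  simp only [Cx.plug, Cx.depth, shift_zero] at h₇
  rw [Raw.subst_rename, hs.subst_congr (τ := expandSub γ.length as.length)] at h₇
  · exact h₇
  · intro x hx
    simp only [Function.comp, upRen, if_pos hx, instSub, dif_pos hx, expandSub]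
    by_cases h : x = γ.length
    · subst h
      simp
    · rw [if_neg h, Function.update_of_ne (by simpa [Fin.ext_iff] using h)]
      rfl

namespace Term

/-- The list term of the variables. -/
def re (as : List A.Node) : Term A as (.tensor as) :=
  ⟨.varTup as.length, by
    have := typed_vars (as := as) (xs := List.range as.length) (ρ := fun x => x) (by simp)
      List.nodup_range (List.map_id _)
    rwa [zip_range] at this⟩

/-- The application of a variable to the list of the other ones. -/
def ev (as : List A.Node) (b : A.Node) : Term A (.lolli as b :: as) b :=
  ⟨.app (.var 0) ((Raw.varTup as.length).shift 1), by
    have h := typed_vars (as := as) (xs := (List.range as.length).map (· + 1)) (by simp)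
      (List.nodup_range.map (add_left_injective 1)) rfl
    refine .app (.var 0 _) h ?_
    have hm := merge_flatten (γ := ![[((0 : ℕ), Ty.lolli as b)],
      ((List.range as.length).map (· + 1)).zip as]) (by
        rw [List.map_flatten]
        simpa [List.ofFn_succ, List.map_fst_zip] using
          List.nodup_range.map (add_left_injective 1))
    have := enumCtx_append_cons [] as (Ty.lolli as b)
    rw [List.nil_append] at this
    rw [this]
    simpa [List.ofFn_succ, tailCtx, enumCtx] using hm⟩

/-- The tuple `⟨id, re, id⟩`. -/
def reTuple (γ as δ : List A.Node) : Tuple (Term A) (γ ++ (as ++ δ)) (γ ++ .tensor as :: δ) :=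
  (Tuple.ids id γ).append (.cons (re as) (Tuple.ids id δ) rfl)

theorem toSubst_reTuple (γ as δ : List A.Node) (i : ℕ) : (reTuple γ as δ).toSubst i =
    if i < γ.length then .var i else if i = γ.length then (Raw.varTup as.length).shift γ.length
      else .var (i - 1 + as.length) := by
  rw [reTuple, Tuple.toSubst_append]
  split_ifs with h₁ h₂
  · exact toSubst_ids _ _
  · subst h₂
    rw [Nat.sub_self]
    rfl
  · obtain ⟨j, rfl⟩ : ∃ j, i = γ.length + (j + 1) := ⟨i - γ.length - 1, by omega⟩
    rw [Nat.add_sub_cancel_left, Tuple.toSubst, toSubst_ids]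
    simp only [Raw.shift, Raw.rename]
    congr 1
    omega

/-- Precomposition with `re` is injective on classes: `s` can be recovered from `s{⟨x⃗⟩ / x}`, as it
is equivalent to `s{⟨x⃗⟩ / x}[x⃗ := x]`. -/
theorem conv_of_comp_reTuple {γ as δ : List A.Node} {b : A.Node}
    {s s' : Term A (γ ++ .tensor as :: δ) b}
    (h : Conv (enumCtx (γ ++ (as ++ δ))) b (s.comp (reTuple γ as δ)).1
      (s'.comp (reTuple γ as δ)).1) : Conv (enumCtx (γ ++ .tensor as :: δ)) b s.1 s'.1 := by
  have key : ∀ r : Raw A, (r.subst (reTuple γ as δ).toSubst).rename (focus γ.length as.length) =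
      r.subst (expandSub γ.length as.length) := by
    intro r
    rw [Raw.rename_subst]
    congr 1
    funext i
    rw [toSubst_reTuple, expandSub]
    split_ifs with h₁ h₂ h₂
    · omega
    · simp [Raw.rename, focus, h₁]
    · subst h₂
      simp only [Raw.varTup, Raw.shift, Raw.rename]
      congr 1
      funext j
      have := j.2
      rw [focus, if_neg (by omega), if_pos (by omega), Nat.add_sub_cancel]
    · simp only [Raw.rename, focus]
      congr 1
      split_ifs <;> omega
  have h' := h.rename (s.comp (reTuple γ as δ)).2 (ρ := focus γ.length as.length)
    (by rw [List.length_append, List.length_append]; exact nodup_map_focus _ _ _) rfl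
  rw [zip_map_focus] at h'
  simp only [comp, key] at h'
  exact (Conv.expand s.2).trans ((Conv.subL (.var _ _) h' (merge_focus γ δ (.tensor as))).trans
    (Conv.expand s'.2).symm)

/-- The term `s[x⃗ := x]`, for `s` with variables `x⃗`. -/
def letVar (γ as δ : List A.Node) {b : A.Node} (s : Term A (γ ++ (as ++ δ)) b) :
    Term A (γ ++ .tensor as :: δ) b :=
  ⟨.sub as (s.1.rename (focus γ.length as.length)) (.var γ.length), by
    refine .sub (.var _ _) ?_ (merge_focus γ δ (.tensor as))
    rw [← zip_map_focus]
    refine s.2.rename ?_ rfl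
    rw [List.length_append, List.length_append]
    exact nodup_map_focus _ _ _⟩

/-- Precomposition with `re` is surjective on classes, by `β`. -/
theorem conv_letVar_comp_reTuple {γ as δ : List A.Node} {b : A.Node}
    (s : Term A (γ ++ (as ++ δ)) b) :
    Conv (enumCtx (γ ++ (as ++ δ))) b ((letVar γ as δ s).comp (reTuple γ as δ)).1 s.1 := by
  have hT := ((letVar γ as δ s).comp (reTuple γ as δ)).2
  have e : ((letVar γ as δ s).comp (reTuple γ as δ)).1 =
      .sub as ((s.1.rename (focus γ.length as.length)).subst
        (Raw.upSub as.length (reTuple γ as δ).toSubst))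
        (.tup fun i : Fin as.length => .var (i + γ.length)) := by
    show Raw.sub as _ ((reTuple γ as δ).toSubst γ.length) = _
    rw [toSubst_reTuple, if_neg (lt_irrefl _), if_pos rfl]
    rfl
  rw [e] at hT ⊢
  have h := Conv.of_beta .hole hT (.beta₁ as _ .hole _ trivial)
  simp only [Cx.plug, Cx.depth] at h
  rw [show upRen as.length (· + 0) = _root_.id by funext i; simp [upRen]; omega, Raw.rename_id] at h
  have e' : ((s.1.rename (focus γ.length as.length)).subst
      (Raw.upSub as.length (reTuple γ as δ).toSubst)).subst
      (instSub fun i : Fin as.length => .var (i + γ.length)) = s.1 := by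
    rw [Raw.subst_rename, Raw.subst_subst]
    refine Raw.subst_eq_self _ fun x => ?_
    simp only [Function.comp, focus, Raw.upSub, toSubst_reTuple]
    split_ifs <;> first | omega | skip
    · simp only [Raw.shift, Raw.rename, Raw.subst, instSub]
      rw [dif_neg (by omega)]
      congr 1
      omega
    · simp only [Raw.subst, instSub]
      rw [dif_pos (by omega)]
      congr 1
      omega
    · simp only [Raw.shift, Raw.rename, Raw.subst, instSub]
      rw [dif_neg (by omega)]
      congr 1
      omega
  rwa [e'] at h

/-! #### Internal homs of types -/

theorem comp_ev {γ as : List A.Node} {b : A.Node} (s : Term A γ (.lolli as b)) :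
    ((ev as b).comp (.cons s (Tuple.ids id as) rfl)).1 =
      .app s.1 (.tup fun i : Fin as.length => .var (i + γ.length)) := by
  show Raw.app _ (Raw.subst _ (Raw.shift 1 _)) = _
  simp only [Raw.varTup, Raw.shift, Raw.rename, Raw.subst, Tuple.toSubst, toSubst_ids]

theorem map_exchange (g k : ℕ) : (List.range (g + k)).map (exchange g k) =
    (List.range g).map (· + k) ++ List.range k := by
  rw [List.range_add, List.map_append, List.map_map]
  have h₁ : (List.range g).map (exchange g k) = (List.range g).map (· + k) :=
    List.map_congr_left fun x hx => by simp [exchange, List.mem_range.1 hx]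
  have h₂ : (List.range k).map (exchange g k ∘ (g + ·)) = List.range k := by
    conv_rhs => rw [← List.map_id (List.range k)]
    exact List.map_congr_left fun x hx => by simp [exchange, List.mem_range.1 hx]
  rw [h₁, h₂]

theorem nodup_map_exchange (g k : ℕ) : ((List.range (g + k)).map (exchange g k)).Nodup := by
  rw [map_exchange]
  exact nodup_shift_range List.nodup_range k

theorem zip_map_exchange (γ as : List A.Node) :
    ((List.range (γ ++ as).length).map (exchange γ.length as.length)).zip (γ ++ as) =
      (enumCtx γ).shift as.length ++ enumCtx as := by
  rw [List.length_append, map_exchange, List.zip_append (by simp), zip_shift, zip_range, zip_range]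

/-- Application to variables is injective on classes, by `η`. -/
theorem conv_of_comp_ev {γ as : List A.Node} {b : A.Node} {s s' : Term A γ (.lolli as b)}
    (h : Conv (enumCtx (γ ++ as)) b ((ev as b).comp (.cons s (Tuple.ids id as) rfl)).1
      ((ev as b).comp (.cons s' (Tuple.ids id as) rfl)).1) :
    Conv (enumCtx γ) (.lolli as b) s.1 s'.1 := by
  have key : ∀ r : Term A γ (.lolli as b),
      ((ev as b).comp (.cons r (Tuple.ids id as) rfl)).1.rename (exchange γ.length as.length) =
        .app (r.1.shift as.length) (.varTup as.length) := by
    intro r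
    rw [comp_ev]
    simp only [Raw.rename, Raw.varTup]
    congr 1
    · exact r.1.rename_congr fun x hx => if_pos (r.2.lt_of_occ hx)
    · congr 1
      funext i
      have := i.2
      rw [exchange, if_neg (by omega), if_pos (by omega), Nat.add_sub_cancel]
  have h' := h.rename ((ev as b).comp (.cons s (Tuple.ids id as) rfl)).2
    (ρ := exchange γ.length as.length)
    (by rw [List.length_append]; exact nodup_map_exchange _ _) rfl
  rw [zip_map_exchange, key, key] at h'
  exact (Conv.eta₂ s.2).trans (h'.lam.trans (Conv.eta₂ s'.2).symm)

/-- The abstraction of the last variables. -/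
def abs (γ as : List A.Node) {b : A.Node} (s : Term A (γ ++ as) b) : Term A γ (.lolli as b) :=
  ⟨.lam as (s.1.rename (exchange γ.length as.length)), by
    refine .lam ?_
    rw [← zip_map_exchange]
    refine s.2.rename ?_ rfl
    rw [List.length_append]
    exact nodup_map_exchange _ _⟩

/-- Application to variables is surjective on classes, by `β`. -/
theorem conv_comp_ev_abs {γ as : List A.Node} {b : A.Node} (s : Term A (γ ++ as) b) :
    Conv (enumCtx (γ ++ as)) b ((ev as b).comp (.cons (abs γ as s) (Tuple.ids id as) rfl)).1
      s.1 := by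
  have hT := ((ev as b).comp (.cons (abs γ as s) (Tuple.ids id as) rfl)).2
  rw [comp_ev] at hT ⊢
  have h := Conv.of_beta .hole hT (.beta₂ as _ .hole _ trivial)
  simp only [Cx.plug, Cx.depth, shift_zero] at h
  rw [Raw.subst_rename, s.2.subst_congr (τ := .var), Raw.subst_var] at h
  · exact h
  · intro x hx
    rw [List.length_append] at hx
    simp only [Function.comp, exchange, instSub]
    split_ifs <;> first | omega | skip
    · simp
    · congr 1
      omega

end Term

theorem FreeHom.comp_reTuple {γ as δ : List A.Node} {b : A.Node}
    (s : Term A (γ ++ .tensor as :: δ) b) :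
    (freeMulticategory A).comp (mk s) ((Tuple.ids (freeMulticategory A).id γ).append
      (.cons (mk (.re as)) (Tuple.ids (freeMulticategory A).id δ) rfl)) =
      mk (s.comp (Term.reTuple γ as δ)) := by
  refine Eq.trans ?_ (comp_mk s (Term.reTuple γ as δ))
  rw [Term.reTuple, Tuple.mapHom_append, Tuple.mapHom_ids, Tuple.mapHom, Tuple.mapHom_ids]
  rfl

theorem FreeHom.comp_cons_ids {γ Γ δ : List A.Node} {a b : A.Node} (r : Term A (a :: δ) b)
    (s : Term A γ a) (h : Γ = γ ++ δ) :
    (freeMulticategory A).comp (mk r) (.cons (mk s) (Tuple.ids (freeMulticategory A).id δ) h) =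
      mk (r.comp (.cons s (Tuple.ids Term.id δ) h)) := by
  refine Eq.trans ?_ (comp_mk r (.cons s (Tuple.ids Term.id δ) h))
  rw [Tuple.mapHom, Tuple.mapHom_ids]
  rfl

/-- The autonomous multicategory of classes of terms. -/
noncomputable def freeAut (A : AutSignature.{u, v}) :
    AutonomousMulticategory A.Node (FreeHom A) where
  toMulticategory := freeMulticategory A
  symm := freeSymm A
  rep :=
    { tensor := .tensor
      re as := .mk (.re as)
      bijective γ as δ b := by
        constructor
        · intro f f' h
          obtain ⟨s, rfl⟩ := f.mk_surjective
          obtain ⟨s', rfl⟩ := f'.mk_surjective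
          have h' := (FreeHom.comp_reTuple s).symm.trans (h.trans (FreeHom.comp_reTuple s'))
          exact FreeHom.mk_eq_mk.2 (Term.conv_of_comp_reTuple (FreeHom.mk_eq_mk.1 h'))
        · intro f
          obtain ⟨s, rfl⟩ := f.mk_surjective
          exact ⟨.mk (Term.letVar γ as δ s), (FreeHom.comp_reTuple _).trans
            (FreeHom.mk_eq_mk.2 (Term.conv_letVar_comp_reTuple s))⟩ }
  closed :=
    { lolli := .lolli
      ev as b := .mk (.ev as b)
      bijective γ as b := by
        constructor
        · intro f f' h
          obtain ⟨s, rfl⟩ := f.mk_surjective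
          obtain ⟨s', rfl⟩ := f'.mk_surjective
          have h' := (FreeHom.comp_cons_ids _ s rfl).symm.trans
            (h.trans (FreeHom.comp_cons_ids _ s' rfl))
          exact FreeHom.mk_eq_mk.2 (Term.conv_of_comp_ev (FreeHom.mk_eq_mk.1 h'))
        · intro f
          obtain ⟨s, rfl⟩ := f.mk_surjective
          exact ⟨.mk (Term.abs γ as s), (FreeHom.comp_cons_ids _ _ rfl).trans
            (FreeHom.mk_eq_mk.2 (Term.conv_comp_ev_abs s))⟩ }

theorem isTermMulticategory_freeAut (A : AutSignature.{u, v}) :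
    IsTermMulticategory (freeAut A) where
  id a := ⟨(Term.id a).2, rfl⟩
  comp s ts := ⟨(s.comp ts).2, FreeHom.comp_mk s ts⟩
  act e _ _ _ _ hΓ hΔ s := ⟨(s.act e hΓ hΔ).2, rfl⟩
  tensor := rfl
  re as := ⟨(Term.re as).2, rfl⟩
  lolli := rfl
  ev as b := ⟨(Term.ev as b).2, rfl⟩

end FreeAut

/-! ### Models from autonomous multicategories -/

namespace AutonomousMulticategory

variable {O : Type u₁} {H : List O → O → Type v₁} (N : AutonomousMulticategory O H)

/-- Representability at the first place. -/
theorem re_bij (as δ : List O) (b : O) : Function.Bijective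
    fun f : H (N.rep.tensor as :: δ) b =>
      N.comp f (.cons (N.rep.re as) (Tuple.ids N.id δ) rfl) := N.rep.bijective [] as δ b

/-- Representability at the second of two places. -/
theorem re_bij_snd (a : O) (as : List O) (b : O) : Function.Bijective
    fun f : H [a, N.rep.tensor as] b =>
      N.comp f (.cons (N.id a) (.cons (N.rep.re as) .nil (List.append_nil as).symm) rfl) := by
  have key : ∀ {Γ : List O} (_ : Γ = a :: as) (t : Tuple H Γ [a, N.rep.tensor as])
      (t' : Tuple H (a :: as) [a, N.rep.tensor as]), HEq t t' →
      (Function.Bijective fun f : H [a, N.rep.tensor as] b => N.comp f t) →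
      Function.Bijective fun f : H [a, N.rep.tensor as] b => N.comp f t' := by
    rintro Γ rfl t t' ht h
    cases ht
    exact h
  refine key (by simp) _ _ ?_ (N.rep.bijective [a] as [] b)
  exact Tuple.cons_heq (by simp) rfl (Tuple.cons_heq rfl rfl HEq.rfl)

/-- Evaluation, as a multiarrow `(a₁ ⊗ … ⊗ aₖ) ⊸ b, (a₁ ⊗ … ⊗ aₖ) → b`. -/
noncomputable def ap (as : List O) (b : O) : H [N.closed.lolli as b, N.rep.tensor as] b :=
  ((N.re_bij_snd _ as b).2 (N.closed.ev as b)).choose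

theorem ap_spec (as : List O) (b : O) :
    N.comp (N.ap as b) (.cons (N.id _) (.cons (N.rep.re as) .nil (List.append_nil as).symm) rfl) =
      N.closed.ev as b := ((N.re_bij_snd _ as b).2 (N.closed.ev as b)).choose_spec

theorem eq_ap {as : List O} {b : O} {p : H [N.closed.lolli as b, N.rep.tensor as] b}
    (h : N.comp p (.cons (N.id _) (.cons (N.rep.re as) .nil (List.append_nil as).symm) rfl) =
      N.closed.ev as b) : p = N.ap as b :=
  (N.re_bij_snd _ as b).1 (h.trans (N.ap_spec as b).symm)

theorem comp_ap {γ as : List O} {b : O} (f : H γ (N.closed.lolli as b)) :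
    N.comp (N.ap as b) (.cons f (.cons (N.rep.re as) .nil (List.append_nil as).symm) rfl) =
      N.comp (N.closed.ev as b) (.cons f (Tuple.ids N.id as) rfl) := by
  rw [← ap_spec, N.assoc]
  have := Tuple.comp_cons N.comp (N.id (N.closed.lolli as b))
    (.cons (N.rep.re as) .nil (List.append_nil as).symm)
    (.cons f .nil (List.append_nil γ).symm) (Tuple.ids N.id as)
  rw [N.id_comp, Tuple.comp_ids] at this
  exact (congrArg _ this).symm

theorem ap_bij (γ as : List O) (b : O) : Function.Bijective
    fun f : H γ (N.closed.lolli as b) =>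
      N.comp (N.ap as b)
        (.cons f (.cons (N.rep.re as) .nil (List.append_nil as).symm) rfl) := by
  simp only [comp_ap]
  exact N.closed.bijective γ as b

/-- `re_bij`, for objects and multiarrows that are only propositionally equal to those required. -/
theorem re_bij_of_heq {t : O} {as δ Γ : List O} {b : O} (ht : t = N.rep.tensor as)
    {r : H as t} (hr : HEq r (N.rep.re as)) (hΓ : Γ = as ++ δ) {gs : Tuple H Γ (t :: δ)}
    (hg : HEq gs (Tuple.cons (Γ := as ++ δ) r (Tuple.ids N.id δ) rfl)) :
    Function.Bijective fun f : H (t :: δ) b => N.comp f gs := by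
  subst ht hΓ
  cases hr
  cases hg
  exact N.re_bij as δ b

/-- `ap_bij`, for objects and multiarrows that are only propositionally equal to those required. -/
theorem ap_bij_of_heq {l t : O} {γ as Γ : List O} {b : O} (ht : t = N.rep.tensor as)
    (hl : l = N.closed.lolli as b) {r : H as t} (hr : HEq r (N.rep.re as)) {p : H [l, t] b}
    (hp : HEq p (N.ap as b)) (hΓ : Γ = γ ++ as) {gs : H γ l → Tuple H Γ [l, t]}
    (hg : ∀ f, HEq (gs f) (Tuple.cons (Γ := γ ++ as) f
      (.cons r .nil (List.append_nil as).symm) rfl)) :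
    Function.Bijective fun f : H γ l => N.comp p (gs f) := by
  subst ht hl hΓ
  cases hr
  cases hp
  obtain rfl : gs = fun f => .cons f (.cons (N.rep.re as) .nil (List.append_nil as).symm) rfl :=
    funext fun f => eq_of_heq (hg f)
  exact N.ap_bij γ as b

end AutonomousMulticategory

/-! #### Change of objects -/

section Pullback

variable {O : Type u₁} {H : List O → O → Type v₁} {P : Type u} (F : P → O)

/-- The multigraph with nodes `P` that is induced by a map of nodes. -/
abbrev PullbackHom (H : List O → O → Type v₁) (F : P → O) (as : List P) (b : P) : Type v₁ :=
  H (as.map F) (F b)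

/-- The tuple of the same multiarrows. -/
def Tuple.push {Γ as : List P} (t : Tuple (PullbackHom H F) Γ as) :
    Tuple H (Γ.map F) (as.map F) := t.map F fun {_ _} f => f

theorem Tuple.push_cons {γ δ Γ as : List P} {a : P} (g : PullbackHom H F γ a)
    (gs : Tuple (PullbackHom H F) δ as) (h : Γ = γ ++ δ) :
    (Tuple.cons g gs h).push F = Tuple.cons (H := H) (Γ := Γ.map F) (γ := γ.map F) (a := F a)
      g (gs.push F) (by rw [h, List.map_append]) := rfl

theorem Tuple.push_append {Γ as Δ bs : List P} (t : Tuple (PullbackHom H F) Γ as)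
    (t' : Tuple (PullbackHom H F) Δ bs) :
    HEq ((t.append t').push F) ((t.push F).append (t'.push F)) := by
  induction t with
  | nil => rfl
  | cons g gs h ih => exact cons_heq List.map_append List.map_append ih

theorem Tuple.push_ids (i : ∀ a, H [a] a) (as : List P) :
    (Tuple.ids (H := PullbackHom H F) (fun a => i (F a)) as).push F = Tuple.ids i (as.map F) := by
  induction as with
  | nil => rfl
  | cons a as ih => exact congrArg (fun t => Tuple.cons (i (F a)) t rfl) ih

variable (N : Multicategory O H)

theorem Tuple.push_comp {Γ Δ as : List P} (t : Tuple (PullbackHom H F) Γ as)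
    (t' : Tuple (PullbackHom H F) Δ Γ) :
    (t.comp (H := PullbackHom H F) (fun f gs => N.comp f (gs.push F)) t').push F =
      (t.push F).comp N.comp (t'.push F) := by
  induction t generalizing Δ with
  | nil => rfl
  | @cons γ δ Γ a as g gs h ih =>
    subst h
    obtain ⟨Δ₁, Δ₂, rfl, t₁, t₂, rfl⟩ := exists_eq_append γ δ t'
    rw [comp_cons]
    have := comp_cons_of_heq N.comp (Γ := (γ ++ δ).map F) (Δ := (Δ₁ ++ Δ₂).map F)
      g (gs.push F) (t₁.push F) (t₂.push F) List.map_append List.map_append _ (push_append F t₁ t₂)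
    refine Eq.trans ?_ this.symm
    rw [push_cons, ih]

theorem Tuple.ofFn_heq {n : ℕ} {γ : Fin n → List O} {a : Fin n → O} {Γ Γ' : List O}
    (g : ∀ i, H (γ i) (a i)) (h : Γ = (List.ofFn γ).flatten) (h' : Γ' = (List.ofFn γ).flatten) :
    HEq (Tuple.ofFn g h) (Tuple.ofFn g h') := by
  subst h h'
  rfl

theorem Tuple.push_ofFn {n : ℕ} {γ : Fin n → List P} {a : Fin n → P} {Γ : List P}
    (g : ∀ i, PullbackHom H F (γ i) (a i)) (h : Γ = (List.ofFn γ).flatten)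
    (h' : Γ.map F = (List.ofFn fun i => (γ i).map F).flatten) :
    HEq ((Tuple.ofFn g h).push F) (Tuple.ofFn (H := H) (a := F ∘ a) (fun i => g i) h') := by
  have key : ∀ (as : List P) (t : Tuple (PullbackHom H F) Γ as), as = List.ofFn a →
      HEq t (Tuple.ofFn g h) →
      HEq (t.push F) (Tuple.ofFn (H := H) (a := F ∘ a) (fun i => g i) h') := by
    induction n generalizing Γ with
    | zero =>
      intro as t e ht
      obtain rfl : as = [] := by simpa using e
      obtain rfl : Γ = [] := by simpa using h
      have ht' := eq_of_heq (ht.trans (Tuple.ofFn_zero g h))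
      subst ht'
      exact (Tuple.ofFn_zero _ _).symm
    | succ n ih =>
      intro as t e ht
      rw [List.ofFn_succ] at e
      subst e
      have ht' := eq_of_heq (ht.trans (Tuple.ofFn_succ g h))
      subst ht'
      rw [push_cons]
      refine HEq.trans ?_ (Tuple.ofFn_succ _ _).symm
      refine Tuple.cons_heq (by rw [List.map_flatten, List.map_ofFn]; rfl)
        (by rw [List.map_ofFn]; rfl) ((ih (fun i => g i.succ) rfl
          (by rw [List.map_flatten, List.map_ofFn]; rfl) _ _ rfl HEq.rfl).trans
            (Tuple.ofFn_heq _ _ _))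
  exact key _ _ rfl HEq.rfl

/-- The multicategory that is induced by a map of objects. -/
def Multicategory.pullback : Multicategory P (PullbackHom H F) where
  id a := N.id (F a)
  comp f gs := N.comp f (gs.push F)
  id_comp f := N.id_comp f
  comp_id f := by rw [Tuple.push_ids, N.comp_id]
  assoc f gs hs := by rw [N.assoc, Tuple.push_comp]

variable {N}

/-- The axiom `comp_act`, for lists of objects that are only propositionally equal to the required
ones. -/
theorem SymmetricStructure.comp_act_of_heq (S : SymmetricStructure N) {n : ℕ} {a : Fin n → O}
    {b : O} {k : Fin n → ℕ} {c : ∀ i, Fin (k i) → O} (σ : Equiv.Perm (Fin n))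
    (π : ∀ i, Equiv.Perm (Fin (k i))) {as as' Γ Γ' : List O} {γ γ' : Fin n → List O}
    (has : as = List.ofFn a) (has' : as' = List.ofFn (a ∘ σ)) (hγ : ∀ i, γ i = List.ofFn (c i))
    (hγ' : ∀ i, γ' i = List.ofFn (c i ∘ π i)) (hΓ : Γ = List.ofFn (blockConcat c))
    (hΓ' : Γ' = List.ofFn (blockConcat c ∘ blockPerm σ π)) (h : Γ = (List.ofFn γ).flatten)
    (h' : Γ' = (List.ofFn fun i => γ' (σ i)).flatten) (f : H as b) (g : ∀ i, H (γ i) (a i))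
    {t : Tuple H Γ as} (ht : HEq t (Tuple.ofFn g h)) {t' : Tuple H Γ' as'}
    (ht' : HEq t' (Tuple.ofFn (a := a ∘ σ)
      (fun i => S.act (π (σ i)) (hγ (σ i)) (hγ' (σ i)) (g (σ i))) h')) :
    N.comp (S.act σ has has' f) t' = S.act (blockPerm σ π) hΓ hΓ' (N.comp f t) := by
  obtain rfl : γ = fun i => List.ofFn (c i) := funext hγ
  obtain rfl : γ' = fun i => List.ofFn (c i ∘ π i) := funext hγ'
  subst has has' hΓ hΓ'
  cases ht
  cases ht'
  exact S.comp_act σ π f g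

/-- The symmetric structure that is induced by a map of objects. -/
def SymmetricStructure.pullback (S : SymmetricStructure N) :
    SymmetricStructure (N.pullback F) where
  act {_ _} e {a} _ _ _ hΓ hΔ f :=
    S.act e (a := F ∘ a) (by rw [hΓ, List.map_ofFn]) (by rw [hΔ, List.map_ofFn]; rfl) f
  act_refl hΓ f := S.act_refl _ f
  act_trans {_ _ _} e' e {a} _ _ _ _ hΓ hΔ hΘ f := S.act_trans e' e (a := F ∘ a) _ _ _ f
  comp_act {n a b k c} σ π f g := by
    have h₁ : ∀ {n : ℕ} (d : Fin n → P), (List.ofFn d).map F = List.ofFn (F ∘ d) := fun _ =>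
      List.map_ofFn ..
    have h₂ := Tuple.push_ofFn (H := H) F (a := a ∘ σ)
      (fun i => S.act (π (σ i)) (a := F ∘ c (σ i)) (h₁ _) (h₁ _) (g (σ i)))
      (ofFn_blockConcat_perm c σ π)
      (by rw [ofFn_blockConcat_perm, List.map_flatten, List.map_ofFn]; rfl)
    exact S.comp_act_of_heq (a := F ∘ a) (c := fun i => F ∘ c i) σ π _ _
      (fun i => h₁ _) (fun i => h₁ _) _ _
      (by rw [ofFn_blockConcat, List.map_flatten, List.map_ofFn]; rfl) _ f g
      (Tuple.push_ofFn F g _ _) h₂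

end Pullback

section Models

variable {A : AutSignature.{u, v}}

namespace SignatureMap

variable {O : Type u₁} {H : List O → O → Type v₁} {S : AutonomousMulticategory O H}
  (i : SignatureMap A S)

/-- The multiarrow `re` of `S`. -/
def re (as : List A.Node) : H (as.map i.obj) (i.obj (.tensor as)) :=
  cast (by rw [i.obj_tensor]) (S.rep.re (as.map i.obj))

theorem re_heq (as : List A.Node) : HEq (i.re as) (S.rep.re (as.map i.obj)) := cast_heq _ _

/-- The multiarrow `ap` of `S`. -/
noncomputable def ap (as : List A.Node) (b : A.Node) :
    H [i.obj (.lolli as b), i.obj (.tensor as)] (i.obj b) :=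
  cast (by rw [i.obj_lolli, i.obj_tensor]) (S.ap (as.map i.obj) (i.obj b))

theorem ap_heq (as : List A.Node) (b : A.Node) :
    HEq (i.ap as b) (S.ap (as.map i.obj) (i.obj b)) := cast_heq _ _

/-- The model that is given by a map of signatures. -/
noncomputable def model : Model.{u, v, v₁} A where
  H := PullbackHom H i.obj
  M := S.toMulticategory.pullback i.obj
  S := S.symm.pullback i.obj
  re := i.re
  re_bij as δ _ := S.re_bij_of_heq (i.obj_tensor as) (i.re_heq as) List.map_append
    (Tuple.cons_heq rfl rfl (heq_of_eq (Tuple.push_ids i.obj S.id δ)))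
  ap := i.ap
  ap_bij _ as b := S.ap_bij_of_heq (i.obj_tensor as) (i.obj_lolli as b) (i.re_heq as)
    (i.ap_heq as b) List.map_append fun _ => Tuple.cons_heq rfl rfl HEq.rfl
  gen := i.map

end SignatureMap

/-- The model of classes of terms. -/
noncomputable def termModel (A : AutSignature.{u, v}) : Model.{u, v, max u v} A where
  H := FreeHom A
  M := (freeAut A).toMulticategory
  S := (freeAut A).symm
  re := (freeAut A).rep.re
  re_bij := (freeAut A).re_bij
  ap := (freeAut A).ap
  ap_bij := (freeAut A).ap_bij
  gen := FreeHom.eta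

end Models

/-! ### Terms are interpreted by their classes -/

section TermModel

variable {A : AutSignature.{u, v}}

theorem permRen_symm_permRen {m n : ℕ} (e : Fin m ≃ Fin n) (x : ℕ) :
    permRen e (permRen e.symm x) = x := by
  obtain rfl : m = n := by simpa using Fintype.card_congr e
  by_cases h : x < m <;> simp [permRen, h]

theorem FreeHom.isClassOf_mk {Γ : List A.Node} {b : A.Node} {s : Raw A} (t : Term A Γ b)
    (h : t.1 = s) : (mk t).IsClassOf s := by
  subst h
  exact ⟨t.2, rfl⟩

/-- If a multiarrow is the class of a term, with the variables renamed to their places, then so is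
each permutation of the multiarrow. -/
theorem FreeHom.isClassOf_of_reord {xs ys : List ℕ} {Γ Δ : List A.Node} {b c : A.Node}
    {f : FreeHom A Γ b} {g : FreeHom A Δ c} (r : Reord (freeAut A).symm xs Γ b f ys Δ c g)
    {s : Raw A} (h : ∀ ρ : ℕ → ℕ, xs.map ρ = List.range Γ.length → f.IsClassOf (s.rename ρ))
    {ρ : ℕ → ℕ} (hρ : ys.map ρ = List.range Δ.length) : g.IsClassOf (s.rename ρ) := by
  cases r with
  | @mk m n e x a _ _ _ hΓ hΔ _ _ _ hx hy =>
    subst hΓ hΔ hx hy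
    have hx : ∀ j, ρ (x (e j)) = j := fun j => by
      have := congrArg (fun l => l[(j : ℕ)]?) hρ
      simpa using this
    obtain ⟨hs, rfl⟩ := h (permRen e.symm ∘ ρ) (by
      apply List.ext_get
      · simp
      · intro i h₁ h₂
        have hi : i < n := by simpa using h₁
        have := hx (e.symm ⟨i, hi⟩)
        rw [Equiv.apply_symm_apply] at this
        simp [this, permRen])
    have e₁ : (s.rename (permRen e.symm ∘ ρ)).rename (permRen e) = s.rename ρ := by
      rw [Raw.rename_rename]
      congr 1
      funext i
      exact permRen_symm_permRen e (ρ i)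
    rw [← e₁]
    exact ⟨(Term.act e rfl rfl ⟨_, hs⟩).2, rfl⟩

/-- If the components of a tuple are the classes of terms, then the tuple consists of the classes of
a tuple of terms, which amounts to the simultaneous substitution of these terms, up to a shift by
`k`. -/
theorem FreeHom.exists_tuple {xs : List ℕ} {ts : List (Raw A)} {Γ as : List A.Node}
    {gs : Tuple (FreeHom A) Γ as}
    (h : TRel (fun xs s Γ b (m : FreeHom A Γ b) => (xs.length = Γ.length ∧
      ∀ x, s.occ x ≠ 0 → x ∈ xs) ∧
      ∀ ρ : ℕ → ℕ, xs.map ρ = List.range Γ.length → m.IsClassOf (s.rename ρ)) xs ts Γ as gs)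
    {ρ : ℕ → ℕ} {k : ℕ} (hρ : xs.map ρ = (List.range Γ.length).map (· + k)) :
    ∃ rs : Tuple (Term A) Γ as, rs.mapHom mk = gs ∧
      (List.ofFn fun i : Fin as.length => (rs.toSubst i).shift k) = ts.map fun t => t.rename ρ := by
  induction h generalizing k with
  | nil => exact ⟨.nil, rfl, by simp⟩
  | @cons xs ys s ts γ δ Γ a as g gs e h _ ih =>
    subst e
    obtain ⟨⟨hl, ho⟩, h⟩ := h
    rw [List.map_append, List.length_append, List.range_add, List.map_append] at hρ
    obtain ⟨h₁, h₂⟩ := List.append_inj hρ (by simp [hl])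
    obtain ⟨rs, rfl, hr⟩ := ih (k := γ.length + k) (by
      rw [h₂, List.map_map]
      refine List.map_congr_left fun x _ => ?_
      simp only [Function.comp]
      omega)
    have h₃ : ∀ x ∈ xs, k ≤ ρ x := fun x hx => by
      have := List.mem_map_of_mem (f := ρ) hx
      rw [h₁, List.mem_map] at this
      obtain ⟨y, -, hy⟩ := this
      omega
    obtain ⟨hs, rfl⟩ := h (fun x => ρ x - k) (by
      rw [show (fun x => ρ x - k) = (· - k) ∘ ρ from rfl, ← List.map_map, h₁, List.map_map]
      conv_rhs => rw [← List.map_id (List.range γ.length)]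
      exact List.map_congr_left fun x _ => Nat.add_sub_cancel x k)
    refine ⟨.cons ⟨_, hs⟩ rs rfl, rfl, ?_⟩
    rw [List.length_cons, List.ofFn_succ, List.map_cons, ← hr]
    congr 1
    · show (s.rename _).rename _ = _
      rw [Raw.rename_rename]
      refine s.rename_congr fun x hx => ?_
      have := h₃ x (ho x hx)
      simp only [Function.comp]
      omega
    · congr 1
      funext i
      exact Raw.shift_shift _ _ _

/-- Application of a variable to a variable. -/
def Term.ap (as : List A.Node) (b : A.Node) : Term A [.lolli as b, .tensor as] b :=
  ⟨.app (.var 0) (.var 1), by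
    refine .app (as := as) (.var 0 _) (.var 1 _) ?_
    have hm := merge_flatten (γ := ![[((0 : ℕ), Ty.lolli as b)], [(1, Ty.tensor as)]])
      (by simp [List.ofFn_succ])
    simpa [List.ofFn_succ, enumCtx] using hm⟩

theorem FreeHom.ap_eq (as : List A.Node) (b : A.Node) :
    (freeAut A).ap as b = mk (.ap as b) := by
  refine ((freeAut A).eq_ap ?_).symm
  refine (comp_mk (.ap as b) (.cons (.id _) (.cons (.re as) .nil (List.append_nil as).symm)
    rfl)).trans ?_
  rfl

/-- Transposition of classes of terms is abstraction. -/
theorem FreeHom.lamb_mk {γ as : List A.Node} {b : A.Node} (s : Term A (γ ++ as) b) :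
    (termModel A).lamb (mk s) = (mk (.abs γ as s) : FreeHom A γ (.lolli as b)) := by
  refine ((termModel A).eq_lamb ?_).symm
  refine ((freeAut A).comp_ap _).trans ((comp_cons_ids _ _ rfl).trans ?_)
  exact mk_eq_mk.2 (Term.conv_comp_ev_abs s)

/-- Transposition of classes of terms along `re` is the formation of `s[x⃗ := x]`. -/
theorem FreeHom.unre_mk {as δ : List A.Node} {b : A.Node} (s : Term A (as ++ δ) b) :
    (termModel A).unre (mk s) = (mk (.letVar [] as δ s) : FreeHom A (.tensor as :: δ) b) := by
  refine ((termModel A).eq_unre ?_).symm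
  refine (comp_reTuple (γ := []) (Term.letVar [] as δ s)).trans ?_
  exact mk_eq_mk.2 (Term.conv_letVar_comp_reTuple (γ := []) s)

/-- A multiarrow of the signature, applied to variables. -/
def Term.con {as : List A.Node} {b : A.Node} (f : A.Arr as b) : Term A as b :=
  ⟨.con f fun i => .var i, .con f (fun i => .var i _) (merge_vars as)⟩

theorem exchange_exchange (g k x : ℕ) : exchange g k (exchange k g x) = x := by
  simp only [exchange]
  split_ifs <;> omega

/-- The interpretation of a term in the model of classes of terms is its class, up to a renaming of
the variables of the context. -/
theorem Den.isClassOf {xs : List ℕ} {s : Raw A} {Γ : List A.Node} {b : A.Node}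
    {m : (termModel A).H Γ b} (h : Den (termModel A) xs s Γ b m) {ρ : ℕ → ℕ}
    (hρ : xs.map ρ = List.range Γ.length) : FreeHom.IsClassOf (A := A) m (s.rename ρ) := by
  induction h using Den.ind generalizing ρ with
  | var x a =>
    have e : ρ x = 0 := by simpa using hρ
    refine FreeHom.isClassOf_mk (Term.id a) ?_
    rw [Raw.rename, e]
    rfl
  | @op u ts as b o xs Γ gs ys Δ m ho hg ih hn r =>
    refine FreeHom.isClassOf_of_reord r (fun ρ hρ => ?_) hρ
    have ih' := (ih.mono (P' := fun xs s Γ b (m : FreeHom A Γ b) => (xs.length = Γ.length ∧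
      ∀ x, s.occ x ≠ 0 → x ∈ xs) ∧
      ∀ ρ : ℕ → ℕ, xs.map ρ = List.range Γ.length → m.IsClassOf (s.rename ρ)) (fun t => t)
      fun xs s _ Γ b m ⟨h, h'⟩ => ⟨⟨h.length_eq, fun _ => h.occ_ne_zero.1⟩, fun _ => h'⟩)
    rw [List.map_id'] at ih'
    obtain ⟨rs, rfl, hr⟩ := FreeHom.exists_tuple ih' (ρ := ρ) (k := 0) (by simpa using hρ)
    simp only [shift_zero] at hr
    cases ho with
    | @tup k ss as =>
      have e : (termModel A).M.comp ((termModel A).re as) (rs.mapHom FreeHom.mk) =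
          FreeHom.mk ((Term.re as).comp rs) := FreeHom.comp_mk _ _
      rw [e]
      refine FreeHom.isClassOf_mk _ (Raw.tup_congr (hr.trans ?_))
      rw [List.map_ofFn]
      rfl
    | app s t as b =>
      have e : (termModel A).M.comp ((termModel A).ap as b) (rs.mapHom FreeHom.mk) =
          FreeHom.mk ((Term.ap as b).comp rs) := by
        refine Eq.trans ?_ (FreeHom.comp_mk _ _)
        rw [← FreeHom.ap_eq]
        rfl
      rw [e]
      refine FreeHom.isClassOf_mk _ ?_
      simp only [List.length_cons, List.length_nil, List.ofFn_succ, List.map_cons,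
        List.cons.injEq] at hr
      exact congrArg₂ Raw.app hr.1 hr.2.1
    | @con as b f ss =>
      have e : (termModel A).M.comp ((termModel A).gen f) (rs.mapHom FreeHom.mk) =
          FreeHom.mk ((Term.con f).comp rs) := FreeHom.comp_mk _ _
      rw [e]
      refine FreeHom.isClassOf_mk _ (congrArg (Raw.con f) (List.ofFn_injective (hr.trans ?_)))
      rw [List.map_ofFn]
      rfl
  | @lam as s xs Γ b n ys Δ m hx h ih r =>
    refine FreeHom.isClassOf_of_reord r (fun ρ hρ => ?_) hρ
    -- The bound variables are the first ones in `s`, but the last ones in the source of `n`.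
    obtain ⟨hs, rfl⟩ := ih (ρ := exchange as.length Γ.length ∘ upRen as.length ρ) (by
      rw [← List.map_map, List.map_append, map_upRen_shift, map_upRen_range, hρ,
        List.length_append, List.range_add, List.map_append, List.map_map]
      refine congrArg₂ (· ++ ·) ?_ ?_
      · conv_rhs => rw [← List.map_id (List.range Γ.length)]
        refine List.map_congr_left fun x hx => ?_
        rw [List.mem_range] at hx
        simp only [Function.comp, exchange, id]
        split_ifs <;> omega
      · refine List.map_congr_left fun x hx => ?_
        rw [exchange, if_pos (List.mem_range.1 hx), Nat.add_comm])
    refine (FreeHom.lamb_mk ⟨_, hs⟩).symm ▸ FreeHom.isClassOf_mk _ (congrArg (Raw.lam as) ?_)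
    rw [Raw.rename_rename]
    congr 1
    funext x
    exact exchange_exchange _ _ _
  | @sub as s t xs zs Γ Δ b n p ys Θ m h h' ih ih' hn r =>
    refine FreeHom.isClassOf_of_reord r (fun ρ hρ => ?_) hρ
    rw [List.map_append, List.length_append, List.range_add] at hρ
    obtain ⟨h₁, h₂⟩ := List.append_inj hρ (by simp [h'.length_eq])
    obtain ⟨t', rfl, ht⟩ : ∃ t' : Term A Δ (.tensor as), p = FreeHom.mk t' ∧ t'.1 = t.rename ρ := by
      obtain ⟨ht, hp⟩ := ih' h₁
      exact ⟨⟨_, ht⟩, hp, rfl⟩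
    have hx := h.length_eq
    -- The values of `ρ` on `xs` come after those on `zs`, of which there are `Δ.length`.
    obtain ⟨s', rfl, hs⟩ : ∃ s' : Term A (as ++ Γ) b, n = FreeHom.mk s' ∧ s'.1 = s.rename
        fun y => if y < as.length then y else upRen as.length ρ y - Δ.length := by
      obtain ⟨hs, hp⟩ := ih
        (ρ := fun y => if y < as.length then y else upRen as.length ρ y - Δ.length) (by
          rw [List.map_append, List.length_append, List.range_add]
          refine congrArg₂ (· ++ ·) ?_ ?_
          · conv_rhs => rw [← List.map_id (List.range as.length)]
            exact List.map_congr_left fun x hx => if_pos (List.mem_range.1 hx)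
          · have := congrArg (List.map (· + as.length - Δ.length)) h₂
            rw [List.map_map, List.map_map] at this
            rw [List.map_map]
            refine Eq.trans (List.map_congr_left fun x _ => ?_) (this.trans
              (List.map_congr_left fun x _ => ?_))
            · simp [upRen]
            · simp only [Function.comp]
              omega)
      exact ⟨⟨_, hs⟩, hp, rfl⟩
    have e := (congrArg (fun f : FreeHom A (.tensor as :: Γ) b => (freeMulticategory A).comp f
      (.cons (FreeHom.mk t') (Tuple.ids (freeMulticategory A).id Γ) rfl))
      (FreeHom.unre_mk s')).trans (FreeHom.comp_cons_ids _ _ rfl)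
    refine e.symm ▸ FreeHom.isClassOf_mk _ (congrArg₂ (Raw.sub as) ?_ ht)
    rw [hs, Raw.subst_rename, Raw.subst_rename, Raw.rename_eq_subst]
    refine s.subst_congr fun y hy => ?_
    have hy := h.occ_ne_zero.1 hy
    rw [List.mem_append, List.mem_range] at hy
    have hk : y < as.length ∨ ∃ x, y = x + as.length ∧ Δ.length ≤ ρ x := by
      refine hy.imp_right fun hy => ?_
      obtain ⟨x, hx, rfl⟩ := List.mem_map.1 hy
      have := List.mem_map_of_mem (f := ρ) hx
      rw [h₂, List.mem_map] at this
      obtain ⟨z, -, hz⟩ := this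
      exact ⟨x, rfl, by omega⟩
    obtain hk | ⟨x, rfl, hk⟩ := hk
    · simp [focus, Raw.upSub, upRen, hk]
    · obtain ⟨z, hz⟩ := Nat.exists_eq_add_of_le hk
      have e₁ : focus 0 as.length (z + as.length) = z + 1 + as.length := by
        simp [focus]; omega
      have e₂ : ¬ x + as.length < as.length := by omega
      have e₃ : ¬ z + 1 + as.length < as.length := by omega
      simp only [Function.comp, if_neg e₂, upRen, Nat.add_sub_cancel, hz]
      rw [show Δ.length + z + as.length - Δ.length = z + as.length by omega]
      show Raw.upSub _ _ (focus 0 as.length (z + as.length)) = _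
      rw [e₁, Raw.upSub, if_neg e₃, Nat.add_sub_cancel, Tuple.toSubst, Term.toSubst_ids]
      simp only [Raw.shift, Raw.rename]
      congr 1
      omega

/-- In the model of classes of terms, each term is interpreted by its class. -/
theorem Term.den {Γ : List A.Node} {b : A.Node} (s : Term A Γ b) :
    Den (termModel A) (List.range Γ.length) s.1 Γ b (FreeHom.mk s) := by
  obtain ⟨s, hs⟩ := s
  obtain ⟨m, hm⟩ := Typed.exists_den_zip (termModel A) (xs := List.range Γ.length)
    (by rwa [zip_range]) (by simp)
  obtain ⟨h, hp⟩ := hm.isClassOf (ρ := fun x => x) (by simp)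
  have e : s.rename (fun x => x) = s := s.rename_id
  obtain rfl : m = FreeHom.mk ⟨s, hs⟩ := by
    rw [hp]
    congr 1
    exact Subtype.ext e
  exact hm

end TermModel

/-! ### Homomorphisms of models -/

theorem TRel.mapHom {O : Type u} {H : List O → O → Type v} {H' : List O → O → Type v₁}
    {φ : ∀ {as : List O} {b : O}, H as b → H' as b} {α : Type u₂} {ι : Type w}
    {P : List α → ι → ∀ (Γ : List O) (b : O), H Γ b → Prop}
    {P' : List α → ι → ∀ (Γ : List O) (b : O), H' Γ b → Prop} {xs : List α} {ts : List ι}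
    {Γ as : List O} {gs : Tuple H Γ as} (h : TRel P xs ts Γ as gs)
    (hP : ∀ xs s Γ b (g : H Γ b), P xs s Γ b g → P' xs s Γ b (φ g)) :
    TRel P' xs ts Γ as (gs.mapHom φ) := by
  induction h with
  | nil => exact .nil
  | cons e h _ ih => exact .cons e (hP _ _ _ _ _ h) ih

section ModelHom

variable {A : AutSignature.{u, v}}

/-- A homomorphism of models. It preserves the inverses of the universal bijections too. -/
structure IsModelHom (𝓜 : Model.{u, v, w} A) (𝓝 : Model.{u, v, u₂} A)
    (φ : ∀ {as : List A.Node} {b : A.Node}, 𝓜.H as b → 𝓝.H as b) : Prop where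
  id (a : A.Node) : φ (𝓜.M.id a) = 𝓝.M.id a
  comp {Γ as : List A.Node} {b : A.Node} (f : 𝓜.H as b) (gs : Tuple 𝓜.H Γ as) :
    φ (𝓜.M.comp f gs) = 𝓝.M.comp (φ f) (gs.mapHom φ)
  act {m n : ℕ} (e : Fin m ≃ Fin n) {a : Fin n → A.Node} {b : A.Node} {Γ Δ : List A.Node}
    (hΓ : Γ = List.ofFn a) (hΔ : Δ = List.ofFn (a ∘ e)) (f : 𝓜.H Γ b) :
    φ (𝓜.S.act e hΓ hΔ f) = 𝓝.S.act e hΓ hΔ (φ f)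
  re (as : List A.Node) : φ (𝓜.re as) = 𝓝.re as
  ap (as : List A.Node) (b : A.Node) : φ (𝓜.ap as b) = 𝓝.ap as b
  gen {as : List A.Node} {b : A.Node} (f : A.Arr as b) : φ (𝓜.gen f) = 𝓝.gen f

namespace IsModelHom

variable {𝓜 : Model.{u, v, w} A} {𝓝 : Model.{u, v, u₂} A}
  {φ : ∀ {as : List A.Node} {b : A.Node}, 𝓜.H as b → 𝓝.H as b}

theorem ids (hφ : IsModelHom 𝓜 𝓝 φ) (as : List A.Node) :
    (Tuple.ids 𝓜.M.id as).mapHom φ = Tuple.ids 𝓝.M.id as := by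
  rw [Tuple.mapHom_ids]
  congr 1
  exact funext hφ.id

theorem unre (hφ : IsModelHom 𝓜 𝓝 φ) {as δ : List A.Node} {b : A.Node} (f : 𝓜.H (as ++ δ) b) :
    φ (𝓜.unre f) = 𝓝.unre (φ f) := by
  apply 𝓝.eq_unre
  have := hφ.comp (𝓜.unre f) (.cons (𝓜.re as) (Tuple.ids 𝓜.M.id δ) rfl)
  rw [𝓜.unre_spec, Tuple.mapHom, hφ.re, hφ.ids] at this
  exact this.symm

theorem ev (hφ : IsModelHom 𝓜 𝓝 φ) (as : List A.Node) (b : A.Node) :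
    φ (𝓜.M.comp (𝓜.ap as b)
      (.cons (𝓜.M.id _) (.cons (𝓜.re as) .nil (List.append_nil as).symm) rfl)) =
      𝓝.M.comp (𝓝.ap as b)
        (.cons (𝓝.M.id _) (.cons (𝓝.re as) .nil (List.append_nil as).symm) rfl) := by
  rw [hφ.comp, Tuple.mapHom, Tuple.mapHom, Tuple.mapHom, hφ.id, hφ.re, hφ.ap]

theorem lamb (hφ : IsModelHom 𝓜 𝓝 φ) {γ as : List A.Node} {b : A.Node} (f : 𝓜.H (γ ++ as) b) :
    φ (𝓜.lamb f) = 𝓝.lamb (φ f) := by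
  apply 𝓝.eq_lamb
  have := hφ.comp (𝓜.ap as b)
    (.cons (𝓜.lamb f) (.cons (𝓜.re as) .nil (List.append_nil as).symm) rfl)
  rw [𝓜.lamb_spec, Tuple.mapHom, Tuple.mapHom, Tuple.mapHom, hφ.re, hφ.ap] at this
  exact this.symm

theorem reord (hφ : IsModelHom 𝓜 𝓝 φ) {α : Type*} {xs ys : List α} {Γ Δ : List A.Node}
    {b c : A.Node} {f : 𝓜.H Γ b} {g : 𝓜.H Δ c} (r : Reord 𝓜.S xs Γ b f ys Δ c g) :
    Reord 𝓝.S xs Γ b (φ f) ys Δ c (φ g) := by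
  cases r with
  | mk e x a hΓ hΔ f hx hy => rw [hφ.act]; exact .mk e x a hΓ hΔ _ hx hy

theorem isOp (hφ : IsModelHom 𝓜 𝓝 φ) {u : Raw A} {ts : List (Raw A)} {as : List A.Node}
    {b : A.Node} {o : 𝓜.H as b}
    (h : IsOp 𝓜 u ts as b o) : IsOp 𝓝 u ts as b (φ o) := by
  cases h with
  | tup ss as => rw [hφ.re]; exact .tup ss as
  | app s t as b => rw [hφ.ap]; exact .app s t as b
  | con f ss => rw [hφ.gen]; exact .con f ss

theorem den (hφ : IsModelHom 𝓜 𝓝 φ) {xs : List ℕ} {s : Raw A} {Γ : List A.Node} {b : A.Node}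
    {m : 𝓜.H Γ b}
    (h : Den 𝓜 xs s Γ b m) : Den 𝓝 xs s Γ b (φ m) := by
  induction h using Den.ind with
  | var x a => rw [hφ.id]; exact .var x a
  | op ho _ ih hn r =>
    have r' := hφ.reord r
    rw [hφ.comp] at r'
    exact .op (hφ.isOp ho) (ih.mapHom fun _ _ _ _ _ h => h.2) hn r'
  | lam hx _ ih r =>
    have r' := hφ.reord r
    rw [hφ.lamb] at r'
    exact .lam hx ih r'
  | sub _ _ ih ih' hn r =>
    have r' := hφ.reord r
    rw [hφ.comp, hφ.unre, Tuple.mapHom, hφ.ids] at r'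
    exact .sub ih ih' hn r'

end IsModelHom

end ModelHom

/-! ### The interpretation of classes of terms -/

section Interp

variable {A : AutSignature.{u, v}} (𝓜 : Model.{u, v, w} A)

theorem FreeHom.exists_den {as : List A.Node} {b : A.Node} (q : FreeHom A as b) :
    ∃ m : 𝓜.H as b, Den 𝓜 (List.range as.length) q.out.1 as b m := by
  refine Typed.exists_den_zip 𝓜 ?_ (by simp)
  rw [zip_range]
  exact q.out.2

/-- The interpretation of a class of terms in a model. -/
noncomputable def interp {as : List A.Node} {b : A.Node} (q : FreeHom A as b) : 𝓜.H as b :=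
  (q.exists_den 𝓜).choose

variable {𝓜}

theorem Term.den_interp {as : List A.Node} {b : A.Node} (s : Term A as b) :
    Den 𝓜 (List.range as.length) s.1 as b (interp 𝓜 (.mk s)) := by
  refine (Den.of_conv ?_).2 ((FreeHom.mk s).exists_den 𝓜).choose_spec
  rw [zip_range]
  exact FreeHom.conv_out s

theorem interp_eq {as : List A.Node} {b : A.Node} {s : Term A as b} {m : 𝓜.H as b}
    (h : Den 𝓜 (List.range as.length) s.1 as b m) : interp 𝓜 (.mk s) = m := s.den_interp.eq h

/-- The model of classes of terms is initial: `φ` preserves the interpretation of a term `s`, which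
is its class in the source, and `interp 𝓜 [s]` in the target. -/
theorem IsModelHom.eq_interp {φ : ∀ {as : List A.Node} {b : A.Node}, FreeHom A as b → 𝓜.H as b}
    (hφ : IsModelHom (termModel A) 𝓜 φ) {as : List A.Node} {b : A.Node} (q : FreeHom A as b) :
    φ q = interp 𝓜 q := by
  obtain ⟨s, rfl⟩ := q.mk_surjective
  exact (interp_eq (hφ.den s.den)).symm

/-- The tuple of the interpretations of terms interprets the substitution of these terms. -/
theorem Tuple.substRel_interp {Γ as : List A.Node} (ts : Tuple (Term A) Γ as) :
    TRel (SubstRel 𝓜 ts.toSubst) (List.range Γ.length) (List.range as.length) Γ as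
      (ts.mapHom fun t => interp 𝓜 (.mk t)) := by
  have key : ∀ k, TRel (Den 𝓜) ((List.range Γ.length).map (· + k))
      (List.ofFn fun i : Fin as.length => (ts.toSubst i).shift k) Γ as
      (ts.mapHom fun t => interp 𝓜 (.mk t)) := by
    induction ts with
    | nil => exact fun _ => .nil
    | @cons γ δ Γ a as g gs h ih =>
      intro k
      subst h
      rw [List.length_append, List.range_add, List.map_append, List.map_map, List.length_cons,
        List.ofFn_succ]
      refine .cons rfl (g.den_interp.shift k) ?_
      have := ih (γ.length + k)
      rw [show (fun x => x + (γ.length + k)) = (· + k) ∘ (γ.length + ·) by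
        funext x; simp only [Function.comp]; omega] at this
      convert this using 2
      funext i
      exact Raw.shift_shift _ _ _
  have := key 0
  simp only [shift_zero] at this
  rw [show (List.ofFn fun i : Fin as.length => ts.toSubst i) =
    (List.range as.length).map ts.toSubst by apply List.ext_get <;> simp] at this
  rw [show ((List.range Γ.length).map (· + 0)) = List.range Γ.length from List.map_id _] at this
  exact this.of_map

variable (𝓜) in
theorem isModelHom_interp : IsModelHom (termModel A) 𝓜 (interp 𝓜) where
  id a := interp_eq (s := Term.id a) (.var 0 a)
  comp f gs := by
    obtain ⟨s, rfl⟩ := FreeHom.mk_surjective f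
    obtain ⟨ts, rfl⟩ := FreeHom.exists_mapHom gs
    refine (congrArg _ (FreeHom.comp_mk s ts)).trans ?_
    refine (interp_eq (s.den_interp.subst ts.substRel_interp List.nodup_range)).trans ?_
    exact congrArg _ (Tuple.mapHom_mapHom _ _ ts).symm
  act {m n} e a b Γ Δ hΓ hΔ f := by
    obtain ⟨s, rfl⟩ := FreeHom.mk_surjective f
    refine interp_eq (s := s.act e hΓ hΔ) ?_
    subst hΓ hΔ
    have h := (s.den_interp (𝓜 := 𝓜)).rename (ρ := permRen e) (fun x y h => by
      have := congrArg (permRen e.symm) h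
      have h' := permRen_symm_permRen e.symm
      rw [e.symm_symm] at h'
      rwa [h', h'] at this)
    refine h.reord ?_
    refine .mk e (fun i => (e.symm i : ℕ)) a rfl rfl _ ?_ ?_
    · rw [List.length_ofFn, Term.map_permRen]
    · apply List.ext_get <;> simp
  re as := interp_eq (s := Term.re as) (den_varTup as)
  ap as b := (congrArg _ (FreeHom.ap_eq as b)).trans
    (interp_eq (s := Term.ap as b) ((IsOp.app _ _ as b).den_vars rfl))
  gen {as b} f := interp_eq (s := Term.con f)
    ((IsOp.con f _).den_vars (by apply List.ext_get <;> simp))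

end Interp

/-! ### The free autonomous multicategory -/

namespace AutonomousMulticategory

variable {O : Type u₁} {H : List O → O → Type v₁} (N : AutonomousMulticategory O H)

theorem ap_spec_of_heq {l t : O} {as : List O} {b : O} (ht : t = N.rep.tensor as)
    (hl : l = N.closed.lolli as b) {r : H as t} (hr : HEq r (N.rep.re as)) {p : H [l, t] b}
    (hp : HEq p (N.ap as b)) {gs : Tuple H (l :: as) [l, t]}
    (hg : gs = Tuple.cons (γ := [l]) (N.id l) (.cons r .nil (List.append_nil as).symm) rfl) :
    HEq (N.comp p gs) (N.closed.ev as b) := by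
  subst ht hl hg
  cases hr
  cases hp
  exact heq_of_eq (N.ap_spec as b)

theorem eq_ap_of_heq {l t : O} {as : List O} {b : O} (ht : t = N.rep.tensor as)
    (hl : l = N.closed.lolli as b) {r : H as t} (hr : HEq r (N.rep.re as)) {p : H [l, t] b}
    {gs : Tuple H (l :: as) [l, t]}
    (hg : gs = Tuple.cons (γ := [l]) (N.id l) (.cons r .nil (List.append_nil as).symm) rfl)
    (h : HEq (N.comp p gs) (N.closed.ev as b)) : HEq p (N.ap as b) := by
  subst ht hl hg
  cases hr
  exact heq_of_eq (N.eq_ap (eq_of_heq h))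

end AutonomousMulticategory

section Universal

variable {A : AutSignature.{u, v}} {O : Type u₁} {H : List O → O → Type v₁}
  {S : AutonomousMulticategory O H}

theorem Tuple.map_eq_push {H₁ : List A.Node → A.Node → Type u₂} (F : A.Node → O)
    (φ : ∀ {as : List A.Node} {b : A.Node}, H₁ as b → PullbackHom H F as b) {Γ as : List A.Node}
    (gs : Tuple H₁ Γ as) : gs.map F φ = (gs.mapHom (H' := PullbackHom H F) φ).push F := by
  induction gs with
  | nil => rfl
  | cons g gs h ih => rw [mapHom, push_cons, map, ih]

/-- The evaluation of the model is that of `S`. -/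
theorem SignatureMap.ev_heq (i : SignatureMap A S) (as : List A.Node) (b : A.Node) :
    HEq (i.model.M.comp (i.model.ap as b) (.cons (i.model.M.id _)
      (.cons (i.model.re as) .nil (List.append_nil as).symm) rfl))
      (S.closed.ev (as.map i.obj) (i.obj b)) :=
  S.ap_spec_of_heq (i.obj_tensor as) (i.obj_lolli as b) (i.re_heq as) (i.ap_heq as b) rfl

/-- The autonomous functor that extends a map of signatures. -/
noncomputable def SignatureMap.extend (i : SignatureMap A S) :
    AutonomousFunctor (freeAut A) S where
  obj := i.obj
  map q := interp i.model q
  map_id a := (isModelHom_interp i.model).id a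
  map_comp f gs := ((isModelHom_interp i.model).comp f gs).trans
    (congrArg (S.comp _) (Tuple.map_eq_push i.obj _ gs).symm)
  map_act e _ _ _ _ hΓ hΔ f := (isModelHom_interp i.model).act e hΓ hΔ f
  obj_tensor := i.obj_tensor
  map_re as := (heq_of_eq ((isModelHom_interp i.model).re as)).trans (i.re_heq as)
  obj_lolli := i.obj_lolli
  map_ev as b := by
    refine HEq.trans (heq_of_eq ?_) (i.ev_heq as b)
    exact (congrArg (interp i.model) ((freeAut A).ap_spec as b).symm).trans
      ((isModelHom_interp i.model).ev as b)

theorem SignatureMap.extend_extends (i : SignatureMap A S) : i.extend.Extends i where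
  obj_eq := rfl
  map_eta f := heq_of_eq ((isModelHom_interp i.model).gen f)

/-- An autonomous functor that extends a map of signatures is a homomorphism of models. -/
theorem AutonomousFunctor.Extends.heq_interp {F : AutonomousFunctor (freeAut A) S}
    {i : SignatureMap A S} (h : F.Extends i) {as : List A.Node} {b : A.Node} (q : FreeHom A as b) :
    HEq (F.map q) (interp i.model q) := by
  -- The map of objects of `i` is made definitionally equal to that of `F`.
  obtain ⟨obj, ht, hl, gen⟩ := i
  obtain ⟨ho, hm⟩ := h
  dsimp only at ho
  subst ho
  set i : SignatureMap A S := ⟨F.obj, ht, hl, gen⟩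
  have hφ : IsModelHom (termModel A) i.model fun {_ _} q => F.map q :=
    { id a := F.map_id a
      comp f gs := (F.map_comp f gs).trans (congrArg (S.comp _) (Tuple.map_eq_push F.obj _ gs))
      act e _ _ _ _ hΓ hΔ f := F.map_act e hΓ hΔ f
      re as := eq_of_heq ((F.map_re as).trans (i.re_heq as).symm)
      ap as b := by
        refine eq_of_heq (HEq.trans ?_ (i.ap_heq as b).symm)
        refine S.eq_ap_of_heq (i.obj_tensor as) (i.obj_lolli as b) (F.map_re as)
          (gs := (Tuple.cons ((freeAut A).id _)
            (.cons ((freeAut A).rep.re as) .nil (List.append_nil as).symm) rfl).map F.obj F.map)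
            ?_ ?_
        · simp only [Tuple.map, F.map_id]
          rfl
        · have := F.map_comp ((freeAut A).ap as b) (.cons ((freeAut A).id _)
            (.cons ((freeAut A).rep.re as) .nil (List.append_nil as).symm) rfl)
          rw [(freeAut A).ap_spec] at this
          exact (heq_of_eq this.symm).trans (F.map_ev as b)
      gen f := eq_of_heq (hm f) }
  exact heq_of_eq (hφ.eq_interp q)

theorem AutonomousFunctor.ext_of_heq {F G : AutonomousFunctor (freeAut A) S} (ho : F.obj = G.obj)
    (hm : ∀ {as : List A.Node} {b : A.Node} (q : FreeHom A as b), HEq (F.map q) (G.map q)) :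
    F = G := by
  obtain ⟨obj, m, _, _, _, _, _, _, _⟩ := F
  obtain ⟨obj', m', _, _, _, _, _, _, _⟩ := G
  dsimp only at ho
  subst ho
  obtain rfl : @m = @m' := by
    funext as b q
    exact eq_of_heq (hm q)
  rfl

end Universal

theorem mainTheorem10 (A : AutSignature.{u, v}) :
    ∃ M : AutonomousMulticategory A.Node (FreeHom A), IsTermMulticategory M ∧
      ∀ {O : Type u₁} {H : List O → O → Type v₁} (S : AutonomousMulticategory O H)
        (i : SignatureMap A S), ∃! F : AutonomousFunctor M S, F.Extends i :=
  ⟨freeAut A, isTermMulticategory_freeAut A, fun _ i => ⟨i.extend, i.extend_extends, fun _ h =>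
    AutonomousFunctor.ext_of_heq h.obj_eq fun q =>
      (h.heq_interp q).trans (i.extend_extends.heq_interp q).symm⟩⟩
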